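/- **Theorem (Total number of $\mathbf y$-gradients).** *Problem.* Consider $\min_{\mathbf x\in\mathbb R^{n_1}}\max_{\mathbf y\in\mathbb R^{n_2}}\frac1m\sum_{i=1}^m f_i(\mathbf x,\mathbf y)+g(\mathbf x)-h(\mathbf y)$ with $g,h$ closed proper convex and $\mathrm{ri}(\mathrm{dom}\,h)\neq\emptyset$. Each $f_i$ is differentiable with $L$-Lipschitz gradient on an open set $\mathcal Z\supseteq \mathrm{dom}(g)\times\mathrm{dom}(h)$. For $\mathbf x\in\mathrm{dom}(g)$ and $\mathbf y,\tilde{\mathbf y}\in\mathrm{dom}(h)$, one has $\langle \mathbf y-\tilde{\mathbf y},\nabla_{\mathbf y}f_i(\mathbf x,\mathbf y)-\nabla_{\mathbf y}f_i(\mathbf x,\tilde{\mathbf y})\rangle\le-\mu\|\mathbf y-\tilde{\mathbf y}\|^2$ with $\mu>0$, and $\|\nabla_{\mathbf y}f_i(\mathbf x,\mathbf y)-\nabla_{\mathbf y}f_i(\mathbf x,\tilde{\mathbf y})\|\le L_y\|\mathbf y-\tilde{\mathbf y}\|$. Put $\kappa=L/\mu$ and $\kappa_y=L_y/\mu$, with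 $\kappa,\kappa_y\ge1$ (automatic if $\mathrm{dom}(h)$ has two points). Let $p(\mathbf x)=\max_{\mathbf y}\{\frac1m\sum_i f_i(\mathbf x,\mathbf y)-h(\mathbf y)\}$ and suppose $p+g$ has a minimizer $\mathbf x^*$ with finite value. *Network.* The matrix $\mathbf W\in\mathbb R^{m\times m}$ on a connected graph satisfies: $w_{ij}=0$ if $i\ne j$ are not adjacent; $\rho=\|\mathbf W-\frac1m\mathbf 1\mathbf 1^\top\|_2<1$; $\mathrm{Null}(\mathbf W-\mathbf I)=\mathrm{span}\{\mathbf 1\}$; $\mathbf W^\top\mathbf 1=\mathbf 1$; $\|\mathbf W-\mathbf I\|_2\le2$. *Method (D-GDMax).* Let $\eta_x=\frac{(1-\rho)^2}{5L\sqrt{1+6\kappa^2}}$, $\eta_\lambda=\frac{(1-\rho)^2}{L(9\kappa+2)}$, $\delta_t=\frac{(1-\rho)^2}{8\kappa(1+t)}$. Start from $\mathbf x_i^0=\mathbf x^0\in\mathrm{dom}(g)$ and $\boldsymbol\lambda_i^0=\mathbf 0$; find $\mathbf y_i^0$ as below and set $\mathbf v_i^0=\nabla_{\mathbf x}f_i(\mathbf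 x_i^0,\mathbf y_i^0)$. For $t\ge0$ and each $i$: - $\mathbf x_i^{t+1}=\mathrm{prox}_{\eta_xg}\big(\sum_jw_{ij}\mathbf x_j^t-\eta_x\mathbf v_i^t\big)$; - $\boldsymbol\lambda_i^{t+1}=\boldsymbol\lambda_i^t+\frac{L\eta_\lambda}{2\sqrt m}\big(\sum_jw_{ij}\mathbf y_j^t-\mathbf y_i^t\big)$; - find $\mathbf y_i^{t+1}$ as below; - $\mathbf v_i^{t+1}=\sum_jw_{ij}\mathbf v_j^t+\nabla_{\mathbf x}f_i(\mathbf x_i^{t+1},\mathbf y_i^{t+1})-\nabla_{\mathbf x}f_i(\mathbf x_i^t,\mathbf y_i^t)$. Put $\tilde{\boldsymbol\lambda}_i^t=\sum_jw_{ji}\boldsymbol\lambda_j^t-\boldsymbol\lambda_i^t$ and $d_i^t(\mathbf y)=f_i(\mathbf x_i^t,\mathbf y)-h(\mathbf y)-\frac{L\sqrt m}2\langle\tilde{\boldsymbol\lambda}_i^t,\mathbf y\rangle$. The point $\mathbf y_i^t$ is computed by APG applied to $\min(-d_i^t)$, warm-started at $\mathbf y_i^{t-1}$ (for $t=0$ at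 a given $\mathbf y_i^{-1}\in\mathrm{dom}(h)$), with $$s_i^t=\max\Big\{1,\Big\lceil\sqrt{\kappa_y}\ln\tfrac{16L_y(\max d_i^t-d_i^t(\mathbf y_i^{t-1}))}{\delta_t^2}\Big\rceil\Big\}$$ gradient evaluations ($\ln 0$ is read as $0$): $s_i^t-1$ accelerated steps and then one proximal gradient step $\mathbf u\mapsto\mathrm{prox}_{h/L_y}(\mathbf u-\nabla\psi(\mathbf u)/L_y)$, where $\psi=-f_i(\mathbf x_i^t,\cdot)+\frac{L\sqrt m}{2}\langle\tilde{\boldsymbol\lambda}_i^t,\cdot\rangle$. With $\alpha=1/\sqrt{\kappa_y}$, the accelerated step is either of the following. - (a) *Extrapolated form:* $\mathbf z=\mathbf u_k+\frac{1-\alpha}{1+\alpha}(\mathbf u_k-\mathbf u_{k-1})$, $\mathbf u_{k+1}=\mathrm{prox}_{h/L_y}(\mathbf z-\nabla\psi(\mathbf z)/L_y)$, with $\mathbf u_{-1}=\mathbf u_0$. As $\mathbf z$ may leave $\mathrm{dom}(h)$, in this case it is assumed that $f_i(\mathbf x,\cdot)$ is differentiable on $2\,\mathrm{dom}(h)-\mathrm{dom}(h)$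 for $\mathbf x\in\mathrm{dom}(g)$ and that the above inequalities with $\mu$ and $L_y$ hold on that set. - (b) *Form with feasible query points:* $\mathbf z=\frac{\mathbf u_k+\alpha\mathbf w_k}{1+\alpha}$, $\mathbf w_{k+1}=\mathrm{prox}_{(\alpha/\mu)h}\big((1-\alpha)\mathbf w_k+\alpha\mathbf z-\frac\alpha\mu\nabla\psi(\mathbf z)\big)$, $\mathbf u_{k+1}=(1-\alpha)\mathbf u_k+\alpha\mathbf w_{k+1}$, with $\mathbf w_0=\mathbf u_0$. No further assumption is made. *Constants.* Let $$\Phi(\mathbf X,\boldsymbol\Lambda,\mathbf Y)=\tfrac1m\sum_i(f_i(\mathbf x_i,\mathbf y_i)-h(\mathbf y_i))-\tfrac L{2\sqrt m}\langle\boldsymbol\Lambda,(\mathbf W-\mathbf I)\mathbf Y\rangle,$$ $\phi(\mathbf x,\boldsymbol\Lambda)=\max_{\mathbf Y}\Phi(\mathbf 1\mathbf x^\top,\boldsymbol\Lambda,\mathbf Y)+g(\mathbf x)$ and $\phi_0=\phi(\mathbf x^0,\mathbf 0)-(p+g)(\mathbf x^*)$. Suppose $\sum_i\|\mathbf v_i^0-\frac1m\sum_j\mathbf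 v_j^0\|^2\le2mL\kappa(1-\rho)$. For $\varepsilon>0$ let $$T=\Big\lceil\tfrac1{\varepsilon^2}\max\Big\{\tfrac{64(10L\kappa(\phi_0+1)+1)}{(1-\rho)^2},\tfrac{4096L\kappa}{1-\rho},800\Big\}\Big\rceil,$$ and, with $B=2L+L\sqrt m+2$, $$D=\big(L(11+\sqrt m)+22m\kappa^2B\big)\tfrac{(\phi_0+1+\frac1{6L\kappa})(1-\rho)^2}{L(4\kappa+1)}+\tfrac{m\kappa(1-\rho)^2(\frac L2+\kappa^2B)}{L(1+6\kappa^2)}+\tfrac{m(\frac L2+\kappa^2B)(1-\rho)^4}{64L^2\kappa^2}+\tfrac{(L+\frac{L\sqrt m}2+1)(1-\rho)^4}{64\mu^2\kappa^2}+\tfrac{(1-\rho)^4}{128\kappa^2}.$$ *Conclusion.* For all $t\ge0$ and all $i$, $\mathrm{dist}(\mathbf 0,\partial d_i^t(\mathbf y_i^t))\le\delta_t$. For every $i$, the total number $T_y=\sum_{t=0}^Ts_i^t$ of evaluations of $\nabla_{\mathbf y}f_i$ made by agent $i$ up to iteration $T$ satisfies $$T_y\le\sqrt{\kappa_y}\,\max\Big\{0,\ln\tfrac{1024\kappa^2L_y(\max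 d_i^0-d_i^0(\mathbf y_i^{-1}))}{(1-\rho)^4}\Big\}+T\sqrt{\kappa_y}\,\ln\tfrac{1024\kappa^2L_yD(T+1)^2}{(1-\rho)^4}+T+1$$ (if $\max d_i^0=d_i^0(\mathbf y_i^{-1})$, the first term is read as $0$). -/

import Mathlib

noncomputable section

namespace DGDMax

open scoped BigOperators

/-- `ℝⁿ` with the Euclidean norm. -/
abbrev E (n : ℕ) : Type := EuclideanSpace ℝ (Fin n)

/-! ### Extended-valued convex functions -/

/-- Effective domain. -/
def dom {n : ℕ} (r : E n → EReal) : Set (E n) := {x | r x ≠ ⊤}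

/-- Closed (lower semicontinuous) proper convex functions. -/
structure IsClosedConvex {n : ℕ} (r : E n → EReal) : Prop where
  ne_bot : ∀ x, r x ≠ ⊥
  dom_nonempty : (dom r).Nonempty
  lsc : LowerSemicontinuous r
  convex_epi : Convex ℝ {q : E n × ℝ | r q.1 ≤ ((q.2 : ℝ) : EReal)}

/-- `prox_r(x) = argmin_u { r(u) + ‖u - x‖² / 2 }` (unique for `r` closed proper convex). -/
def prox {n : ℕ} (r : E n → EReal) (x : E n) : E n :=
  Classical.epsilon fun u => ∀ u', r u + ((‖u - x‖ ^ 2 / 2 : ℝ) : EReal) ≤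
    r u' + ((‖u' - x‖ ^ 2 / 2 : ℝ) : EReal)

/-- `c · r` for a real number `c` and an extended-valued function `r`. -/
def scale {n : ℕ} (c : ℝ) (r : E n → EReal) : E n → EReal := fun x => (c : EReal) * r x

/-- The superdifferential of a concave extended-valued function `d` at `y`
(empty if `d y = -∞`). -/
def superdiff {n : ℕ} (d : E n → EReal) (y : E n) : Set (E n) :=
  {ζ | d y ≠ ⊥ ∧ ∀ z, d z ≤ d y + ((inner ℝ ζ (z - y) : ℝ) : EReal)}

/-! ### The problem -/

/-- Data of `min_x max_y (1/m) ∑ f_i(x,y) + g(x) - h(y)` on a network of `m` agents with mixing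
matrix `W`, together with the constants `L`, `L_y`, `μ`. -/
structure Problem (m n₁ n₂ : ℕ) where
  f : Fin m → E n₁ → E n₂ → ℝ
  g : E n₁ → EReal
  h : E n₂ → EReal
  graph : SimpleGraph (Fin m)
  W : Matrix (Fin m) (Fin m) ℝ
  L : ℝ
  Ly : ℝ
  μ : ℝ

namespace Problem

variable {m n₁ n₂ : ℕ} (p : Problem m n₁ n₂)

/-- `f_i` as a function of `z = [x; y] ∈ ℝ^{n₁+n₂}` (Euclidean norm). -/
def fz (i : Fin m) (z : WithLp 2 (E n₁ × E n₂)) : ℝ := p.f i z.fst z.snd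

/-- Partial gradients. -/
def gradX (i : Fin m) (x : E n₁) (y : E n₂) : E n₁ := gradient (fun x' => p.f i x' y) x

def gradY (i : Fin m) (x : E n₁) (y : E n₂) : E n₂ := gradient (fun y' => p.f i x y') y

def κ : ℝ := p.L / p.μ

def κy : ℝ := p.Ly / p.μ

/-- `ρ = ‖W - (1/m) 1 1ᵀ‖₂` (spectral norm). -/
def ρ : ℝ := ‖Matrix.toEuclideanCLM (n := Fin m) (𝕜 := ℝ) (p.W - Matrix.of fun _ _ => 1 / (m : ℝ))‖

/-- `p(x) = max_y { (1/m) ∑ f_i(x,y) - h(y) }`. -/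
def primal (x : E n₁) : EReal :=
  ⨆ y : E n₂, ((1 / (m : ℝ) * ∑ i, p.f i x y : ℝ) : EReal) - p.h y

/-- `Φ(X, Λ, Y) = (1/m) ∑ (f_i(x_i,y_i) - h(y_i)) - L/(2√m) ⟨Λ, (W - I) Y⟩`. -/
def Phi (X : Fin m → E n₁) (Lam Y : Fin m → E n₂) : EReal :=
  ((1 / (m : ℝ) * ∑ i, p.f i (X i) (Y i)
      - p.L / (2 * √m) * ∑ i, inner ℝ (Lam i) (∑ j, p.W i j • Y j - Y i) : ℝ) : EReal)
    - ((1 / (m : ℝ) : ℝ) : EReal) * ∑ i, p.h (Y i)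

/-- `P(x, Λ) = max_Y Φ(1xᵀ, Λ, Y)`. -/
def P (x : E n₁) (Lam : Fin m → E n₂) : EReal := ⨆ Y : Fin m → E n₂, p.Phi (fun _ => x) Lam Y

/-- `φ(x, Λ) = P(x, Λ) + g(x)`. -/
def phi (x : E n₁) (Lam : Fin m → E n₂) : EReal := p.P x Lam + p.g x

/-- The standing assumptions on the objective. The last two fields follow from the others as soon
as `dom h` has two points. -/
structure ObjAssumption : Prop where
  g_closed : IsClosedConvex p.g
  h_closed : IsClosedConvex p.h
  relint : (intrinsicInterior ℝ (dom p.h)).Nonempty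
  smooth : ∃ Z : Set (WithLp 2 (E n₁ × E n₂)), IsOpen Z ∧
    (∀ x ∈ dom p.g, ∀ y ∈ dom p.h, WithLp.toLp 2 (x, y) ∈ Z) ∧
    ∀ i, (∀ z ∈ Z, DifferentiableAt ℝ (p.fz i) z) ∧
      ∀ z ∈ Z, ∀ z' ∈ Z, ‖gradient (p.fz i) z - gradient (p.fz i) z'‖ ≤ p.L * ‖z - z'‖
  mu_pos : 0 < p.μ
  strong_concave : ∀ i, ∀ x ∈ dom p.g, ∀ y ∈ dom p.h, ∀ y' ∈ dom p.h,
    inner ℝ (y - y') (p.gradY i x y - p.gradY i x y') ≤ -p.μ * ‖y - y'‖ ^ 2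
  smooth_y : ∀ i, ∀ x ∈ dom p.g, ∀ y ∈ dom p.h, ∀ y' ∈ dom p.h,
    ‖p.gradY i x y - p.gradY i x y'‖ ≤ p.Ly * ‖y - y'‖
  mu_le_L : p.μ ≤ p.L
  mu_le_Ly : p.μ ≤ p.Ly

/-- `x*` is a minimizer of `p + g` with finite optimal value. -/
def IsSolution (xs : E n₁) : Prop :=
  (∀ x, p.primal xs + p.g xs ≤ p.primal x + p.g x) ∧
    p.primal xs + p.g xs ≠ ⊤ ∧ p.primal xs + p.g xs ≠ ⊥

/-- The assumptions on the network and the mixing matrix. -/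
structure MixAssumption : Prop where
  connected : p.graph.Connected
  support : ∀ i j, i ≠ j → ¬ p.graph.Adj i j → p.W i j = 0
  rho_lt_one : p.ρ < 1
  null_space : LinearMap.ker (Matrix.toLin' (p.W - 1)) = Submodule.span ℝ {fun _ => (1 : ℝ)}
  transpose_one : p.W.transpose.mulVec (fun _ => (1 : ℝ)) = fun _ => 1
  norm_le_two : ‖Matrix.toEuclideanCLM (n := Fin m) (𝕜 := ℝ) (p.W - 1)‖ ≤ 2

/-! ### The local `y`-subproblems and the accelerated proximal gradient method (APG) -/

/-- `d(y) = f_i(x, y) - h(y) - (L√m/2) ⟨λ̃, y⟩`. -/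
def d (i : Fin m) (x : E n₁) (lt : E n₂) (y : E n₂) : EReal :=
  ((p.f i x y - p.L * √m / 2 * inner ℝ lt y : ℝ) : EReal) - p.h y

/-- The gap `max d - d(y₀)`. -/
def gap (i : Fin m) (x : E n₁) (lt y₀ : E n₂) : ℝ :=
  ((⨆ y, p.d i x lt y) - p.d i x lt y₀).toReal

/-- The gradient of the smooth part `y ↦ -f_i(x, y) + (L√m/2) ⟨λ̃, y⟩` of `-d`; one call costs one
evaluation of `∇_y f_i`. -/
def gradSmooth (i : Fin m) (x : E n₁) (lt y : E n₂) : E n₂ :=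
  (p.L * √m / 2) • lt - p.gradY i x y

end Problem

/-- Two standard forms of the constant-momentum APG for strongly convex composite problems:
`extrapolated` queries the gradient at `x_k + β (x_k - x_{k-1})`, which may lie outside `dom h`;
`feasible` queries it at convex combinations of points of `dom h`. Without the nonsmooth term
both generate the same points. -/
inductive APGForm
  | extrapolated
  | feasible

/-- State of the APG: the iterate `x_k`, an auxiliary point (`x_{k-1}` in the extrapolated form,
the prox-center `v_k` in the feasible form), and the number of gradient evaluations so far. -/
structure APGState (n : ℕ) where
  x : E n
  aux : E n
  evals : ℕ

namespace Problem

variable {m n₁ n₂ : ℕ} (p : Problem m n₁ n₂)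

/-- One accelerated step, with `α = √(μ/L_y) = 1/√κ_y`. -/
def apgStep (form : APGForm) (i : Fin m) (x : E n₁) (lt : E n₂) (s : APGState n₂) :
    APGState n₂ :=
  let α : ℝ := 1 / √p.κy
  match form with
  | .extrapolated =>
    let z := s.x + ((1 - α) / (1 + α)) • (s.x - s.aux)
    { x := prox (scale (1 / p.Ly) p.h) (z - (1 / p.Ly) • p.gradSmooth i x lt z)
      aux := s.x
      evals := s.evals + 1 }
  | .feasible =>
    let z := (1 / (1 + α)) • (s.x + α • s.aux)
    let v := prox (scale (α / p.μ) p.h)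
      ((1 - α) • s.aux + α • z - (α / p.μ) • p.gradSmooth i x lt z)
    { x := (1 - α) • s.x + α • v
      aux := v
      evals := s.evals + 1 }

/-- `k` accelerated steps from `y₀`. -/
def apgIter (form : APGForm) (i : Fin m) (x : E n₁) (lt y₀ : E n₂) (k : ℕ) : APGState n₂ :=
  (p.apgStep form i x lt)^[k] { x := y₀, aux := y₀, evals := 0 }

/-- APG started from `y₀`: `k` accelerated steps followed by one plain proximal gradient step, the
point of which is returned together with the total number of gradient evaluations. -/
def apg (form : APGForm) (i : Fin m) (x : E n₁) (lt y₀ : E n₂) (k : ℕ) : E n₂ × ℕ :=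
  let s := p.apgIter form i x lt y₀ k
  (prox (scale (1 / p.Ly) p.h) (s.x - (1 / p.Ly) • p.gradSmooth i x lt s.x), s.evals + 1)

/-- The number of APG iterations to reach accuracy `δ` from `y₀`:
`⌈√κ_y ln (16 L_y (max d - d(y₀)) / δ²)⌉`, but at least one. -/
def apgBudget (i : Fin m) (x : E n₁) (lt y₀ : E n₂) (δ : ℝ) : ℕ :=
  max 1 ⌈√p.κy * Real.log (16 * p.Ly * p.gap i x lt y₀ / δ ^ 2)⌉₊

/-- The `y`-update: the final proximal gradient step counts as the last one of the
`apgBudget` iterations. -/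
def solveY (form : APGForm) (i : Fin m) (x : E n₁) (lt y₀ : E n₂) (δ : ℝ) : E n₂ × ℕ :=
  p.apg form i x lt y₀ (p.apgBudget i x lt y₀ δ - 1)

end Problem

/-! ### The D-GDMax method -/

/-- State of the method: `X^t`, `Λ^t`, `Y^t`, `V^t`, and, for each agent, the total number of
`y`-gradient evaluations so far. -/
structure State (m n₁ n₂ : ℕ) where
  x : Fin m → E n₁
  lam : Fin m → E n₂
  y : Fin m → E n₂
  v : Fin m → E n₁
  evals : Fin m → ℕ

/-- `λ̃_i = ∑_j w_{ji} λ_j - λ_i`. -/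
def lamTilde {m n₂ : ℕ} (W : Matrix (Fin m) (Fin m) ℝ) (lam : Fin m → E n₂) (i : Fin m) : E n₂ :=
  ∑ j, W j i • lam j - lam i

/-- `‖U_⊥‖_F²`, where `U_⊥` has the rows `u_i - (1/m) ∑_j u_j`. -/
def perpSq {m n : ℕ} (U : Fin m → E n) : ℝ :=
  ∑ i, ‖U i - (1 / (m : ℝ)) • ∑ j, U j‖ ^ 2

namespace Problem

variable {m n₁ n₂ : ℕ} (p : Problem m n₁ n₂)

/-- Initialization; `yinit i` is the starting point `y_i^{-1}` of the first local solve. -/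
def init (form : APGForm) (δ : ℕ → ℝ) (x0 : E n₁) (yinit : Fin m → E n₂) : State m n₁ n₂ :=
  let sol := fun i => p.solveY form i x0 0 (yinit i) (δ 0)
  { x := fun _ => x0
    lam := fun _ => 0
    y := fun i => (sol i).1
    v := fun i => p.gradX i x0 (sol i).1
    evals := fun i => (sol i).2 }

/-- Iteration `t → t + 1`; each local subproblem is warm-started at the previous `y_i`. -/
def step (form : APGForm) (ηx ηlam : ℝ) (δ : ℕ → ℝ) (t : ℕ) (s : State m n₁ n₂) :
    State m n₁ n₂ :=
  let x' := fun i => prox (scale ηx p.g) (∑ j, p.W i j • s.x j - ηx • s.v i)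
  let lam' := fun i => s.lam i + (p.L * ηlam / (2 * √m)) • (∑ j, p.W i j • s.y j - s.y i)
  let sol := fun i => p.solveY form i (x' i) (lamTilde p.W lam' i) (s.y i) (δ (t + 1))
  { x := x'
    lam := lam'
    y := fun i => (sol i).1
    v := fun i => ∑ j, p.W i j • s.v j + p.gradX i (x' i) (sol i).1 - p.gradX i (s.x i) (s.y i)
    evals := fun i => s.evals i + (sol i).2 }

/-- The state after `t` iterations. -/
def run (form : APGForm) (ηx ηlam : ℝ) (δ : ℕ → ℝ) (x0 : E n₁) (yinit : Fin m → E n₂) :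
    ℕ → State m n₁ n₂
  | 0 => p.init form δ x0 yinit
  | t + 1 => p.step form ηx ηlam δ t (run form ηx ηlam δ x0 yinit t)

/-! ### Parameters and constants -/

def ηx : ℝ := (1 - p.ρ) ^ 2 / (5 * p.L * √(1 + 6 * p.κ ^ 2))

def ηlam : ℝ := (1 - p.ρ) ^ 2 / (p.L * (9 * p.κ + 2))

def δ (t : ℕ) : ℝ := (1 - p.ρ) ^ 2 / (8 * p.κ * (1 + t))

/-- `φ₀ = φ(x⁰, 0) - (p + g)(x*)`. -/
def phi0 (x0 xs : E n₁) : ℝ := (p.phi x0 (fun _ => 0) - (p.primal xs + p.g xs)).toReal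

/-- The number `T` of iterations for target accuracy `ε`. -/
def iterCount (ε φ₀ : ℝ) : ℕ :=
  ⌈1 / ε ^ 2 * max (max (64 * (10 * p.L * p.κ * (φ₀ + 1) + 1) / (1 - p.ρ) ^ 2)
    (4096 * p.L * p.κ / (1 - p.ρ))) 800⌉₊

/-- The constant `D`. -/
def D (φ₀ : ℝ) : ℝ :=
  (p.L * (11 + √m) + 22 * m * p.κ ^ 2 * (2 * p.L + p.L * √m + 2))
      * ((φ₀ + 1 + 1 / (6 * p.L * p.κ)) * (1 - p.ρ) ^ 2 / (p.L * (4 * p.κ + 1)))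
    + m * p.κ * (1 - p.ρ) ^ 2 * (p.L / 2 + p.κ ^ 2 * (2 * p.L + p.L * √m + 2))
      / (p.L * (1 + 6 * p.κ ^ 2))
    + m * (p.L / 2 + p.κ ^ 2 * (2 * p.L + p.L * √m + 2)) * (1 - p.ρ) ^ 4
      / (64 * p.L ^ 2 * p.κ ^ 2)
    + (p.L + p.L * √m / 2 + 1) * (1 - p.ρ) ^ 4 / (64 * p.μ ^ 2 * p.κ ^ 2)
    + (1 - p.ρ) ^ 4 / (128 * p.κ ^ 2)

/-- What the extrapolated form of the APG needs in order to query gradients outside `dom h`: the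
smoothness and strong concavity of `f_i(x, ·)` also hold on the set `{2u - v : u, v ∈ dom h}`, which
contains all extrapolated points (and equals `dom h` if, for example, `dom h` is all of `ℝ^{n₂}`). -/
def ExtrapolationRegular : Prop :=
  let Y : Set (E n₂) := {y | ∃ u ∈ dom p.h, ∃ v ∈ dom p.h, y = (2 : ℝ) • u - v}
  ∀ i, ∀ x ∈ dom p.g, (∀ y ∈ Y, DifferentiableAt ℝ (p.f i x) y) ∧
    ∀ y ∈ Y, ∀ y' ∈ Y,
      ‖p.gradY i x y - p.gradY i x y'‖ ≤ p.Ly * ‖y - y'‖ ∧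
      inner ℝ (y - y') (p.gradY i x y - p.gradY i x y') ≤ -p.μ * ‖y - y'‖ ^ 2

end Problem

end DGDMax

end

/-! The cost of a local solve is √κ_y times the logarithm of (gap at the starting point)/δ_t², up to
constants and rounding. The count therefore reduces to one fact: at every warm start the gap is at
most the constant D, uniformly in t.

Accuracy of the local solves. Each accelerated step, in either form, contracts the energy "gap plus
μ/2 times the squared distance of an auxiliary point to the maximizer" by the factor 1 − 1/√κ_y
(`SmoothStrong.feasible_step`, `SmoothStrong.extrapolated_step`). The last proximal gradient step
turns a small gap into a small residual (`SmoothStrong.prox_grad_residual`). With the prescribed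
budget the residual is at most δ_t (`isApproxMax_solveY`), which is the first claim.

Warm starts. If y has residual δ for the old data (x, λ̃), then for new data its residual is at most
δ + L‖Δx‖ + (L√m/2)‖Δλ̃‖, and strong concavity bounds the new gap by the square of this over 2μ
(`IsApproxMax.gap_le`). It remains to bound one-step displacements.

Displacements. The merit function is P(x̄, Λ) + g(x̄), with x̄ the average of the x_i, plus weighted
consensus errors of X and of the tracking variable V. One iteration decreases it by multiples of
‖Δx̄‖² and ‖ΔΛ‖², up to an error of order δ_t² (`Invariant.merit_step_le`). Since δ_t is of order
1/(1+t), these errors are dominated by a telescoping sequence. Weak duality, P(x, Λ) ≥ p(x), bounds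
the merit below by the optimal value (`IsSolution.optVal_le`). So every displacement is bounded by
the initial merit gap (`displacement_bounds`), which gives the uniform bound `gap_warm_start_le`;
adding up the budgets finishes the proof. -/

noncomputable section

namespace DGDMax

open scoped BigOperators

/-! ### Closed convex functions and proximal maps -/

/-- `ξ` is a subgradient of `r` at `y`, in terms of real values on the effective domain. -/
def IsSubgrad {n : ℕ} (r : E n → EReal) (y ξ : E n) : Prop :=
  y ∈ dom r ∧ ∀ z ∈ dom r, (r y).toReal + inner ℝ ξ (z - y) ≤ (r z).toReal

section Convex

variable {n : ℕ} {r : E n → EReal}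

lemma IsClosedConvex.coe_toReal (hr : IsClosedConvex r) {x : E n} (hx : x ∈ dom r) :
    ((r x).toReal : EReal) = r x :=
  EReal.coe_toReal hx (hr.ne_bot x)

lemma IsClosedConvex.combo (hr : IsClosedConvex r) {x y : E n} (hx : x ∈ dom r) (hy : y ∈ dom r)
    {a b : ℝ} (ha : 0 ≤ a) (hb : 0 ≤ b) (hab : a + b = 1) :
    a • x + b • y ∈ dom r ∧
      (r (a • x + b • y)).toReal ≤ a * (r x).toReal + b * (r y).toReal := by
  have h := hr.convex_epi (x := (x, (r x).toReal)) (y := (y, (r y).toReal))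
    (by simp [hr.coe_toReal hx]) (by simp [hr.coe_toReal hy]) ha hb hab
  simp only [Set.mem_ofPred_eq, Prod.smul_mk, Prod.mk_add_mk, smul_eq_mul] at h
  have hd : a • x + b • y ∈ dom r := fun ht => by
    rw [ht] at h
    exact EReal.coe_ne_top _ (top_le_iff.mp h)
  refine ⟨hd, ?_⟩
  rw [← hr.coe_toReal hd] at h
  exact_mod_cast h

lemma IsClosedConvex.convex_dom (hr : IsClosedConvex r) : Convex ℝ (dom r) :=
  fun _ hx _ hy _ _ ha hb hab => (hr.combo hx hy ha hb hab).1

/-- A closed proper convex function decays at most linearly. -/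
lemma IsClosedConvex.exists_linear_lower_bound (hr : IsClosedConvex r) {x₀ : E n}
    (hx₀ : x₀ ∈ dom r) :
    ∃ A, 0 ≤ A ∧ ∀ x ∈ dom r, (r x₀).toReal - A * (1 + ‖x - x₀‖) ≤ (r x).toReal := by
  obtain ⟨q, hq, hmin⟩ := LowerSemicontinuousOn.exists_isMinOn (s := Metric.closedBall x₀ 1)
    ⟨x₀, by simp⟩ (isCompact_closedBall x₀ 1) (hr.lsc.lowerSemicontinuousOn _)
  have hq0 : r q ≤ r x₀ := hmin (Metric.mem_closedBall_self zero_le_one)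
  have hqd : q ∈ dom r := fun ht => hx₀ (by rw [ht] at hq0; exact top_le_iff.mp hq0)
  have hball : ∀ x ∈ dom r, ‖x - x₀‖ ≤ 1 → (r q).toReal ≤ (r x).toReal := by
    intro x hx hxb
    have : r q ≤ r x := hmin (by simpa [dist_eq_norm] using hxb)
    rw [← hr.coe_toReal hqd, ← hr.coe_toReal hx] at this
    exact_mod_cast this
  have hle := hball x₀ hx₀ (by simp)
  refine ⟨(r x₀).toReal - (r q).toReal, by linarith, fun x hx => ?_⟩
  rcases le_total ‖x - x₀‖ 1 with h1 | h1
  · have := hball x hx h1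
    nlinarith [norm_nonneg (x - x₀)]
  · set s := ‖x - x₀‖ with hs
    have hs0 : 0 < s := by linarith
    -- The point of the segment from x₀ to x at distance 1 from x₀: its value is at least the
    -- minimum over the unit ball, and convexity carries this bound out to x with slope linear in s.
    have hc := hr.combo hx₀ hx (a := 1 - 1 / s) (b := 1 / s)
      (by rw [sub_nonneg, div_le_one hs0]; exact h1) (by positivity) (by ring)
    have hb := hball _ hc.1 (by
      have : (1 - 1 / s) • x₀ + (1 / s) • x - x₀ = (1 / s) • (x - x₀) := by module
      rw [this, norm_smul, Real.norm_of_nonneg (by positivity), ← hs]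
      exact le_of_eq (by field_simp))
    have h2 := hb.trans hc.2
    have h3 : s * (r q).toReal ≤ (s - 1) * (r x₀).toReal + (r x).toReal := by
      calc s * (r q).toReal
          ≤ s * ((1 - 1 / s) * (r x₀).toReal + 1 / s * (r x).toReal) := by gcongr
        _ = _ := by field_simp
    nlinarith

/-- The proximal subproblem has a solution. -/
lemma IsClosedConvex.exists_prox (hr : IsClosedConvex r) {c : ℝ} (hc : 0 < c) (x : E n) :
    ∃ u, ∀ u', scale c r u + ((‖u - x‖ ^ 2 / 2 : ℝ) : EReal) ≤
      scale c r u' + ((‖u' - x‖ ^ 2 / 2 : ℝ) : EReal) := by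
  obtain ⟨x₀, hx₀⟩ := hr.dom_nonempty
  obtain ⟨A, hA, hlin⟩ := hr.exists_linear_lower_bound hx₀
  set F : E n → EReal := fun u => scale c r u + ((‖u - x‖ ^ 2 / 2 : ℝ) : EReal) with hF
  have hval : ∀ u ∈ dom r, F u = ((c * (r u).toReal + ‖u - x‖ ^ 2 / 2 : ℝ) : EReal) := by
    intro u hu
    simp only [hF, scale]
    rw [← hr.coe_toReal hu]
    push_cast
    simp
  have htop : ∀ u, u ∉ dom r → F u = ⊤ := by
    intro u hu
    have : r u = ⊤ := by simpa [dom] using hu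
    simp only [hF, scale, this]
    rw [EReal.coe_mul_top_of_pos hc, EReal.top_add_coe]
  have hlsc : LowerSemicontinuous F := by
    refine LowerSemicontinuous.add' ?_ ?_ ?_
    · have hcont : Continuous fun a : EReal => (c : EReal) * a :=
        continuous_iff_continuousAt.mpr fun a =>
          (EReal.continuousAt_mul (p := ((c : EReal), a)) (Or.inl (by simpa using hc.ne'))
            (Or.inl (by simpa using hc.ne')) (Or.inl (EReal.coe_ne_bot c))
            (Or.inl (EReal.coe_ne_top c))).comp (by fun_prop)
      exact hcont.comp_lowerSemicontinuous hr.lsc (fun a b hab => mul_le_mul_of_nonneg_left hab (by exact_mod_cast hc.le))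
    · exact Continuous.lowerSemicontinuous (continuous_coe_real_ereal.comp (by fun_prop))
    · intro u
      exact EReal.continuousAt_add (Or.inr (EReal.coe_ne_bot _)) (Or.inr (EReal.coe_ne_top _))
  -- Beyond radius R the quadratic term outweighs the linear decay c·A·(1 + s), so the objective
  -- there is no smaller than at x₀, and a minimizer over the compact ball is global.
  set R : ℝ := 2 * (‖x₀ - x‖ + c * A + 1) with hR
  obtain ⟨q, -, hq⟩ := LowerSemicontinuousOn.exists_isMinOn (s := Metric.closedBall x₀ R)
    ⟨x₀, by simp [hR]; positivity⟩ (isCompact_closedBall x₀ R) (hlsc.lowerSemicontinuousOn _)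
  refine ⟨q, fun u => ?_⟩
  change F q ≤ F u
  by_cases hu : u ∈ dom r
  swap
  · rw [htop u hu]; exact le_top
  rcases le_total ‖u - x₀‖ R with h1 | h1
  · exact hq (by simpa [dist_eq_norm] using h1)
  · refine le_trans (hq (show x₀ ∈ _ by simp [hR]; positivity)) ?_
    rw [hval u hu, hval x₀ hx₀, EReal.coe_le_coe_iff]
    have h2 := hlin u hu
    set s := ‖u - x₀‖
    set a := ‖x₀ - x‖
    have ha : 0 ≤ a := norm_nonneg _
    have h3 : s - a ≤ ‖u - x‖ := by
      have := norm_sub_norm_le (u - x₀) (x - x₀)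
      rw [sub_sub_sub_cancel_right, norm_sub_rev x x₀] at this
      exact this
    have hcA : 0 ≤ c * A := by positivity
    have hsa : 0 ≤ s - a := by linarith
    have h4 : (s - a) ^ 2 ≤ ‖u - x‖ ^ 2 := by gcongr
    have h5 : c * ((r x₀).toReal - A * (1 + s)) ≤ c * (r u).toReal := by gcongr
    nlinarith [mul_nonneg hsa hcA, mul_nonneg ha hcA]

lemma prox_spec (hr : IsClosedConvex r) {c : ℝ} (hc : 0 < c) (x u : E n) :
    scale c r (prox (scale c r) x) + ((‖prox (scale c r) x - x‖ ^ 2 / 2 : ℝ) : EReal) ≤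
      scale c r u + ((‖u - x‖ ^ 2 / 2 : ℝ) : EReal) :=
  Classical.epsilon_spec (hr.exists_prox hc x) u

/-- The optimality condition of the proximal map. -/
lemma isSubgrad_prox (hr : IsClosedConvex r) {c : ℝ} (hc : 0 < c) (x : E n) :
    IsSubgrad r (prox (scale c r) x) ((1 / c) • (x - prox (scale c r) x)) := by
  have hspec := prox_spec hr hc x
  set q := prox (scale c r) x
  have hval : ∀ u ∈ dom r, scale c r u + ((‖u - x‖ ^ 2 / 2 : ℝ) : EReal)
      = ((c * (r u).toReal + ‖u - x‖ ^ 2 / 2 : ℝ) : EReal) := by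
    intro u hu
    simp only [scale]
    rw [← hr.coe_toReal hu]
    push_cast
    simp
  have hq : q ∈ dom r := by
    intro ht
    obtain ⟨x₀, hx₀⟩ := hr.dom_nonempty
    have h := hspec x₀
    rw [hval x₀ hx₀] at h
    simp only [scale, ht] at h
    rw [EReal.coe_mul_top_of_pos hc, EReal.top_add_coe] at h
    exact EReal.coe_ne_top _ (top_le_iff.mp h)
  refine ⟨hq, fun z hz => ?_⟩
  -- Comparison of q with the point at parameter t on the segment towards z, divided by t; the
  -- t-term disappears as t tends to 0.
  have key : ∀ t : ℝ, 0 < t → t ≤ 1 →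
      0 ≤ c * ((r z).toReal - (r q).toReal) + inner ℝ (q - x) (z - q) + t * (‖z - q‖ ^ 2 / 2) := by
    intro t ht ht1
    have hcb := hr.combo hq hz (a := 1 - t) (b := t) (by linarith) ht.le (by ring)
    have h := hspec ((1 - t) • q + t • z)
    rw [hval _ hq, hval _ hcb.1, EReal.coe_le_coe_iff] at h
    have he : (1 - t) • q + t • z - x = (q - x) + t • (z - q) := by module
    rw [he, norm_add_sq_real, inner_smul_right, norm_smul, Real.norm_of_nonneg ht.le] at h
    have h2 : c * (r ((1 - t) • q + t • z)).toReal ≤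
      c * ((1 - t) * (r q).toReal + t * (r z).toReal) := by gcongr; exact hcb.2
    have h3 : 0 ≤ t * (c * ((r z).toReal - (r q).toReal) + inner ℝ (q - x) (z - q)
        + t * (‖z - q‖ ^ 2 / 2)) := by nlinarith
    exact nonneg_of_mul_nonneg_right h3 ht
  have h0 : 0 ≤ c * ((r z).toReal - (r q).toReal) + inner ℝ (q - x) (z - q) := by
    by_contra hneg
    push Not at hneg
    set a := c * ((r z).toReal - (r q).toReal) + inner ℝ (q - x) (z - q)
    set b := ‖z - q‖ ^ 2 / 2
    have hb : 0 ≤ b := by positivity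
    -- An explicit t in place of the limit: it makes t·b at most −a/2, so a + t·b would be negative.
    have h := key (min 1 (-a / (2 * (b + 1)))) (by
      apply lt_min one_pos; apply div_pos <;> linarith) (min_le_left _ _)
    have h2 : min 1 (-a / (2 * (b + 1))) * b ≤ -a / (2 * (b + 1)) * b :=
      mul_le_mul_of_nonneg_right (min_le_right _ _) hb
    have h3 : -a / (2 * (b + 1)) * b ≤ -a / 2 := by
      rw [div_mul_eq_mul_div, div_le_div_iff₀ (by linarith) (by norm_num)]
      nlinarith
    linarith
  rw [inner_smul_left]
  simp only [conj_trivial]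
  have h4 : inner ℝ (x - q) (z - q) = - inner ℝ (q - x) (z - q) := by
    rw [← inner_neg_left, neg_sub]
  rw [h4]
  have : 0 ≤ (1 / c) * (c * ((r z).toReal - (r q).toReal) + inner ℝ (q - x) (z - q)) := by
    positivity
  have h5 : (1 / c) * (c * ((r z).toReal - (r q).toReal)) = (r z).toReal - (r q).toReal := by
    field_simp
  linarith

lemma IsSubgrad.monotone {y z ξ ζ : E n} (hy : IsSubgrad r y ξ) (hz : IsSubgrad r z ζ) :
    0 ≤ inner ℝ (ξ - ζ) (y - z) := by
  have h1 := hy.2 z hz.1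
  have h2 := hz.2 y hy.1
  have h3 : inner ℝ ξ (z - y) = - inner ℝ ξ (y - z) := by rw [← inner_neg_right, neg_sub]
  rw [inner_sub_left]
  linarith

/-- A proximal map is nonexpansive. -/
lemma norm_prox_sub_prox_le (hr : IsClosedConvex r) {c : ℝ} (hc : 0 < c) (x y : E n) :
    ‖prox (scale c r) x - prox (scale c r) y‖ ≤ ‖x - y‖ := by
  have h := (isSubgrad_prox hr hc x).monotone (isSubgrad_prox hr hc y)
  set p := prox (scale c r) x
  set q := prox (scale c r) y
  rw [← smul_sub, inner_smul_left] at h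
  simp only [conj_trivial] at h
  have h2 := nonneg_of_mul_nonneg_right h (show 0 < 1 / c by positivity)
  have h3 : x - p - (y - q) = (x - y) - (p - q) := by abel
  rw [h3, inner_sub_left, real_inner_self_eq_norm_sq] at h2
  have h4 := real_inner_le_norm (x - y) (p - q)
  by_contra! hlt
  nlinarith [norm_nonneg (x - y), norm_nonneg (p - q)]

end Convex

/-! ### Smooth and strongly convex functions on convex sets -/

/-- The hypothesis makes φ(s) − φ'(0)s − Ks²/2 nonincreasing on [0, 1]. No integrability of the
derivative is needed. -/
lemma sub_sub_le_of_hasDerivAt {φ φ' : ℝ → ℝ} {K : ℝ}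
    (hd : ∀ s ∈ Set.Icc (0 : ℝ) 1, HasDerivAt φ (φ' s) s)
    (hK : ∀ s ∈ Set.Icc (0 : ℝ) 1, φ' s - φ' 0 ≤ K * s) : φ 1 - φ 0 - φ' 0 ≤ K / 2 := by
  have hder : ∀ s ∈ Set.Icc (0 : ℝ) 1,
      HasDerivAt (fun s => φ s - φ' 0 * s - K / 2 * s ^ 2) (φ' s - φ' 0 - K * s) s := by
    intro s hs
    have h1 := (hd s hs).sub ((hasDerivAt_id s).const_mul (φ' 0))
    have h2 := h1.sub ((hasDerivAt_pow 2 s).const_mul (K / 2))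
    exact h2.congr_deriv (by simp; ring)
  have hanti : AntitoneOn (fun s => φ s - φ' 0 * s - K / 2 * s ^ 2) (Set.Icc 0 1) := by
    refine antitoneOn_of_hasDerivWithinAt_nonpos (convex_Icc 0 1)
      (fun s hs => (hder s hs).continuousAt.continuousWithinAt)
      (fun s hs => (hder s (interior_subset hs)).hasDerivWithinAt) fun s hs => ?_
    have := hK s (interior_subset hs)
    linarith
  have h := hanti (Set.left_mem_Icc.mpr zero_le_one) (Set.right_mem_Icc.mpr zero_le_one)
    zero_le_one
  simp only at h
  linarith

/-- The sign of K is free: K = L gives the descent lemma, and K = −μ applied to −ψ gives strong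
convexity. -/
lemma le_quadratic_of_hasGradientAt {n : ℕ} {ψ : E n → ℝ} {G : E n → E n} {C : Set (E n)} {K : ℝ}
    (hC : Convex ℝ C) (hd : ∀ y ∈ C, HasGradientAt ψ (G y) y)
    (hK : ∀ y ∈ C, ∀ y' ∈ C, inner ℝ (G y' - G y) (y' - y) ≤ K * ‖y' - y‖ ^ 2)
    {y y' : E n} (hy : y ∈ C) (hy' : y' ∈ C) :
    ψ y' ≤ ψ y + inner ℝ (G y) (y' - y) + K / 2 * ‖y' - y‖ ^ 2 := by
  have hmem : ∀ s ∈ Set.Icc (0 : ℝ) 1, y + s • (y' - y) ∈ C := fun s hs =>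
    hC.add_smul_sub_mem hy hy' hs
  have h := sub_sub_le_of_hasDerivAt (φ := fun s => ψ (y + s • (y' - y)))
    (φ' := fun s => inner ℝ (G (y + s • (y' - y))) (y' - y)) (K := K * ‖y' - y‖ ^ 2) ?_ ?_
  · simp only [one_smul, zero_smul, add_zero, add_sub_cancel] at h
    linarith
  · intro s hs
    have h1 := (hd _ (hmem s hs)).hasFDerivAt
    have h2 : HasDerivAt (fun s : ℝ => y + s • (y' - y)) (y' - y) s := by
      simpa using ((hasDerivAt_id s).smul_const (y' - y)).const_add y
    exact (h1.comp_hasDerivAt s h2).congr_deriv (by simp)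
  · intro s hs
    simp only [zero_smul, add_zero]
    rw [← inner_sub_left]
    rcases hs.1.eq_or_lt with h0 | h0
    · simp [← h0]
    have h3 := hK y hy _ (hmem s hs)
    rw [add_sub_cancel_left, inner_smul_right, norm_smul, Real.norm_of_nonneg hs.1] at h3
    have h4 : s * inner ℝ (G (y + s • (y' - y)) - G y) (y' - y) ≤ s * (K * ‖y' - y‖ ^ 2 * s) := by
      linarith
    exact le_of_mul_le_mul_left h4 h0

/-- `ψ` with gradient `G` is `μ`-strongly convex and `L`-smooth on `C`. -/
structure SmoothStrong {n : ℕ} (ψ : E n → ℝ) (G : E n → E n) (μ L : ℝ) (C : Set (E n)) : Prop where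
  lower : ∀ y ∈ C, ∀ y' ∈ C, ψ y + inner ℝ (G y) (y' - y) + μ / 2 * ‖y' - y‖ ^ 2 ≤ ψ y'
  upper : ∀ y ∈ C, ∀ y' ∈ C, ψ y' ≤ ψ y + inner ℝ (G y) (y' - y) + L / 2 * ‖y' - y‖ ^ 2
  lip : ∀ y ∈ C, ∀ y' ∈ C, ‖G y - G y'‖ ≤ L * ‖y - y'‖

section SmoothStrong

variable {n : ℕ} {ψ : E n → ℝ} {G : E n → E n} {μ L : ℝ} {C : Set (E n)}

lemma SmoothStrong.of_gradient (hC : Convex ℝ C) (hd : ∀ y ∈ C, HasGradientAt ψ (G y) y)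
    (hlip : ∀ y ∈ C, ∀ y' ∈ C, ‖G y - G y'‖ ≤ L * ‖y - y'‖)
    (hmono : ∀ y ∈ C, ∀ y' ∈ C, μ * ‖y - y'‖ ^ 2 ≤ inner ℝ (y - y') (G y - G y')) :
    SmoothStrong ψ G μ L C where
  lower y hy y' hy' := by
    have h := le_quadratic_of_hasGradientAt (ψ := fun y => -ψ y) (G := fun y => -G y) (K := -μ) hC
      (fun y hy => by
        rw [hasGradientAt_iff_hasFDerivAt, map_neg]
        exact (hd y hy).hasFDerivAt.neg)
      (fun y hy y' hy' => by
        have := hmono y' hy' y hy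
        rw [real_inner_comm] at this
        have e : -G y' - -G y = -(G y' - G y) := by abel
        rw [e, inner_neg_left]
        linarith) hy hy'
    rw [inner_neg_left] at h
    linarith
  upper y hy y' hy' := by
    refine le_quadratic_of_hasGradientAt hC hd (fun y hy y' hy' => ?_) hy hy'
    calc inner ℝ (G y' - G y) (y' - y) ≤ ‖G y' - G y‖ * ‖y' - y‖ := real_inner_le_norm _ _
      _ ≤ L * ‖y' - y‖ * ‖y' - y‖ := by gcongr; exact hlip _ hy' _ hy
      _ = _ := by ring
  lip := hlip

lemma SmoothStrong.mono_inner (hψ : SmoothStrong ψ G μ L C) {y y' : E n} (hy : y ∈ C)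
    (hy' : y' ∈ C) : μ * ‖y - y'‖ ^ 2 ≤ inner ℝ (G y - G y') (y - y') := by
  have h1 := hψ.lower y hy y' hy'
  have h2 := hψ.lower y' hy' y hy
  have h3 : inner ℝ (G y) (y' - y) = - inner ℝ (G y) (y - y') := by
    rw [← inner_neg_right, neg_sub]
  rw [norm_sub_rev y' y] at h1
  rw [inner_sub_left]
  linarith

variable {r : E n → EReal}

/-! ### Stationary points and residuals of proximal gradient steps. -/

/-- A strongly convex smooth function plus a closed convex function has a stationary point. -/
lemma SmoothStrong.exists_isSubgrad (hr : IsClosedConvex r) (hψ : SmoothStrong ψ G μ L (dom r))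
    (hμ : 0 < μ) (hμL : μ ≤ L) : ∃ y, IsSubgrad r y (-G y) := by
  have hL : 0 < L := hμ.trans_le hμL
  -- This step size minimizes 1 − 2sμ + s²L², so the proximal gradient map contracts by √(1 − μ²/L²)
  -- on `dom r`.
  set s : ℝ := μ / L ^ 2 with hs
  have hs0 : 0 < s := by positivity
  set T : E n → E n := fun u => prox (scale s r) (u - s • G u) with hT
  have hTmem : ∀ u, T u ∈ dom r := fun u => (isSubgrad_prox hr hs0 _).1
  obtain ⟨x₀, hx₀⟩ := hr.dom_nonempty
  have hle1 : μ ^ 2 / L ^ 2 ≤ 1 := by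
    rw [div_le_one (by positivity)]; gcongr
  set q : ℝ := √(1 - μ ^ 2 / L ^ 2) with hq
  have hq1 : q < 1 := by
    rw [hq, Real.sqrt_lt' one_pos]
    have : 0 < μ ^ 2 / L ^ 2 := by positivity
    linarith
  have hq0 : 0 ≤ q := Real.sqrt_nonneg _
  have hcontr : ∀ u ∈ dom r, ∀ v ∈ dom r, ‖T u - T v‖ ≤ q * ‖u - v‖ := by
    intro u hu v hv
    refine (norm_prox_sub_prox_le hr hs0 _ _).trans ?_
    apply le_of_sq_le_sq _ (by positivity)
    have e : u - s • G u - (v - s • G v) = (u - v) - s • (G u - G v) := by module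
    rw [e, norm_sub_sq_real, inner_smul_right, norm_smul, Real.norm_of_nonneg hs0.le, mul_pow,
      mul_pow, hq, Real.sq_sqrt (by linarith)]
    have h1 := hψ.mono_inner hu hv
    rw [real_inner_comm] at h1
    have h2 : ‖G u - G v‖ ^ 2 ≤ (L * ‖u - v‖) ^ 2 := by gcongr; exact hψ.lip u hu v hv
    have h3 : s * (μ * ‖u - v‖ ^ 2) ≤ s * inner ℝ (u - v) (G u - G v) := by gcongr
    have h4 : s ^ 2 * ‖G u - G v‖ ^ 2 ≤ s ^ 2 * (L * ‖u - v‖) ^ 2 := by gcongr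
    have e1 : s * (μ * ‖u - v‖ ^ 2) = μ ^ 2 / L ^ 2 * ‖u - v‖ ^ 2 := by rw [hs]; ring
    have e2 : s ^ 2 * (L * ‖u - v‖) ^ 2 = μ ^ 2 / L ^ 2 * ‖u - v‖ ^ 2 := by rw [hs]; field_simp
    linarith
  set w : ℕ → E n := fun k => T^[k] x₀ with hw
  have hwsucc : ∀ k, w (k + 1) = T (w k) := fun k => Function.iterate_succ_apply' T k x₀
  have hwmem : ∀ k, w k ∈ dom r := by
    intro k
    cases k with
    | zero => exact hx₀
    | succ k => rw [hwsucc]; exact hTmem _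
  have hgeo : ∀ k, dist (w k) (w (k + 1)) ≤ ‖x₀ - T x₀‖ * q ^ k := by
    intro k
    induction k with
    | zero => simp [hw, dist_eq_norm]
    | succ k ih =>
      rw [hwsucc (k + 1), dist_eq_norm]
      nth_rewrite 1 [hwsucc k]
      refine (hcontr _ (hwmem k) _ (hwmem _)).trans ?_
      rw [dist_eq_norm] at ih
      calc q * ‖w k - w (k + 1)‖ ≤ q * (‖x₀ - T x₀‖ * q ^ k) := by gcongr
        _ = _ := by ring
  obtain ⟨y, hy⟩ := cauchySeq_tendsto_of_complete (cauchySeq_of_le_geometric q _ hq1 hgeo)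
  -- `dom r` need not be closed, so G is not yet controlled at the limit y. The gradients are given
  -- their own limit g; passing to the limit in the continuous proximal map yields y = prox(y − s
  -- g), which places y in `dom r`, and only then does Lipschitz continuity identify g with G y.
  obtain ⟨g, hg⟩ := cauchySeq_tendsto_of_complete
    (cauchySeq_of_le_geometric (f := fun k => G (w k)) q (L * ‖x₀ - T x₀‖) hq1 (fun k => by
      rw [dist_eq_norm]
      refine (hψ.lip _ (hwmem k) _ (hwmem _)).trans ?_
      have := hgeo k
      rw [dist_eq_norm] at this
      rw [mul_assoc]
      gcongr))
  have hprox : Continuous (prox (scale s r)) :=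
    (LipschitzWith.of_dist_le_mul (K := 1) fun a b => by
      simpa [dist_eq_norm] using norm_prox_sub_prox_le hr hs0 a b).continuous
  have hlim : Filter.Tendsto (fun k => w (k + 1)) Filter.atTop
      (nhds (prox (scale s r) (y - s • g))) := by
    simp only [hwsucc, hT]
    exact (hprox.tendsto _).comp (hy.sub (hg.const_smul s))
  have hfix : prox (scale s r) (y - s • g) = y :=
    tendsto_nhds_unique hlim ((Filter.tendsto_add_atTop_iff_nat 1).mpr hy)
  have hsub := isSubgrad_prox hr hs0 (y - s • g)
  rw [hfix] at hsub
  have hGy : Filter.Tendsto (fun k => G (w k)) Filter.atTop (nhds (G y)) := by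
    rw [tendsto_iff_norm_sub_tendsto_zero]
    refine squeeze_zero (fun _ => norm_nonneg _)
      (fun k => hψ.lip _ (hwmem k) _ hsub.1) ?_
    simpa using (tendsto_iff_norm_sub_tendsto_zero.mp hy).const_mul L
  have hgG : g = G y := tendsto_nhds_unique hg hGy
  refine ⟨y, ?_⟩
  have e : (1 / s) • (y - s • g - y) = -G y := by
    rw [sub_sub_cancel_left, smul_neg, smul_smul, one_div, inv_mul_cancel₀ hs0.ne', one_smul, hgG]
  rwa [e] at hsub

/-- Quadratic growth at a stationary point. -/
lemma SmoothStrong.growth (hψ : SmoothStrong ψ G μ L (dom r)) {ys : E n}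
    (hys : IsSubgrad r ys (-G ys)) {y : E n} (hy : y ∈ dom r) :
    ψ ys + (r ys).toReal + μ / 2 * ‖y - ys‖ ^ 2 ≤ ψ y + (r y).toReal := by
  have h1 := hψ.lower ys hys.1 y hy
  have h2 := hys.2 y hy
  rw [inner_neg_left] at h2
  linarith

/-- Residual of a proximal gradient step in terms of the optimality gap. -/
lemma SmoothStrong.prox_grad_residual (hr : IsClosedConvex r) (hψ : SmoothStrong ψ G μ L (dom r))
    (hμ : 0 < μ) (hμL : μ ≤ L) {ys : E n} (hys : IsSubgrad r ys (-G ys)) {u y : E n}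
    (hu : u ∈ dom r) (hy : y = prox (scale (1 / L) r) (u - (1 / L) • G u)) :
    ∃ ξ, IsSubgrad r y ξ ∧
      ‖G y + ξ‖ ^ 2 ≤ 4 * (L - μ) * (ψ u + (r u).toReal - (ψ ys + (r ys).toReal)) := by
  have hL : 0 < L := hμ.trans_le hμL
  have hsub := isSubgrad_prox hr (show 0 < 1 / L by positivity) (u - (1 / L) • G u)
  rw [← hy] at hsub
  have e : (1 / (1 / L)) • (u - (1 / L) • G u - y) = L • (u - y) - G u := by
    rw [one_div_one_div, sub_right_comm, smul_sub, smul_smul, mul_one_div_cancel hL.ne', one_smul]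
  rw [e] at hsub
  refine ⟨_, hsub, ?_⟩
  have hyd := hsub.1
  have h1 := hψ.upper u hu y hyd
  have h2 := hsub.2 u hu
  have h3 := hψ.growth hys hyd
  have h4 := hψ.mono_inner hu hyd
  have h5 := hψ.lip u hu y hyd
  rw [inner_sub_left, inner_smul_left, real_inner_self_eq_norm_sq] at h2
  simp only [conj_trivial] at h2
  have e1 : inner ℝ (G u) (y - u) = - inner ℝ (G u) (u - y) := by
    rw [← inner_neg_right, neg_sub]
  rw [e1, norm_sub_rev y u] at h1
  have e2 : G y + (L • (u - y) - G u) = L • (u - y) - (G u - G y) := by abel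
  rw [e2, norm_sub_sq_real, inner_smul_left, norm_smul, Real.norm_of_nonneg hL.le, real_inner_comm]
  simp only [conj_trivial]
  have h6 : ‖G u - G y‖ ^ 2 ≤ (L * ‖u - y‖) ^ 2 := by gcongr
  have h7 : L * (μ * ‖u - y‖ ^ 2) ≤ L * inner ℝ (G u - G y) (u - y) := by gcongr
  -- Sufficient decrease of the step. The squared residual is at most (2L² − 2Lμ)‖u − y‖² by the
  -- Lipschitz and monotonicity bounds, so the factor 2/L from here produces 4(L − μ).
  have h8 : L / 2 * ‖u - y‖ ^ 2 ≤ ψ u + (r u).toReal - (ψ ys + (r ys).toReal) := by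
    have : 0 ≤ μ / 2 * ‖y - ys‖ ^ 2 := by positivity
    linarith
  have h9 : (L - μ) * (L / 2 * ‖u - y‖ ^ 2) ≤
      (L - μ) * (ψ u + (r u).toReal - (ψ ys + (r ys).toReal)) :=
    mul_le_mul_of_nonneg_left h8 (by linarith)
  nlinarith

/-! ### Energy contraction of the two accelerated steps. -/

lemma norm_sq_convex_combo (a b : E n) (α : ℝ) :
    ‖(1 - α) • a + α • b‖ ^ 2 =
      (1 - α) * ‖a‖ ^ 2 + α * ‖b‖ ^ 2 - α * (1 - α) * ‖a - b‖ ^ 2 := by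
  rw [norm_add_sq_real, norm_sub_sq_real, inner_smul_left, inner_smul_right, norm_smul, norm_smul,
    mul_pow, mul_pow, Real.norm_eq_abs, Real.norm_eq_abs, sq_abs, sq_abs]
  simp only [conj_trivial]
  ring

/-- One accelerated step with feasible query points contracts the energy. -/
lemma SmoothStrong.feasible_step (hr : IsClosedConvex r) (hψ : SmoothStrong ψ G μ L (dom r))
    (hμ : 0 < μ) {ys : E n} (hys : ys ∈ dom r) {α : ℝ} (hα : 0 < α) (hα1 : α ≤ 1)
    (hαL : L * α ^ 2 = μ) {u w z w' u' : E n} (hu : u ∈ dom r) (hw : w ∈ dom r)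
    (hz : z = (1 / (1 + α)) • (u + α • w))
    (hw' : w' = prox (scale (α / μ) r) ((1 - α) • w + α • z - (α / μ) • G z))
    (hu' : u' = (1 - α) • u + α • w') :
    u' ∈ dom r ∧ w' ∈ dom r ∧
      ψ u' + (r u').toReal - (ψ ys + (r ys).toReal) + μ / 2 * ‖w' - ys‖ ^ 2 ≤
      (1 - α) * (ψ u + (r u).toReal - (ψ ys + (r ys).toReal) + μ / 2 * ‖w - ys‖ ^ 2) := by
  have hz' : (1 + α) • z = u + α • w := by
    rw [hz, smul_smul, mul_one_div_cancel (by linarith), one_smul]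
  have hzd : z ∈ dom r := by
    have : z = (1 / (1 + α)) • u + (α / (1 + α)) • w := by rw [hz]; module
    rw [this]
    exact hr.convex_dom hu hw (by positivity) (by positivity) (by field_simp)
  set c := (1 - α) • w + α • z with hc
  have hsub := isSubgrad_prox hr (show 0 < α / μ by positivity) (c - (α / μ) • G z)
  rw [← hw'] at hsub
  have hcombo := hr.combo hu hsub.1 (a := 1 - α) (b := α) (by linarith) hα.le (by ring)
  rw [← hu'] at hcombo
  refine ⟨hcombo.1, hsub.1, ?_⟩
  -- The choice of z couples the two sequences: the displacement of u' is α times that of w'. With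
  -- Lα² = μ the smoothness term then becomes exactly the μ/2-weighted proximal term.
  have hdiff : u' - z = α • (w' - c) := by
    have : u' - z - α • (w' - c) = (1 - α) • ((u + α • w) - (1 + α) • z) := by
      rw [hu', hc]; module
    rw [hz', sub_self, smul_zero] at this
    exact sub_eq_zero.mp this
  have h1 := hψ.upper z hzd u' hcombo.1
  have e1 : inner ℝ (G z) (u' - z) =
      (1 - α) * inner ℝ (G z) (u - z) + α * inner ℝ (G z) (w' - z) := by
    have : u' - z = (1 - α) • (u - z) + α • (w' - z) := by rw [hu']; module
    rw [this, inner_add_right, inner_smul_right, inner_smul_right]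
  rw [e1, hdiff, norm_smul, Real.norm_of_nonneg hα.le, mul_pow,
    show L / 2 * (α ^ 2 * ‖w' - c‖ ^ 2) = μ / 2 * ‖w' - c‖ ^ 2 by rw [← hαL]; ring] at h1
  have h2 := hψ.lower z hzd u hu
  have h3 := hψ.lower z hzd ys hys
  have h4 := hsub.2 ys hys
  have e2 : α * inner ℝ ((1 / (α / μ)) • (c - (α / μ) • G z - w')) (ys - w') =
      μ * inner ℝ (c - w') (ys - w') - α * (inner ℝ (G z) (ys - z) - inner ℝ (G z) (w' - z)) := by
    rw [← inner_sub_right, sub_sub_sub_cancel_right, inner_smul_left,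
      show c - (α / μ) • G z - w' = (c - w') - (α / μ) • G z by abel, inner_sub_left (c - w'),
      inner_smul_left]
    simp only [conj_trivial]
    field_simp
  have h5 := mul_le_mul_of_nonneg_left h4 hα.le
  rw [mul_add, e2] at h5
  have e3 : ‖w' - c‖ ^ 2 + ‖w' - ys‖ ^ 2 - ‖ys - c‖ ^ 2 = 2 * inner ℝ (c - w') (ys - w') := by
    have : ys - c = (ys - w') - (c - w') := by abel
    rw [this, norm_sub_rev w' c, norm_sub_rev w' ys, norm_sub_sq_real (ys - w'), real_inner_comm]
    ring
  -- The prox-center c is a convex combination of w and z. The extra α‖ys − z‖² is paid for by the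
  -- strong convexity inequality at `ys`, which enters with weight α.
  have e4 : ‖ys - c‖ ^ 2 ≤ (1 - α) * ‖w - ys‖ ^ 2 + α * ‖ys - z‖ ^ 2 := by
    have : ys - c = (1 - α) • (ys - w) + α • (ys - z) := by rw [hc]; module
    rw [this, norm_sq_convex_combo, norm_sub_rev w ys]
    have : 0 ≤ α * (1 - α) * ‖ys - w - (ys - z)‖ ^ 2 :=
      mul_nonneg (mul_nonneg hα.le (by linarith)) (sq_nonneg _)
    linarith
  have h6 := mul_le_mul_of_nonneg_left h2 (show 0 ≤ 1 - α by linarith)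
  have h7 := mul_le_mul_of_nonneg_left h3 hα.le
  have h8 := mul_le_mul_of_nonneg_left e4 (show 0 ≤ μ / 2 by linarith)
  have h9 : 0 ≤ (1 - α) * (μ / 2 * ‖u - z‖ ^ 2) := mul_nonneg (by linarith) (by positivity)
  have h10 := hcombo.2
  have h11 := congrArg (fun t => μ / 2 * t) e3
  linarith

/-- One accelerated step in extrapolated form contracts the energy. -/
lemma SmoothStrong.extrapolated_step (hr : IsClosedConvex r) (hψ : SmoothStrong ψ G μ L C)
    (hC : dom r ⊆ C) (hμ : 0 < μ) (hL : 0 < L) {ys : E n} (hys : ys ∈ dom r) {α : ℝ} (hα : 0 < α)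
    (hα1 : α ≤ 1) (hαL : L * α ^ 2 = μ) {u v z u' : E n} (hu : u ∈ dom r)
    (hz : z = u + ((1 - α) / (1 + α)) • (u - v)) (hzC : z ∈ C)
    (hu' : u' = prox (scale (1 / L) r) (z - (1 / L) • G z)) :
    u' ∈ dom r ∧
      ψ u' + (r u').toReal - (ψ ys + (r ys).toReal) +
        μ / 2 * ‖u + (1 / α) • (u' - u) - ys‖ ^ 2 ≤
      (1 - α) * (ψ u + (r u).toReal - (ψ ys + (r ys).toReal) +
        μ / 2 * ‖v + (1 / α) • (u - v) - ys‖ ^ 2) := by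
  have hsub := isSubgrad_prox hr (show 0 < 1 / L by positivity) (z - (1 / L) • G z)
  rw [← hu'] at hsub
  have e : (1 / (1 / L)) • (z - (1 / L) • G z - u') = L • (z - u') - G z := by
    rw [one_div_one_div, sub_right_comm, smul_sub, smul_smul, mul_one_div_cancel hL.ne', one_smul]
  rw [e] at hsub
  refine ⟨hsub.1, ?_⟩
  -- One inequality used at both x = u and x = `ys`, with weights 1 − α and α. The point z needs
  -- only to lie in C, where ψ is controlled, not in `dom r`.
  have descent : ∀ x ∈ dom r, ψ u' + (r u').toReal ≤ ψ x + (r x).toReal - μ / 2 * ‖x - z‖ ^ 2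
      + L / 2 * ‖x - z‖ ^ 2 - L / 2 * ‖x - u'‖ ^ 2 := by
    intro x hx
    have h1 := hψ.upper z hzC u' (hC hsub.1)
    have h2 := hψ.lower z hzC x (hC hx)
    have h3 := hsub.2 x hx
    rw [inner_sub_left, inner_smul_left] at h3
    simp only [conj_trivial] at h3
    have e1 : inner ℝ (G z) (x - u') = inner ℝ (G z) (x - z) - inner ℝ (G z) (u' - z) := by
      rw [← inner_sub_right, sub_sub_sub_cancel_right]
    have e2 : ‖x - z‖ ^ 2 = ‖x - u'‖ ^ 2 - 2 * inner ℝ (z - u') (x - u') + ‖u' - z‖ ^ 2 := by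
      have : x - z = (x - u') - (z - u') := by abel
      rw [this, norm_sub_sq_real, norm_sub_rev u' z, real_inner_comm]
    have e3 : L / 2 * ‖x - z‖ ^ 2 = L / 2 * ‖x - u'‖ ^ 2 - L * inner ℝ (z - u') (x - u')
      + L / 2 * ‖u' - z‖ ^ 2 := by rw [e2]; ring
    linarith
  -- The hidden prox-center of the extrapolated form; in terms of it z satisfies the same relation
  -- (1 + α)z = u + αw as in the feasible form.
  set w := v + (1 / α) • (u - v) with hw
  set w' := u + (1 / α) • (u' - u) with hw'
  have hz' : (1 + α) • z = u + α • w := by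
    rw [hz, hw, smul_add, smul_add, smul_smul, smul_smul, mul_one_div_cancel hα.ne',
      mul_div_cancel₀ _ (by linarith)]
    module
  have hαw' : α • w' = u' - (1 - α) • u := by
    rw [hw', smul_add, smul_smul, mul_one_div_cancel hα.ne']
    module
  have hu1 := mul_le_mul_of_nonneg_left (descent u hu) (show 0 ≤ 1 - α by linarith)
  have hs1 := mul_le_mul_of_nonneg_left (descent ys hys) hα.le
  -- Both identities carry the same cross term α(1 − α)‖u − ys‖², which cancels when they are
  -- subtracted.
  have c1 := norm_sq_convex_combo (u - z) (ys - z) α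
  have c2 := norm_sq_convex_combo (u - u') (ys - u') α
  rw [sub_sub_sub_cancel_right] at c1 c2
  have d2 : (1 - α) • (u - u') + α • (ys - u') = α • (ys - w') := by
    rw [smul_sub α ys w', hαw']; module
  have d1 : (1 - α) • (u - z) + α • (ys - z) = α • ((1 - α) • (ys - w) + α • (ys - z)) := by
    have : (1 - α) • (u - z) + α • (ys - z) - α • ((1 - α) • (ys - w) + α • (ys - z)) =
      (1 - α) • ((u + α • w) - (1 + α) • z) := by module
    rw [hz', sub_self, smul_zero] at this
    exact sub_eq_zero.mp this
  have c3 := norm_sq_convex_combo (ys - w) (ys - z) α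
  have h3 : 0 ≤ α * (1 - α) * ‖ys - w - (ys - z)‖ ^ 2 :=
    mul_nonneg (mul_nonneg hα.le (by linarith)) (sq_nonneg _)
  rw [d1, norm_smul, Real.norm_of_nonneg hα.le, mul_pow, c3] at c1
  rw [d2, norm_smul, Real.norm_of_nonneg hα.le, mul_pow] at c2
  have c1' := congrArg (fun t => L / 2 * t) c1
  have c2' := congrArg (fun t => L / 2 * t) c2
  beta_reduce at c1' c2'
  rw [norm_sub_rev ys w'] at c2'
  rw [norm_sub_rev ys w] at c1'
  have e5 : L / 2 * (α ^ 2 * ‖w' - ys‖ ^ 2) = μ / 2 * ‖w' - ys‖ ^ 2 := by rw [← hαL]; ring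
  have e6 : L / 2 * (α ^ 2 * ((1 - α) * ‖w - ys‖ ^ 2 + α * ‖ys - z‖ ^ 2 -
      α * (1 - α) * ‖ys - w - (ys - z)‖ ^ 2)) = μ / 2 * ((1 - α) * ‖w - ys‖ ^ 2 + α * ‖ys - z‖ ^ 2 -
      α * (1 - α) * ‖ys - w - (ys - z)‖ ^ 2) := by rw [← hαL]; ring
  rw [e5] at c2'
  rw [e6] at c1'
  have h4 := mul_nonneg (show 0 ≤ μ / 2 by linarith) h3
  have h9 : 0 ≤ (1 - α) * (μ / 2 * ‖u - z‖ ^ 2) := mul_nonneg (by linarith) (by positivity)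
  linarith

end SmoothStrong

namespace Problem

variable {m n₁ n₂ : ℕ} {p : Problem m n₁ n₂}

/-! ### Partial gradients -/

lemma ObjAssumption.hasGradientAt_joint (hobj : p.ObjAssumption) (i : Fin m) {x : E n₁}
    (hx : x ∈ dom p.g) {y : E n₂} (hy : y ∈ dom p.h) :
    HasGradientAt (p.fz i) (gradient (p.fz i) (WithLp.toLp 2 (x, y))) (WithLp.toLp 2 (x, y)) := by
  obtain ⟨Z, -, hsub, hZ⟩ := hobj.smooth
  exact ((hZ i).1 _ (hsub x hx y hy)).hasGradientAt

/-- Chain rule along the affine inclusion x' ↦ (x', y). Partial gradients being components of the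
joint gradient, they inherit its Lipschitz bound. -/
lemma ObjAssumption.hasGradientAt_x (hobj : p.ObjAssumption) (i : Fin m) {x : E n₁}
    (hx : x ∈ dom p.g) {y : E n₂} (hy : y ∈ dom p.h) :
    HasGradientAt (fun x' => p.f i x' y) (gradient (p.fz i) (WithLp.toLp 2 (x, y))).fst x := by
  have h := (hobj.hasGradientAt_joint i hx hy).hasFDerivAt
  rw [hasGradientAt_iff_hasFDerivAt]
  generalize gradient (p.fz i) (WithLp.toLp 2 (x, y)) = v₀ at h ⊢
  have hlin : HasFDerivAt (fun x' : E n₁ => WithLp.toLp 2 (x', y))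
      (((WithLp.prodContinuousLinearEquiv 2 ℝ (E n₁) (E n₂)).symm :
        (E n₁ × E n₂) →L[ℝ] WithLp 2 (E n₁ × E n₂)).comp
          (ContinuousLinearMap.inl ℝ (E n₁) (E n₂))) x :=
    ((WithLp.prodContinuousLinearEquiv 2 ℝ (E n₁) (E n₂)).symm.hasFDerivAt).comp x
      (hasFDerivAt_prodMk_left x y)
  refine (h.comp x hlin).congr_fderiv ?_
  ext v
  simp [WithLp.prod_inner_apply]

lemma ObjAssumption.hasGradientAt_y (hobj : p.ObjAssumption) (i : Fin m) {x : E n₁}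
    (hx : x ∈ dom p.g) {y : E n₂} (hy : y ∈ dom p.h) :
    HasGradientAt (fun y' => p.f i x y') (gradient (p.fz i) (WithLp.toLp 2 (x, y))).snd y := by
  have h := (hobj.hasGradientAt_joint i hx hy).hasFDerivAt
  rw [hasGradientAt_iff_hasFDerivAt]
  generalize gradient (p.fz i) (WithLp.toLp 2 (x, y)) = v₀ at h ⊢
  have hlin : HasFDerivAt (fun y' : E n₂ => WithLp.toLp 2 (x, y'))
      (((WithLp.prodContinuousLinearEquiv 2 ℝ (E n₁) (E n₂)).symm :
        (E n₁ × E n₂) →L[ℝ] WithLp 2 (E n₁ × E n₂)).comp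
          (ContinuousLinearMap.inr ℝ (E n₁) (E n₂))) y :=
    ((WithLp.prodContinuousLinearEquiv 2 ℝ (E n₁) (E n₂)).symm.hasFDerivAt).comp y
      (hasFDerivAt_prodMk_right x y)
  refine (h.comp y hlin).congr_fderiv ?_
  ext v
  simp [WithLp.prod_inner_apply]

lemma ObjAssumption.hasGradientAt_gradX (hobj : p.ObjAssumption) (i : Fin m) {x : E n₁}
    (hx : x ∈ dom p.g) {y : E n₂} (hy : y ∈ dom p.h) :
    HasGradientAt (fun x' => p.f i x' y) (p.gradX i x y) x := by
  have h := hobj.hasGradientAt_x i hx hy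
  rwa [gradX, h.gradient]

lemma ObjAssumption.hasGradientAt_gradY (hobj : p.ObjAssumption) (i : Fin m) {x : E n₁}
    (hx : x ∈ dom p.g) {y : E n₂} (hy : y ∈ dom p.h) :
    HasGradientAt (fun y' => p.f i x y') (p.gradY i x y) y := by
  have h := hobj.hasGradientAt_y i hx hy
  rwa [gradY, h.gradient]

lemma ObjAssumption.L_pos (hobj : p.ObjAssumption) : 0 < p.L := hobj.mu_pos.trans_le hobj.mu_le_L

lemma ObjAssumption.Ly_pos (hobj : p.ObjAssumption) : 0 < p.Ly :=
  hobj.mu_pos.trans_le hobj.mu_le_Ly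

/-- Joint Lipschitz continuity of both partial gradients. -/
lemma ObjAssumption.joint_lipschitz (hobj : p.ObjAssumption) (i : Fin m) {x x' : E n₁}
    (hx : x ∈ dom p.g) (hx' : x' ∈ dom p.g) {y y' : E n₂} (hy : y ∈ dom p.h) (hy' : y' ∈ dom p.h) :
    ‖p.gradX i x y - p.gradX i x' y'‖ ^ 2 + ‖p.gradY i x y - p.gradY i x' y'‖ ^ 2 ≤
      p.L ^ 2 * (‖x - x'‖ ^ 2 + ‖y - y'‖ ^ 2) := by
  obtain ⟨Z, -, hsub, hZ⟩ := hobj.smooth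
  have h := (hZ i).2 _ (hsub x hx y hy) _ (hsub x' hx' y' hy')
  have h2 : ‖gradient (p.fz i) (WithLp.toLp 2 (x, y)) -
      gradient (p.fz i) (WithLp.toLp 2 (x', y'))‖ ^ 2 ≤
      (p.L * ‖WithLp.toLp 2 (x, y) - WithLp.toLp 2 (x', y')‖) ^ 2 := by gcongr
  rw [mul_pow, WithLp.prod_norm_sq_eq_of_L2, WithLp.prod_norm_sq_eq_of_L2] at h2
  have e1 : p.gradX i x y = (gradient (p.fz i) (WithLp.toLp 2 (x, y))).fst :=
    (hobj.hasGradientAt_x i hx hy).gradient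
  have e2 : p.gradX i x' y' = (gradient (p.fz i) (WithLp.toLp 2 (x', y'))).fst :=
    (hobj.hasGradientAt_x i hx' hy').gradient
  have e3 : p.gradY i x y = (gradient (p.fz i) (WithLp.toLp 2 (x, y))).snd :=
    (hobj.hasGradientAt_y i hx hy).gradient
  have e4 : p.gradY i x' y' = (gradient (p.fz i) (WithLp.toLp 2 (x', y'))).snd :=
    (hobj.hasGradientAt_y i hx' hy').gradient
  rw [e1, e2, e3, e4]
  simpa using h2

lemma ObjAssumption.gradX_lipschitz (hobj : p.ObjAssumption) (i : Fin m) {x x' : E n₁}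
    (hx : x ∈ dom p.g) (hx' : x' ∈ dom p.g) {y y' : E n₂} (hy : y ∈ dom p.h) (hy' : y' ∈ dom p.h) :
    ‖p.gradX i x y - p.gradX i x' y'‖ ^ 2 ≤ p.L ^ 2 * (‖x - x'‖ ^ 2 + ‖y - y'‖ ^ 2) := by
  have := hobj.joint_lipschitz i hx hx' hy hy'
  nlinarith [sq_nonneg ‖p.gradY i x y - p.gradY i x' y'‖]

lemma ObjAssumption.gradY_lipschitz_x (hobj : p.ObjAssumption) (i : Fin m) {x x' : E n₁}
    (hx : x ∈ dom p.g) (hx' : x' ∈ dom p.g) {y : E n₂} (hy : y ∈ dom p.h) :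
    ‖p.gradY i x y - p.gradY i x' y‖ ≤ p.L * ‖x - x'‖ := by
  have h := hobj.joint_lipschitz i hx hx' hy hy
  have hL := hobj.L_pos
  apply le_of_sq_le_sq _ (by positivity)
  rw [sub_self, norm_zero] at h
  nlinarith [sq_nonneg ‖p.gradX i x y - p.gradX i x' y‖]

/-- Quadratic upper bound in `x`. -/
lemma ObjAssumption.f_le_quadratic_x (hobj : p.ObjAssumption) (i : Fin m) {x x' : E n₁}
    (hx : x ∈ dom p.g) (hx' : x' ∈ dom p.g) {y : E n₂} (hy : y ∈ dom p.h) :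
    p.f i x' y ≤ p.f i x y + inner ℝ (p.gradX i x y) (x' - x) + p.L / 2 * ‖x' - x‖ ^ 2 := by
  refine le_quadratic_of_hasGradientAt (ψ := fun x => p.f i x y) (G := fun x => p.gradX i x y)
    hobj.g_closed.convex_dom (fun x hx => hobj.hasGradientAt_gradX i hx hy)
    (fun x hx x' hx' => ?_) hx hx'
  have h := hobj.gradX_lipschitz i hx' hx hy hy
  rw [sub_self, norm_zero] at h
  have hL := hobj.L_pos
  have h2 : ‖p.gradX i x' y - p.gradX i x y‖ ≤ p.L * ‖x' - x‖ := by
    apply le_of_sq_le_sq _ (by positivity)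
    rw [mul_pow]; linarith
  calc inner ℝ (p.gradX i x' y - p.gradX i x y) (x' - x)
      ≤ ‖p.gradX i x' y - p.gradX i x y‖ * ‖x' - x‖ := real_inner_le_norm _ _
    _ ≤ p.L * ‖x' - x‖ * ‖x' - x‖ := by gcongr
    _ = _ := by ring

/-! ### The local subproblems -/

/-- The smooth part of `-d`. -/
def psi (p : Problem m n₁ n₂) (i : Fin m) (x : E n₁) (lt y : E n₂) : ℝ :=
  p.L * √m / 2 * inner ℝ lt y - p.f i x y

lemma hasGradientAt_psi (i : Fin m) (x : E n₁) (lt : E n₂) {y : E n₂}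
    (h : HasGradientAt (fun y' => p.f i x y') (p.gradY i x y) y) :
    HasGradientAt (p.psi i x lt) (p.gradSmooth i x lt y) y := by
  rw [hasGradientAt_iff_hasFDerivAt] at h ⊢
  have h1 : HasFDerivAt (fun y : E n₂ => p.L * √m / 2 * inner ℝ lt y)
      ((p.L * √m / 2) • (innerSL ℝ lt)) y :=
    ((innerSL ℝ lt).hasFDerivAt (x := y)).const_mul _
  refine (h1.sub h).congr_fderiv ?_
  ext v
  simp [gradSmooth]

lemma gradSmooth_sub (i : Fin m) (x : E n₁) (lt y y' : E n₂) :
    p.gradSmooth i x lt y - p.gradSmooth i x lt y' = -(p.gradY i x y - p.gradY i x y') := by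
  simp only [gradSmooth]; abel

lemma smoothStrong_psi_of_gradY {C : Set (E n₂)} (hC : Convex ℝ C) (i : Fin m) (x : E n₁)
    (lt : E n₂) (hd : ∀ y ∈ C, HasGradientAt (fun y' => p.f i x y') (p.gradY i x y) y)
    (hlip : ∀ y ∈ C, ∀ y' ∈ C, ‖p.gradY i x y - p.gradY i x y'‖ ≤ p.Ly * ‖y - y'‖)
    (hmono : ∀ y ∈ C, ∀ y' ∈ C,
      inner ℝ (y - y') (p.gradY i x y - p.gradY i x y') ≤ -p.μ * ‖y - y'‖ ^ 2) :
    SmoothStrong (p.psi i x lt) (p.gradSmooth i x lt) p.μ p.Ly C := by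
  refine .of_gradient hC (fun y hy => hasGradientAt_psi i x lt (hd y hy)) ?_ ?_
  · intro y hy y' hy'
    rw [gradSmooth_sub, norm_neg]
    exact hlip y hy y' hy'
  · intro y hy y' hy'
    rw [gradSmooth_sub, inner_neg_right]
    have := hmono y hy y' hy'
    linarith

lemma ObjAssumption.smoothStrong (hobj : p.ObjAssumption) (i : Fin m) {x : E n₁}
    (hx : x ∈ dom p.g) (lt : E n₂) :
    SmoothStrong (p.psi i x lt) (p.gradSmooth i x lt) p.μ p.Ly (dom p.h) :=
  smoothStrong_psi_of_gradY hobj.h_closed.convex_dom i x lt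
    (fun _ hy => hobj.hasGradientAt_gradY i hx hy) (hobj.smooth_y i x hx)
    (hobj.strong_concave i x hx)

/-- The set of points that the extrapolated method may query. -/
def extrapolationSet (p : Problem m n₁ n₂) : Set (E n₂) :=
  {y | ∃ u ∈ dom p.h, ∃ v ∈ dom p.h, y = (2 : ℝ) • u - v}

lemma dom_subset_extrapolationSet : dom p.h ⊆ p.extrapolationSet :=
  fun y hy => ⟨y, hy, y, hy, by module⟩

lemma ExtrapolationRegular.smoothStrong (hreg : p.ExtrapolationRegular) (hobj : p.ObjAssumption)
    (i : Fin m) {x : E n₁} (hx : x ∈ dom p.g) (lt : E n₂) :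
    SmoothStrong (p.psi i x lt) (p.gradSmooth i x lt) p.μ p.Ly p.extrapolationSet := by
  have hC : Convex ℝ p.extrapolationSet := by
    rintro _ ⟨u, hu, v, hv, rfl⟩ _ ⟨u', hu', v', hv', rfl⟩ a b ha hb hab
    exact ⟨_, hobj.h_closed.convex_dom hu hu' ha hb hab, _,
      hobj.h_closed.convex_dom hv hv' ha hb hab, by module⟩
  exact smoothStrong_psi_of_gradY hC i x lt
    (fun y hy => ((hreg i x hx).1 y hy).hasGradientAt)
    (fun y hy y' hy' => ((hreg i x hx).2 y hy y' hy').1)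
    (fun y hy y' hy' => ((hreg i x hx).2 y hy y' hy').2)

lemma ObjAssumption.d_eq (hobj : p.ObjAssumption) (i : Fin m) (x : E n₁) (lt : E n₂) {y : E n₂}
    (hy : y ∈ dom p.h) :
    p.d i x lt y = ((-(p.psi i x lt y + (p.h y).toReal) : ℝ) : EReal) := by
  rw [d, ← hobj.h_closed.coe_toReal hy, ← EReal.coe_sub, EReal.toReal_coe, psi]
  congr 1
  ring

lemma d_eq_bot (i : Fin m) (x : E n₁) (lt : E n₂) {y : E n₂} (hy : y ∉ dom p.h) :
    p.d i x lt y = ⊥ := by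
  have : p.h y = ⊤ := by simpa [dom] using hy
  rw [d, this]
  rfl

/-- A maximizer of `d_i(x, ·)`. -/
def yhat (p : Problem m n₁ n₂) (i : Fin m) (x : E n₁) (lt : E n₂) : E n₂ :=
  Classical.epsilon fun y => IsSubgrad p.h y (-p.gradSmooth i x lt y)

lemma ObjAssumption.yhat_spec (hobj : p.ObjAssumption) (i : Fin m) {x : E n₁}
    (hx : x ∈ dom p.g) (lt : E n₂) :
    IsSubgrad p.h (p.yhat i x lt) (-p.gradSmooth i x lt (p.yhat i x lt)) :=
  Classical.epsilon_spec
    ((hobj.smoothStrong i hx lt).exists_isSubgrad hobj.h_closed hobj.mu_pos hobj.mu_le_Ly)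

/-- The maximum of `d_i(x, ·)`. -/
def dmax (p : Problem m n₁ n₂) (i : Fin m) (x : E n₁) (lt : E n₂) : ℝ :=
  -(p.psi i x lt (p.yhat i x lt) + (p.h (p.yhat i x lt)).toReal)

lemma ObjAssumption.le_dmax (hobj : p.ObjAssumption) (i : Fin m) {x : E n₁}
    (hx : x ∈ dom p.g) (lt : E n₂) {y : E n₂} (hy : y ∈ dom p.h) :
    -(p.psi i x lt y + (p.h y).toReal) + p.μ / 2 * ‖y - p.yhat i x lt‖ ^ 2 ≤ p.dmax i x lt := by
  have := (hobj.smoothStrong i hx lt).growth (hobj.yhat_spec i hx lt) hy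
  rw [dmax]
  linarith

lemma ObjAssumption.iSup_d (hobj : p.ObjAssumption) (i : Fin m) {x : E n₁}
    (hx : x ∈ dom p.g) (lt : E n₂) : ⨆ y, p.d i x lt y = (p.dmax i x lt : EReal) := by
  apply le_antisymm
  · refine iSup_le fun y => ?_
    by_cases hy : y ∈ dom p.h
    · rw [hobj.d_eq i x lt hy, EReal.coe_le_coe_iff]
      have h1 := hobj.le_dmax i hx lt hy
      have h2 : 0 ≤ p.μ / 2 * ‖y - p.yhat i x lt‖ ^ 2 := by
        have := hobj.mu_pos
        positivity
      linarith
    · rw [d_eq_bot i x lt hy]; exact bot_le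
  · refine le_trans (le_of_eq ?_) (le_iSup _ (p.yhat i x lt))
    rw [hobj.d_eq i x lt (hobj.yhat_spec i hx lt).1, dmax]

lemma ObjAssumption.gap_eq (hobj : p.ObjAssumption) (i : Fin m) {x : E n₁}
    (hx : x ∈ dom p.g) (lt : E n₂) {y : E n₂} (hy : y ∈ dom p.h) :
    p.gap i x lt y = p.dmax i x lt + (p.psi i x lt y + (p.h y).toReal) := by
  rw [gap, hobj.iSup_d i hx lt, hobj.d_eq i x lt hy, ← EReal.coe_sub, EReal.toReal_coe]
  ring

/-- `y` maximizes `d_i(x, ·)` up to a residual of norm at most `δ`. -/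
def IsApproxMax (p : Problem m n₁ n₂) (i : Fin m) (x : E n₁) (lt : E n₂) (δ : ℝ) (y : E n₂) :
    Prop :=
  ∃ ξ, IsSubgrad p.h y ξ ∧ ‖p.gradSmooth i x lt y + ξ‖ ≤ δ

lemma ObjAssumption.isApproxMax_yhat (hobj : p.ObjAssumption) (i : Fin m) {x : E n₁}
    (hx : x ∈ dom p.g) (lt : E n₂) : p.IsApproxMax i x lt 0 (p.yhat i x lt) :=
  ⟨_, hobj.yhat_spec i hx lt, by simp⟩

lemma IsApproxMax.mem_dom {i : Fin m} {x : E n₁} {lt : E n₂} {δ : ℝ} {y : E n₂}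
    (h : p.IsApproxMax i x lt δ y) : y ∈ dom p.h := by
  obtain ⟨ξ, hξ, -⟩ := h
  exact hξ.1

/-- The negated residual is itself a supergradient of d: convexity of the smooth part and the
subgradient inequality for h add up on `dom h`, and d is −∞ elsewhere. -/
lemma IsApproxMax.infEDist_le (hobj : p.ObjAssumption) {i : Fin m} {x : E n₁}
    (hx : x ∈ dom p.g) {lt : E n₂} {δ : ℝ} {y : E n₂} (h : p.IsApproxMax i x lt δ y) :
    Metric.infEDist 0 (superdiff (p.d i x lt) y) ≤ ENNReal.ofReal δ := by
  obtain ⟨ξ, hξ, hδ⟩ := h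
  have hmem : -(p.gradSmooth i x lt y + ξ) ∈ superdiff (p.d i x lt) y := by
    refine ⟨?_, fun z => ?_⟩
    · rw [hobj.d_eq i x lt hξ.1]; exact EReal.coe_ne_bot _
    by_cases hz : z ∈ dom p.h
    · rw [hobj.d_eq i x lt hξ.1, hobj.d_eq i x lt hz, ← EReal.coe_add, EReal.coe_le_coe_iff]
      have h1 := (hobj.smoothStrong i hx lt).lower y hξ.1 z hz
      have h2 := hξ.2 z hz
      rw [inner_neg_left, inner_add_left]
      have h3 : 0 ≤ p.μ / 2 * ‖z - y‖ ^ 2 := by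
        have := hobj.mu_pos
        positivity
      linarith
    · rw [d_eq_bot i x lt hz]; exact bot_le
  refine (Metric.infEDist_le_edist_of_mem hmem).trans ?_
  rw [edist_dist, dist_eq_norm, zero_sub, neg_neg]
  exact ENNReal.ofReal_le_ofReal hδ

lemma ObjAssumption.norm_gradSmooth_sub_le (hobj : p.ObjAssumption) (i : Fin m) {x x' : E n₁}
    (hx : x ∈ dom p.g) (hx' : x' ∈ dom p.g) (lt lt' : E n₂) {y : E n₂} (hy : y ∈ dom p.h) :
    ‖p.gradSmooth i x lt y - p.gradSmooth i x' lt' y‖ ≤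
      p.L * ‖x - x'‖ + p.L * √m / 2 * ‖lt - lt'‖ := by
  have e : p.gradSmooth i x lt y - p.gradSmooth i x' lt' y =
      (p.L * √m / 2) • (lt - lt') - (p.gradY i x y - p.gradY i x' y) := by
    simp only [gradSmooth, smul_sub]; abel
  have hL := hobj.L_pos
  rw [e]
  refine (norm_sub_le _ _).trans ?_
  rw [norm_smul, Real.norm_of_nonneg (by positivity)]
  linarith [hobj.gradY_lipschitz_x i hx hx' hy]

/-- Approximate maximizers are stable under perturbations of the data. -/
lemma IsApproxMax.mul_norm_sub_le (hobj : p.ObjAssumption) {i : Fin m} {x x' : E n₁}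
    (hx : x ∈ dom p.g) (hx' : x' ∈ dom p.g) {lt lt' : E n₂} {δ δ' : ℝ} {y y' : E n₂}
    (h : p.IsApproxMax i x lt δ y) (h' : p.IsApproxMax i x' lt' δ' y') :
    p.μ * ‖y - y'‖ ≤ δ + δ' + p.L * ‖x - x'‖ + p.L * √m / 2 * ‖lt - lt'‖ := by
  obtain ⟨ξ, hξ, hδ⟩ := h
  obtain ⟨ξ', hξ', hδ'⟩ := h'
  have h1 := hξ.monotone hξ'
  have h2 := (hobj.smoothStrong i hx lt).mono_inner hξ.1 hξ'.1
  have h3 := hobj.norm_gradSmooth_sub_le i hx hx' lt lt' hξ'.1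
  set K := δ + δ' + p.L * ‖x - x'‖ + p.L * √m / 2 * ‖lt - lt'‖ with hKdef
  -- The two residuals, the change of data at the fixed point y', and the change of the gradient in
  -- y alone; the last is strongly monotone and supplies μ‖y − y'‖².
  have e : ξ - ξ' = (p.gradSmooth i x lt y + ξ) - (p.gradSmooth i x' lt' y' + ξ')
      - (p.gradSmooth i x lt y' - p.gradSmooth i x' lt' y')
      - (p.gradSmooth i x lt y - p.gradSmooth i x lt y') := by abel
  rw [e, inner_sub_left] at h1
  set v := (p.gradSmooth i x lt y + ξ) - (p.gradSmooth i x' lt' y' + ξ')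
      - (p.gradSmooth i x lt y' - p.gradSmooth i x' lt' y')
  have hv : ‖v‖ ≤ K := by
    refine (norm_sub_le _ _).trans ?_
    have := norm_sub_le (p.gradSmooth i x lt y + ξ) (p.gradSmooth i x' lt' y' + ξ')
    linarith
  have h4 : inner ℝ v (y - y') ≤ K * ‖y - y'‖ := (real_inner_le_norm _ _).trans (by gcongr)
  rcases (norm_nonneg (y - y')).eq_or_lt with h0 | h0
  · rw [← h0, mul_zero]
    exact (norm_nonneg v).trans hv
  · have : p.μ * ‖y - y'‖ * ‖y - y'‖ ≤ K * ‖y - y'‖ := by nlinarith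
    exact le_of_mul_le_mul_right this h0

/-- The gap of an approximate maximizer after a perturbation of the data. -/
lemma IsApproxMax.gap_le (hobj : p.ObjAssumption) {i : Fin m} {x x' : E n₁}
    (hx : x ∈ dom p.g) (hx' : x' ∈ dom p.g) {lt lt' : E n₂} {δ : ℝ} {y : E n₂}
    (h : p.IsApproxMax i x lt δ y) :
    p.gap i x' lt' y ≤
      (δ + p.L * ‖x' - x‖ + p.L * √m / 2 * ‖lt' - lt‖) ^ 2 / (2 * p.μ) := by
  obtain ⟨ξ, hξ, hδ⟩ := h
  have hys := (hobj.yhat_spec i hx' lt').1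
  rw [hobj.gap_eq i hx' lt' hξ.1, dmax]
  set ys := p.yhat i x' lt'
  have h1 := (hobj.smoothStrong i hx' lt').lower y hξ.1 ys hys
  have h2 := hξ.2 ys hys
  have h3 := hobj.norm_gradSmooth_sub_le i hx' hx lt' lt hξ.1
  set K := δ + p.L * ‖x' - x‖ + p.L * √m / 2 * ‖lt' - lt‖ with hKdef
  -- K bounds the residual of y for the new data, with the same subgradient ξ of h.
  have hK : ‖p.gradSmooth i x' lt' y + ξ‖ ≤ K := by
    have e : p.gradSmooth i x' lt' y + ξ =
      (p.gradSmooth i x lt y + ξ) + (p.gradSmooth i x' lt' y - p.gradSmooth i x lt y) := by abel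
    rw [e]
    exact (norm_add_le _ _).trans (by linarith)
  have h4 : -inner ℝ (p.gradSmooth i x' lt' y + ξ) (ys - y) ≤ K * ‖ys - y‖ := by
    rw [← inner_neg_left]
    refine (real_inner_le_norm _ _).trans ?_
    rw [norm_neg]
    gcongr
  rw [inner_add_left] at h4
  have hμ := hobj.mu_pos
  have h5 : K * ‖ys - y‖ - p.μ / 2 * ‖ys - y‖ ^ 2 ≤ K ^ 2 / (2 * p.μ) := by
    rw [le_div_iff₀ (by positivity)]
    nlinarith [sq_nonneg (K - p.μ * ‖ys - y‖)]
  linarith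

/-! ### Convergence of the accelerated proximal gradient method -/

lemma ObjAssumption.one_le_κy (hobj : p.ObjAssumption) : 1 ≤ p.κy := by
  rw [κy, one_le_div hobj.mu_pos]; exact hobj.mu_le_Ly

lemma ObjAssumption.one_le_κ (hobj : p.ObjAssumption) : 1 ≤ p.κ := by
  rw [κ, one_le_div hobj.mu_pos]; exact hobj.mu_le_L

lemma apgIter_succ (form : APGForm) (i : Fin m) (x : E n₁) (lt y₀ : E n₂) (k : ℕ) :
    p.apgIter form i x lt y₀ (k + 1) = p.apgStep form i x lt (p.apgIter form i x lt y₀ k) :=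
  Function.iterate_succ_apply' _ _ _

lemma apgIter_evals (form : APGForm) (i : Fin m) (x : E n₁) (lt y₀ : E n₂) (k : ℕ) :
    (p.apgIter form i x lt y₀ k).evals = k := by
  induction k with
  | zero => rfl
  | succ k ih => rw [apgIter_succ]; cases form <;> simp [apgStep, ih]

lemma ObjAssumption.alpha_spec (hobj : p.ObjAssumption) :
    0 < 1 / √p.κy ∧ 1 / √p.κy ≤ 1 ∧ p.Ly * (1 / √p.κy) ^ 2 = p.μ := by
  have h1 := hobj.one_le_κy
  have h2 : 1 ≤ √p.κy := Real.one_le_sqrt.mpr h1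
  refine ⟨by positivity, by rw [div_le_one (by positivity)]; exact h2, ?_⟩
  rw [div_pow, Real.sq_sqrt (by linarith), κy]
  have := hobj.Ly_pos
  have := hobj.mu_pos
  field_simp

/-- Linear convergence of the APG in function values. -/
lemma ObjAssumption.apgIter_gap_le (hobj : p.ObjAssumption) {form : APGForm}
    (hform : form = APGForm.extrapolated → p.ExtrapolationRegular) (i : Fin m) {x : E n₁}
    (hx : x ∈ dom p.g) (lt : E n₂) {y₀ : E n₂} (hy₀ : y₀ ∈ dom p.h) (k : ℕ) :
    (p.apgIter form i x lt y₀ k).x ∈ dom p.h ∧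
      p.gap i x lt (p.apgIter form i x lt y₀ k).x ≤
        (1 - 1 / √p.κy) ^ k * (2 * p.gap i x lt y₀) := by
  obtain ⟨hα, hα1, hαL⟩ := hobj.alpha_spec
  have hspec := hobj.yhat_spec i hx lt
  have hμ := hobj.mu_pos
  have hψ := hobj.smoothStrong i hx lt
  have hgap : ∀ y ∈ dom p.h, p.gap i x lt y = p.psi i x lt y + (p.h y).toReal -
      (p.psi i x lt (p.yhat i x lt) + (p.h (p.yhat i x lt)).toReal) := by
    intro y hy
    rw [hobj.gap_eq i hx lt hy, dmax]
    ring
  -- Both forms start with their auxiliary point at y₀, so quadratic growth bounds the initial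
  -- energy by twice the initial gap.
  have hgrow : p.μ / 2 * ‖y₀ - p.yhat i x lt‖ ^ 2 ≤ p.gap i x lt y₀ := by
    rw [hgap y₀ hy₀]
    have := hψ.growth hspec hy₀
    linarith
  have hα0 : 0 ≤ 1 - 1 / √p.κy := by linarith
  set s : ℕ → APGState n₂ := p.apgIter form i x lt y₀ with hs
  cases form with
  | feasible =>
    have key : ∀ k, (s k).x ∈ dom p.h ∧ (s k).aux ∈ dom p.h ∧
        p.gap i x lt (s k).x + p.μ / 2 * ‖(s k).aux - p.yhat i x lt‖ ^ 2 ≤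
          (1 - 1 / √p.κy) ^ k * (2 * p.gap i x lt y₀) := by
      intro k
      induction k with
      | zero =>
        refine ⟨hy₀, hy₀, ?_⟩
        rw [pow_zero, one_mul]
        change p.gap i x lt y₀ + p.μ / 2 * ‖y₀ - p.yhat i x lt‖ ^ 2 ≤ _
        linarith
      | succ k ih =>
        obtain ⟨h1, h2, h3⟩ := ih
        have hstep := hψ.feasible_step hobj.h_closed hμ hspec.1 hα hα1 hαL h1 h2 rfl
          (w' := (s (k + 1)).aux) (u' := (s (k + 1)).x) (by rw [hs, apgIter_succ]; rfl)
          (by rw [hs, apgIter_succ]; rfl)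
        refine ⟨hstep.1, hstep.2.1, ?_⟩
        rw [hgap _ hstep.1, pow_succ' (1 - 1 / √p.κy), mul_assoc (1 - 1 / √p.κy)]
        rw [hgap _ h1] at h3
        exact hstep.2.2.trans (mul_le_mul_of_nonneg_left h3 hα0)
    refine ⟨(key k).1, le_trans ?_ (key k).2.2⟩
    have : 0 ≤ p.μ / 2 * ‖(s k).aux - p.yhat i x lt‖ ^ 2 := by positivity
    linarith
  | extrapolated =>
    have hψC := (hform rfl).smoothStrong hobj i hx lt
    have key : ∀ k, (s k).x ∈ dom p.h ∧ (s k).aux ∈ dom p.h ∧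
        p.gap i x lt (s k).x + p.μ / 2 * ‖(s k).aux + (1 / (1 / √p.κy)) • ((s k).x - (s k).aux)
          - p.yhat i x lt‖ ^ 2 ≤ (1 - 1 / √p.κy) ^ k * (2 * p.gap i x lt y₀) := by
      intro k
      induction k with
      | zero =>
        refine ⟨hy₀, hy₀, ?_⟩
        rw [pow_zero, one_mul]
        change p.gap i x lt y₀ + p.μ / 2 * ‖y₀ + (1 / (1 / √p.κy)) • (y₀ - y₀)
          - p.yhat i x lt‖ ^ 2 ≤ _
        rw [sub_self, smul_zero, add_zero]
        linarith
      | succ k ih =>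
        obtain ⟨h1, h2, h3⟩ := ih
        have haux : (s (k + 1)).aux = (s k).x := by rw [hs, apgIter_succ]; rfl
        have hstep := hψC.extrapolated_step hobj.h_closed dom_subset_extrapolationSet hμ
          hobj.Ly_pos hspec.1 hα hα1 hαL h1 (v := (s k).aux) rfl (by
            -- The query point is 2u − ((1 − β)u + βv) with β in [0, 1], hence of the form 2a − b
            -- with a and b in `dom h`.
            set β := (1 - 1 / √p.κy) / (1 + 1 / √p.κy) with hβ
            have hβ0 : 0 ≤ β := by positivity
            have hβ1 : β ≤ 1 := by rw [hβ, div_le_one (by positivity)]; linarith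
            exact ⟨_, h1, _, hobj.h_closed.convex_dom h1 h2 (sub_nonneg.mpr hβ1) hβ0 (by ring),
              by module⟩)
          (u' := (s (k + 1)).x) (by rw [hs, apgIter_succ]; rfl)
        refine ⟨hstep.1, haux ▸ h1, ?_⟩
        rw [hgap _ hstep.1, pow_succ' (1 - 1 / √p.κy), mul_assoc (1 - 1 / √p.κy), haux]
        rw [hgap _ h1] at h3
        exact hstep.2.trans (mul_le_mul_of_nonneg_left h3 hα0)
    refine ⟨(key k).1, le_trans ?_ (key k).2.2⟩
    have : 0 ≤ p.μ / 2 * ‖(s k).aux + (1 / (1 / √p.κy)) • ((s k).x - (s k).aux)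
          - p.yhat i x lt‖ ^ 2 := by positivity
    linarith

lemma ObjAssumption.gap_nonneg (hobj : p.ObjAssumption) (i : Fin m) {x : E n₁}
    (hx : x ∈ dom p.g) (lt : E n₂) {y : E n₂} (hy : y ∈ dom p.h) : 0 ≤ p.gap i x lt y := by
  have h1 := hobj.le_dmax i hx lt hy
  have h2 : 0 ≤ p.μ / 2 * ‖y - p.yhat i x lt‖ ^ 2 := by
    have := hobj.mu_pos
    positivity
  rw [hobj.gap_eq i hx lt hy]
  linarith

lemma one_le_apgBudget (i : Fin m) (x : E n₁) (lt y₀ : E n₂) (δ : ℝ) :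
    1 ≤ p.apgBudget i x lt y₀ δ := le_max_left _ _

lemma solveY_evals (form : APGForm) (i : Fin m) (x : E n₁) (lt y₀ : E n₂) (δ : ℝ) :
    (p.solveY form i x lt y₀ δ).2 = p.apgBudget i x lt y₀ δ := by
  simp only [solveY, apg, apgIter_evals]
  exact Nat.sub_add_cancel (one_le_apgBudget i x lt y₀ δ)

/-- The budgeted APG reaches the prescribed accuracy. -/
lemma ObjAssumption.isApproxMax_solveY (hobj : p.ObjAssumption) {form : APGForm}
    (hform : form = APGForm.extrapolated → p.ExtrapolationRegular) (i : Fin m) {x : E n₁}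
    (hx : x ∈ dom p.g) (lt : E n₂) {y₀ : E n₂} (hy₀ : y₀ ∈ dom p.h) {δ : ℝ} (hδ : 0 < δ) :
    p.IsApproxMax i x lt δ (p.solveY form i x lt y₀ δ).1 := by
  obtain ⟨hα, hα1, hαL⟩ := hobj.alpha_spec
  have hLy := hobj.Ly_pos
  have hμ := hobj.mu_pos
  have hψ := hobj.smoothStrong i hx lt
  set s := p.apgBudget i x lt y₀ δ with hs
  have hs1 : s - 1 + 1 = s := Nat.sub_add_cancel (one_le_apgBudget i x lt y₀ δ)
  obtain ⟨hu, hgap⟩ := hobj.apgIter_gap_le hform i hx lt hy₀ (s - 1)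
  obtain ⟨ξ, hξ, hres⟩ := hψ.prox_grad_residual hobj.h_closed hμ hobj.mu_le_Ly
    (hobj.yhat_spec i hx lt) hu rfl
  refine ⟨ξ, hξ, ?_⟩
  apply le_of_sq_le_sq _ hδ.le
  refine hres.trans ?_
  set α := 1 / √p.κy with hαdef
  set g₀ := p.gap i x lt y₀ with hg₀
  have hg0 : 0 ≤ g₀ := hobj.gap_nonneg i hx lt hy₀
  have e1 : p.psi i x lt (p.apgIter form i x lt y₀ (s - 1)).x +
      (p.h (p.apgIter form i x lt y₀ (s - 1)).x).toReal -
      (p.psi i x lt (p.yhat i x lt) + (p.h (p.yhat i x lt)).toReal) =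
      p.gap i x lt (p.apgIter form i x lt y₀ (s - 1)).x := by
    rw [hobj.gap_eq i hx lt hu, dmax]; ring
  rw [e1]
  have hα0 : 0 ≤ 1 - α := by linarith
  have h1 : 4 * (p.Ly - p.μ) * p.gap i x lt (p.apgIter form i x lt y₀ (s - 1)).x ≤
      16 * p.Ly * g₀ * (1 - α) ^ s := by
    calc 4 * (p.Ly - p.μ) * p.gap i x lt (p.apgIter form i x lt y₀ (s - 1)).x
        ≤ 4 * (p.Ly - p.μ) * ((1 - α) ^ (s - 1) * (2 * g₀)) := by
          apply mul_le_mul_of_nonneg_left hgap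
          linarith [hobj.mu_le_Ly]
      -- Since μ = L_y α², the factor L_y − μ equals L_y(1 − α)(1 + α): the last proximal gradient
      -- step provides the power of 1 − α missing from the s − 1 accelerated ones.
      _ = 8 * (1 + α) * (p.Ly * g₀ * (1 - α) ^ (s - 1 + 1)) := by
          rw [← hαL]; ring
      _ ≤ 8 * (1 + 1) * (p.Ly * g₀ * (1 - α) ^ (s - 1 + 1)) := by gcongr
      _ = _ := by rw [hs1]; ring
  refine h1.trans ?_
  -- With zero gap the logarithm in the budget is `Real.log 0 = 0` and carries no information, but
  -- the residual bound vanishes.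
  rcases hg0.eq_or_lt with h0 | h0
  · rw [← h0]; simp; positivity
  set A := 16 * p.Ly * g₀ / δ ^ 2 with hA
  have hA0 : 0 < A := by positivity
  have hsA : √p.κy * Real.log A ≤ s := by
    refine (Nat.le_ceil _).trans ?_
    exact_mod_cast le_max_right 1 _
  have h2 : (1 - α) ^ s ≤ A⁻¹ := by
    calc (1 - α) ^ s ≤ (Real.exp (-α)) ^ s := by
          gcongr
          have := Real.add_one_le_exp (-α)
          linarith
      _ = Real.exp (-(α * s)) := by rw [← Real.exp_nat_mul]; ring_nf
      _ ≤ Real.exp (-Real.log A) := by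
          apply Real.exp_le_exp.mpr
          have hk : 0 < √p.κy := Real.sqrt_pos.mpr (by linarith [hobj.one_le_κy])
          have : α * (√p.κy * Real.log A) ≤ α * s := by gcongr
          rw [hαdef, ← mul_assoc, one_div_mul_cancel hk.ne', one_mul] at this
          linarith
      _ = A⁻¹ := by rw [Real.exp_neg, Real.exp_log hA0]
  calc 16 * p.Ly * g₀ * (1 - α) ^ s ≤ 16 * p.Ly * g₀ * A⁻¹ := by gcongr
    _ = δ ^ 2 := by rw [hA]; field_simp

end Problem

/-! ### Averages and mixing matrices -/

/-- The average of the rows. -/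
def mean {m n : ℕ} (U : Fin m → E n) : E n := (1 / (m : ℝ)) • ∑ j, U j

section Mean

variable {m n : ℕ}

lemma perpSq_eq (U : Fin m → E n) : perpSq U = ∑ i, ‖U i - mean U‖ ^ 2 := rfl

lemma perpSq_nonneg (U : Fin m → E n) : 0 ≤ perpSq U :=
  Finset.sum_nonneg fun _ _ => sq_nonneg _

lemma mean_add (U V : Fin m → E n) : mean (fun i => U i + V i) = mean U + mean V := by
  simp only [mean, Finset.sum_add_distrib, smul_add]

lemma mean_sub (U V : Fin m → E n) : mean (fun i => U i - V i) = mean U - mean V := by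
  simp only [mean, Finset.sum_sub_distrib, smul_sub]

lemma card_smul_mean (hm : 0 < m) (U : Fin m → E n) : (m : ℝ) • mean U = ∑ i, U i := by
  have : (m : ℝ) ≠ 0 := by positivity
  rw [mean, smul_smul, mul_one_div_cancel this, one_smul]

lemma mean_const (hm : 0 < m) (c : E n) : mean (fun _ : Fin m => c) = c := by
  have : (m : ℝ) ≠ 0 := by positivity
  rw [mean, Finset.sum_const, Finset.card_univ, Fintype.card_fin, ← Nat.cast_smul_eq_nsmul ℝ,
    smul_smul, one_div_mul_cancel this, one_smul]

lemma sum_sub_mean (hm : 0 < m) (U : Fin m → E n) : ∑ i, (U i - mean U) = 0 := by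
  rw [Finset.sum_sub_distrib, ← card_smul_mean hm, Finset.sum_const, Finset.card_univ,
    Fintype.card_fin, ← Nat.cast_smul_eq_nsmul ℝ, sub_self]

/-- Bias–variance decomposition: the cross terms vanish because deviations from the average sum to
zero. -/
lemma sum_norm_sub_sq (hm : 0 < m) (U : Fin m → E n) (c : E n) :
    ∑ i, ‖c - U i‖ ^ 2 = m * ‖c - mean U‖ ^ 2 + perpSq U := by
  have h : ∀ i, ‖c - U i‖ ^ 2 =
      ‖c - mean U‖ ^ 2 - 2 * inner ℝ (c - mean U) (U i - mean U) + ‖U i - mean U‖ ^ 2 := by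
    intro i
    rw [← norm_sub_sq_real, sub_sub_sub_cancel_right]
  rw [Finset.sum_congr rfl fun i _ => h i, Finset.sum_add_distrib, Finset.sum_sub_distrib,
    ← Finset.mul_sum, ← inner_sum, sum_sub_mean hm, inner_zero_right, Finset.sum_const,
    Finset.card_univ, Fintype.card_fin, nsmul_eq_mul, perpSq_eq]
  ring

lemma perpSq_le (hm : 0 < m) (U : Fin m → E n) : perpSq U ≤ ∑ i, ‖U i‖ ^ 2 := by
  have h := sum_norm_sub_sq hm U 0
  simp only [zero_sub, norm_neg] at h
  rw [h]
  have : 0 ≤ m * ‖mean U‖ ^ 2 := by positivity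
  linarith

lemma norm_add_sq_le (a b : E n) : ‖a + b‖ ^ 2 ≤ 2 * ‖a‖ ^ 2 + 2 * ‖b‖ ^ 2 := by
  have h := parallelogram_law_with_norm ℝ a b
  nlinarith [sq_nonneg ‖a - b‖]

lemma sum_norm_sub_sq_le (hm : 0 < m) (U V : Fin m → E n) :
    ∑ i, ‖U i - V i‖ ^ 2 ≤ m * ‖mean U - mean V‖ ^ 2 + 2 * perpSq U + 2 * perpSq V := by
  have h := sum_norm_sub_sq hm (fun i => U i - V i) 0
  simp only [zero_sub, norm_neg] at h
  rw [h, mean_sub]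
  have h2 : perpSq (fun i => U i - V i) ≤ 2 * perpSq U + 2 * perpSq V := by
    simp only [perpSq_eq, mean_sub, Finset.mul_sum]
    rw [← Finset.sum_add_distrib]
    refine Finset.sum_le_sum fun i _ => ?_
    have e : U i - V i - (mean U - mean V) = (U i - mean U) + -(V i - mean V) := by abel
    rw [e]
    refine (norm_add_sq_le _ _).trans ?_
    rw [norm_neg]
  linarith

lemma sum_inner_le_sqrt (a b : Fin m → E n) :
    ∑ i, inner ℝ (a i) (b i) ≤ √(∑ i, ‖a i‖ ^ 2) * √(∑ i, ‖b i‖ ^ 2) :=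
  (Finset.sum_le_sum fun _ _ => real_inner_le_norm _ _).trans
    (Real.sum_mul_le_sqrt_mul_sqrt _ _ _)

lemma sum_norm_add_sq_le (a b : Fin m → E n) :
    ∑ i, ‖a i + b i‖ ^ 2 ≤ (√(∑ i, ‖a i‖ ^ 2) + √(∑ i, ‖b i‖ ^ 2)) ^ 2 := by
  have h := sum_inner_le_sqrt a b
  simp only [norm_add_sq_real, Finset.sum_add_distrib, ← Finset.mul_sum]
  have ha : 0 ≤ ∑ i, ‖a i‖ ^ 2 := Finset.sum_nonneg fun _ _ => sq_nonneg _
  have hb : 0 ≤ ∑ i, ‖b i‖ ^ 2 := Finset.sum_nonneg fun _ _ => sq_nonneg _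
  nlinarith [Real.sq_sqrt ha, Real.sq_sqrt hb]

/-- Rowwise action of a matrix is bounded by its spectral norm. -/
lemma sum_norm_sum_smul_sq_le (A : Matrix (Fin m) (Fin m) ℝ) (U : Fin m → E n) :
    ∑ i, ‖∑ j, A i j • U j‖ ^ 2 ≤
      ‖Matrix.toEuclideanCLM (n := Fin m) (𝕜 := ℝ) A‖ ^ 2 * ∑ j, ‖U j‖ ^ 2 := by
  simp only [EuclideanSpace.norm_sq_eq]
  rw [Finset.sum_comm, Finset.sum_comm (s := Finset.univ (α := Fin m)) (f := fun j k => ‖U j k‖ ^ 2),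
    Finset.mul_sum]
  refine Finset.sum_le_sum fun k _ => ?_
  set u : EuclideanSpace ℝ (Fin m) := WithLp.toLp 2 fun j => U j k with hu
  have h := (Matrix.toEuclideanCLM (n := Fin m) (𝕜 := ℝ) A).le_opNorm u
  have h2 : ‖Matrix.toEuclideanCLM (n := Fin m) (𝕜 := ℝ) A u‖ ^ 2 ≤
      (‖Matrix.toEuclideanCLM (n := Fin m) (𝕜 := ℝ) A‖ * ‖u‖) ^ 2 := by gcongr
  rw [mul_pow, EuclideanSpace.norm_sq_eq, EuclideanSpace.norm_sq_eq u] at h2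
  refine le_trans (le_of_eq (Finset.sum_congr rfl fun i _ => ?_)) h2
  congr 2
  rw [hu, Matrix.toEuclideanCLM_toLp]
  simp [Matrix.mulVec, dotProduct]

lemma sqrt_le_mul_sqrt {a b c : ℝ} (hc : 0 ≤ c) (h : a ≤ c ^ 2 * b) : √a ≤ c * √b :=
  (Real.sqrt_le_sqrt h).trans_eq (by rw [Real.sqrt_mul (sq_nonneg c), Real.sqrt_sq hc])

end Mean

namespace Problem

variable {m n₁ n₂ n : ℕ} {p : Problem m n₁ n₂}

lemma MixAssumption.card_pos (hmix : p.MixAssumption) : 0 < m :=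
  Fin.pos_iff_nonempty.mpr hmix.connected.nonempty

lemma MixAssumption.row_sum (hmix : p.MixAssumption) (i : Fin m) : ∑ j, p.W i j = 1 := by
  have h : (fun _ => (1 : ℝ)) ∈ LinearMap.ker (Matrix.toLin' (p.W - 1)) := by
    rw [hmix.null_space]
    exact Submodule.mem_span_singleton_self _
  rw [LinearMap.mem_ker, Matrix.toLin'_apply, Matrix.sub_mulVec, Matrix.one_mulVec] at h
  have := congrFun h i
  simp only [Pi.sub_apply, Matrix.mulVec, dotProduct, mul_one, Pi.zero_apply] at this
  linarith

lemma MixAssumption.col_sum (hmix : p.MixAssumption) (j : Fin m) : ∑ i, p.W i j = 1 := by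
  have := congrFun hmix.transpose_one j
  simpa [Matrix.mulVec, dotProduct] using this

lemma rho_nonneg : 0 ≤ p.ρ := norm_nonneg _

/-- Mixing preserves the average. -/
lemma MixAssumption.mean_mix (hmix : p.MixAssumption) (U : Fin m → E n) :
    mean (fun i => ∑ j, p.W i j • U j) = mean U := by
  simp only [mean]
  rw [Finset.sum_comm]
  simp only [← Finset.sum_smul, hmix.col_sum, one_smul]

/-- Mixing contracts the distance to consensus. -/
lemma MixAssumption.sum_mix_sub_mean_sq_le (hmix : p.MixAssumption) (U : Fin m → E n) :
    ∑ i, ‖∑ j, p.W i j • U j - mean U‖ ^ 2 ≤ p.ρ ^ 2 * perpSq U := by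
  have h := sum_norm_sum_smul_sq_le (p.W - Matrix.of fun _ _ => 1 / (m : ℝ))
    (fun j => U j - mean U)
  refine le_trans (le_of_eq (Finset.sum_congr rfl fun i _ => ?_)) h
  congr 2
  simp only [Matrix.sub_apply, Matrix.of_apply, sub_smul]
  rw [Finset.sum_sub_distrib, ← Finset.smul_sum, sum_sub_mean hmix.card_pos, smul_zero, sub_zero]
  simp only [smul_sub, Finset.sum_sub_distrib, ← Finset.sum_smul, hmix.row_sum, one_smul]

/-- The map Λ ↦ Λ̃ is the transpose of W − I, whose spectral norm equals that of W − I and is at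
most 2. -/
lemma MixAssumption.sum_norm_lamTilde_sq_le (hmix : p.MixAssumption) (U : Fin m → E n) :
    ∑ i, ‖lamTilde p.W U i‖ ^ 2 ≤ 4 * ∑ i, ‖U i‖ ^ 2 := by
  have h := sum_norm_sum_smul_sq_le (star (p.W - 1)) U
  have e : ∀ i, ∑ j, (star (p.W - 1)) i j • U j = lamTilde p.W U i := by
    intro i
    simp [lamTilde, Matrix.star_apply, Matrix.sub_apply, sub_smul, Finset.sum_sub_distrib,
      Matrix.one_apply]
  have hstar : ‖star (Matrix.toEuclideanCLM (n := Fin m) (𝕜 := ℝ) (p.W - 1))‖ =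
      ‖Matrix.toEuclideanCLM (n := Fin m) (𝕜 := ℝ) (p.W - 1)‖ :=
    (ContinuousLinearMap.adjoint (𝕜 := ℝ)).norm_map _
  rw [map_star, hstar] at h
  simp only [e] at h
  refine h.trans ?_
  have h0 : 0 ≤ ∑ j, ‖U j‖ ^ 2 := Finset.sum_nonneg fun _ _ => sq_nonneg _
  have h2 := hmix.norm_le_two
  have h3 : ‖Matrix.toEuclideanCLM (n := Fin m) (𝕜 := ℝ) (p.W - 1)‖ ^ 2 ≤ 2 ^ 2 := by gcongr
  nlinarith

lemma lamTilde_sub (W : Matrix (Fin m) (Fin m) ℝ) (lam lam' : Fin m → E n) (i : Fin m) :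
    lamTilde W lam i - lamTilde W lam' i = lamTilde W (fun i => lam i - lam' i) i := by
  simp only [lamTilde, smul_sub, Finset.sum_sub_distrib]
  abel

/-- Moving W − I from Y onto Λ is what decouples Φ into one subproblem per agent. -/
lemma sum_inner_lamTilde (W : Matrix (Fin m) (Fin m) ℝ) (lam Y : Fin m → E n) :
    ∑ i, inner ℝ (lamTilde W lam i) (Y i) = ∑ i, inner ℝ (lam i) (∑ j, W i j • Y j - Y i) := by
  simp only [lamTilde, inner_sub_left, inner_sub_right, Finset.sum_sub_distrib, sum_inner,
    inner_sum, inner_smul_left, inner_smul_right, conj_trivial]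
  rw [Finset.sum_comm]

/-! ### Effect of one iteration on each part of the merit function -/

/-- Mixing contracts deviations by ρ, and ρa + b is the convex combination of a and b/(1 − ρ) with
weights ρ and 1 − ρ; convexity of the square does the rest. It is applied to gradient tracking, D
being the change of the local gradients. -/
lemma perpSq_mix_add_le (hmix : p.MixAssumption) (V D : Fin m → E n) :
    perpSq (fun i => ∑ j, p.W i j • V j + D i) ≤
      p.ρ * perpSq V + (∑ i, ‖D i‖ ^ 2) / (1 - p.ρ) := by
  have hρ := hmix.rho_lt_one
  have hρ0 : 0 ≤ p.ρ := rho_nonneg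
  have h1 := hmix.sum_mix_sub_mean_sq_le V
  have h2 := perpSq_le hmix.card_pos D
  have e : perpSq (fun i => ∑ j, p.W i j • V j + D i) =
      ∑ i, ‖(∑ j, p.W i j • V j - mean V) + (D i - mean D)‖ ^ 2 := by
    rw [perpSq_eq, mean_add, hmix.mean_mix]
    refine Finset.sum_congr rfl fun i _ => ?_
    congr 2
    abel
  rw [e]
  refine (sum_norm_add_sq_le _ _).trans ?_
  rw [← perpSq_eq D]
  set S := ∑ i, ‖D i‖ ^ 2
  have hS : 0 ≤ S := Finset.sum_nonneg fun _ _ => sq_nonneg _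
  have hV := perpSq_nonneg V
  have h3 : √(∑ i, ‖∑ j, p.W i j • V j - mean V‖ ^ 2) ≤ p.ρ * √(perpSq V) :=
    sqrt_le_mul_sqrt hρ0 h1
  have h4 : √(perpSq D) ≤ √S := Real.sqrt_le_sqrt h2
  have h5 : (√(∑ i, ‖∑ j, p.W i j • V j - mean V‖ ^ 2) + √(perpSq D)) ^ 2 ≤
      (p.ρ * √(perpSq V) + √S) ^ 2 := by gcongr
  refine h5.trans ?_
  have h1ρ : 0 < 1 - p.ρ := by linarith
  have e1 := Real.sq_sqrt hV
  have e2 := Real.sq_sqrt hS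
  set a := √(perpSq V)
  set b := √S
  rw [← e1, ← e2]
  have : p.ρ * a ^ 2 + b ^ 2 / (1 - p.ρ) - (p.ρ * a + b) ^ 2 =
      p.ρ * ((1 - p.ρ) * a - b) ^ 2 / (1 - p.ρ) := by field_simp; ring
  have h6 : 0 ≤ p.ρ * ((1 - p.ρ) * a - b) ^ 2 / (1 - p.ρ) := by positivity
  linarith

lemma _root_.DGDMax.IsClosedConvex.mean_mem {r : E n → EReal} (hr : IsClosedConvex r) (hm : 0 < m)
    {U : Fin m → E n} (hU : ∀ i, U i ∈ dom r) :
    mean U ∈ dom r ∧ (r (mean U)).toReal ≤ 1 / (m : ℝ) * ∑ i, (r (U i)).toReal := by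
  have hcvx : ConvexOn ℝ (dom r) fun x => (r x).toReal :=
    ⟨hr.convex_dom, fun _ hx _ hy _ _ ha hb hab => (hr.combo hx hy ha hb hab).2⟩
  have hm0 : (m : ℝ) ≠ 0 := by positivity
  have hw : ∑ _i : Fin m, 1 / (m : ℝ) = 1 := by
    rw [Finset.sum_const, Finset.card_univ, Fintype.card_fin, nsmul_eq_mul,
      mul_one_div_cancel hm0]
  have e : mean U = ∑ i, (1 / (m : ℝ)) • U i := by rw [mean, Finset.smul_sum]
  rw [e]
  refine ⟨hr.convex_dom.sum_mem (fun _ _ => by positivity) hw fun i _ => hU i, ?_⟩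
  have h := hcvx.map_sum_le (t := Finset.univ) (w := fun _ => 1 / (m : ℝ)) (p := U)
    (fun _ _ => by positivity) hw fun i _ => hU i
  simpa [Finset.mul_sum] using h

/-- Decrease of `g` at the averages. -/
lemma g_mean_step_le (hg : IsClosedConvex p.g) (hmix : p.MixAssumption) {η : ℝ} (hη : 0 < η)
    {x x' v : Fin m → E n₁} (hx : mean x ∈ dom p.g)
    (hx' : ∀ i, x' i = prox (scale η p.g) (∑ j, p.W i j • x j - η • v i)) :
    (p.g (mean x')).toReal ≤ (p.g (mean x)).toReal - inner ℝ (mean v) (mean x' - mean x)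
      - 1 / η * ‖mean x' - mean x‖ ^ 2 - 1 / (2 * m * η) * (perpSq x' - perpSq x)
      - (1 - p.ρ) / (2 * m * η) * perpSq x - (1 - p.ρ) / (4 * m * η) * perpSq x'
      + η / (m * (1 - p.ρ)) * perpSq v := by
  have hm := hmix.card_pos
  have hm0 : (0 : ℝ) < m := by exact_mod_cast hm
  have h1ρ : 0 < 1 - p.ρ := by linarith [hmix.rho_lt_one]
  have hsub : ∀ i, IsSubgrad p.g (x' i)
      ((1 / η) • (∑ j, p.W i j • x j - η • v i - x' i)) := fun i => by
    have := isSubgrad_prox hg hη (∑ j, p.W i j • x j - η • v i)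
    rwa [← hx' i] at this
  have hjen := hg.mean_mem hm fun i => (hsub i).1
  set D := mean x' - mean x with hD
  -- The families b, c, e sum to zero, so after summation over the agents their products with D and
  -- with `mean v` vanish. Only ⟨b, e⟩, controlled by the contraction of mixing, and ⟨c, e⟩,
  -- controlled by Young's inequality, survive.
  set b : Fin m → E n₁ := fun i => ∑ j, p.W i j • x j - mean x with hb
  set c : Fin m → E n₁ := fun i => v i - mean v with hc
  set e : Fin m → E n₁ := fun i => x' i - mean x' with he
  have hb0 : ∑ i, b i = 0 := by
    have := sum_sub_mean hm (fun i => ∑ j, p.W i j • x j)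
    rwa [hmix.mean_mix] at this
  have hc0 : ∑ i, c i = 0 := sum_sub_mean hm v
  have he0 : ∑ i, e i = 0 := sum_sub_mean hm x'
  have hterm : ∀ i, (p.g (x' i)).toReal ≤ (p.g (mean x)).toReal + 1 / η *
      (inner ℝ (b i) D + inner ℝ (b i) (e i) - η * inner ℝ (mean v) D - η * inner ℝ (mean v) (e i)
        - η * inner ℝ (c i) D - η * inner ℝ (c i) (e i) - ‖D‖ ^ 2 - 2 * inner ℝ D (e i)
        - ‖e i‖ ^ 2) := by
    intro i
    have h := (hsub i).2 _ hx
    have e1 : mean x - x' i = -(D + e i) := by simp only [hD, he]; abel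
    have e2 : ∑ j, p.W i j • x j - η • v i - x' i = b i - η • mean v - η • c i - D - e i := by
      simp only [hb, hc, hD, he, smul_sub]; abel
    rw [e1, e2, inner_neg_right, inner_smul_left] at h
    simp only [inner_sub_left, inner_add_right, inner_smul_left, conj_trivial,
      real_inner_self_eq_norm_sq] at h
    rw [real_inner_comm (e i) D] at *
    linarith
  have hsum := Finset.sum_le_sum fun i (_ : i ∈ Finset.univ) => hterm i
  simp only [Finset.sum_add_distrib, ← Finset.mul_sum, Finset.sum_sub_distrib, ← sum_inner,
    ← inner_sum, hb0, hc0, he0, inner_zero_left, inner_zero_right, Finset.sum_const,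
    Finset.card_univ, Fintype.card_fin, nsmul_eq_mul] at hsum
  have hbe : ∑ i, inner ℝ (b i) (e i) ≤ p.ρ * (perpSq x + perpSq x') / 2 := by
    refine (sum_inner_le_sqrt b e).trans ?_
    have hρ0 : 0 ≤ p.ρ := rho_nonneg
    have h3 : √(∑ i, ‖b i‖ ^ 2) ≤ p.ρ * √(perpSq x) :=
      sqrt_le_mul_sqrt hρ0 (hmix.sum_mix_sub_mean_sq_le x)
    have e1 := Real.sq_sqrt (perpSq_nonneg x)
    have e2 := Real.sq_sqrt (perpSq_nonneg x')
    rw [← perpSq_eq x']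
    calc √(∑ i, ‖b i‖ ^ 2) * √(perpSq x') ≤ p.ρ * √(perpSq x) * √(perpSq x') := by gcongr
      _ = p.ρ * (√(perpSq x) * √(perpSq x')) := by ring
      _ ≤ p.ρ * ((perpSq x + perpSq x') / 2) := by
        gcongr
        nlinarith [sq_nonneg (√(perpSq x) - √(perpSq x'))]
      _ = _ := by ring
  have hce : -(η * ∑ i, inner ℝ (c i) (e i)) ≤
      η ^ 2 / (1 - p.ρ) * perpSq v + (1 - p.ρ) / 4 * perpSq x' := by
    rw [perpSq_eq v, perpSq_eq x', Finset.mul_sum, Finset.mul_sum, Finset.mul_sum,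
      ← Finset.sum_add_distrib, ← Finset.sum_neg_distrib]
    refine Finset.sum_le_sum fun i _ => ?_
    have h := real_inner_le_norm (-(c i)) (e i)
    rw [inner_neg_left, norm_neg] at h
    have h2 := mul_le_mul_of_nonneg_left h hη.le
    have h3 : η ^ 2 / (1 - p.ρ) * ‖c i‖ ^ 2 + (1 - p.ρ) / 4 * ‖e i‖ ^ 2 - η * (‖c i‖ * ‖e i‖) =
        (η * ‖c i‖ - (1 - p.ρ) / 2 * ‖e i‖) ^ 2 / (1 - p.ρ) := by field_simp; ring
    have h4 : 0 ≤ (η * ‖c i‖ - (1 - p.ρ) / 2 * ‖e i‖) ^ 2 / (1 - p.ρ) := by positivity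
    linarith
  have hnsmul : inner ℝ (m • mean v) D = m * inner ℝ (mean v) D := by
    rw [← Nat.cast_smul_eq_nsmul ℝ, inner_smul_left, conj_trivial]
  rw [← perpSq_eq x', hnsmul] at hsum
  refine hjen.2.trans ?_
  have hfin : 1 / (m : ℝ) * ∑ i, (p.g (x' i)).toReal ≤ 1 / (m : ℝ) *
      (m * (p.g (mean x)).toReal + 1 / η * (p.ρ * (perpSq x + perpSq x') / 2
        + (η ^ 2 / (1 - p.ρ) * perpSq v + (1 - p.ρ) / 4 * perpSq x')
        - η * (m * inner ℝ (mean v) D) - m * ‖D‖ ^ 2 - perpSq x')) := by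
    gcongr
    refine hsum.trans ?_
    refine add_le_add le_rfl (mul_le_mul_of_nonneg_left ?_ (by positivity))
    linarith
  refine hfin.trans (le_of_eq ?_)
  field_simp
  ring

/-! ### The dual function -/

/-- The finite value of `P(x, Λ)`. -/
def Pval (p : Problem m n₁ n₂) (x : E n₁) (Lam : Fin m → E n₂) : ℝ :=
  1 / (m : ℝ) * ∑ i, p.dmax i x (lamTilde p.W Lam i)

lemma add_add_sq_le (a b c : ℝ) : (a + b + c) ^ 2 ≤ 3 * (a ^ 2 + b ^ 2 + c ^ 2) := by
  nlinarith [sq_nonneg (a - b), sq_nonneg (b - c), sq_nonneg (a - c)]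

lemma IsApproxMax.norm_sub_sq_le (hobj : p.ObjAssumption) {i : Fin m} {x x' : E n₁}
    (hx : x ∈ dom p.g) (hx' : x' ∈ dom p.g) {lt lt' : E n₂} {δ δ' : ℝ} {y y' : E n₂}
    (h : p.IsApproxMax i x lt δ y) (h' : p.IsApproxMax i x' lt' δ' y') :
    ‖y - y'‖ ^ 2 ≤ 3 * p.κ ^ 2 *
      ((δ + δ') ^ 2 / p.L ^ 2 + ‖x - x'‖ ^ 2 + m / 4 * ‖lt - lt'‖ ^ 2) := by
  have h1 := h.mul_norm_sub_le hobj hx hx' h'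
  have hμ := hobj.mu_pos
  have hL := hobj.L_pos
  have h2 : (p.μ * ‖y - y'‖) ^ 2 ≤
      3 * ((δ + δ') ^ 2 + (p.L * ‖x - x'‖) ^ 2 + (p.L * √m / 2 * ‖lt - lt'‖) ^ 2) :=
    (pow_le_pow_left₀ (by positivity) h1 2).trans (add_add_sq_le _ _ _)
  have hm : √(m : ℝ) ^ 2 = m := Real.sq_sqrt (by positivity)
  rw [show (p.L * √m / 2 * ‖lt - lt'‖) ^ 2 = p.L ^ 2 * √m ^ 2 / 4 * ‖lt - lt'‖ ^ 2 by ring, hm,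
    mul_pow] at h2
  rw [κ]
  calc ‖y - y'‖ ^ 2 = (p.μ ^ 2 * ‖y - y'‖ ^ 2) / p.μ ^ 2 := by field_simp
    _ ≤ (3 * ((δ + δ') ^ 2 + (p.L * ‖x - x'‖) ^ 2 + p.L ^ 2 * m / 4 * ‖lt - lt'‖ ^ 2))
        / p.μ ^ 2 := by gcongr
    _ = _ := by field_simp

/-- Change of one local maximum after a perturbation of the data, compared with the
gradients at an approximate maximizer. -/
lemma ObjAssumption.dmax_sub_le (hobj : p.ObjAssumption) {i : Fin m} {x xb xb' : E n₁}
    (hx : x ∈ dom p.g) (hxb : xb ∈ dom p.g) (hxb' : xb' ∈ dom p.g) {lt lt' : E n₂} {δ : ℝ}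
    {y : E n₂} (h : p.IsApproxMax i x lt δ y) :
    p.dmax i xb' lt' - p.dmax i xb lt ≤ inner ℝ (p.gradX i x y) (xb' - xb)
      - p.L * √m / 2 * inner ℝ (lt' - lt) y + 5 / 2 * (p.L * p.κ) * ‖xb' - xb‖ ^ 2
      + p.L * p.κ / 8 * ‖xb - x‖ ^ 2 + p.L * p.κ * m / 4 * ‖lt' - lt‖ ^ 2
      + 9 / 8 * (p.L * p.κ) *
        (δ ^ 2 / p.L ^ 2 + ‖xb' - x‖ ^ 2 + m / 4 * ‖lt' - lt‖ ^ 2) := by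
  have hL := hobj.L_pos
  have hκ := hobj.one_le_κ
  have hκ0 : 0 < p.κ := by linarith
  have hμ := hobj.mu_pos
  -- The maximizer for the new data is admissible for the old, so the increase of the maximum is at
  -- most the change of the objective at this one point. It is then replaced by the computed y, at a
  -- cost of order ‖ys − y‖².
  have hys := (hobj.yhat_spec i hxb' lt').1
  have hr := (hobj.isApproxMax_yhat i hxb' lt').norm_sub_sq_le hobj hxb' hx h
  have h1 := hobj.le_dmax i hxb lt hys
  have h2 : 0 ≤ p.μ / 2 * ‖p.yhat i xb' lt' - p.yhat i xb lt‖ ^ 2 := by positivity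
  have h3 : p.dmax i xb' lt' = -(p.psi i xb' lt' (p.yhat i xb' lt')
    + (p.h (p.yhat i xb' lt')).toReal) := rfl
  set ys := p.yhat i xb' lt'
  have h4 := hobj.f_le_quadratic_x i hxb hxb' hys
  have h5 := hobj.gradX_lipschitz i hxb hx hys h.mem_dom
  rw [zero_add] at hr
  have h6 : inner ℝ (p.gradX i xb ys) (xb' - xb) ≤ inner ℝ (p.gradX i x y) (xb' - xb) +
      2 * (p.L * p.κ) * ‖xb' - xb‖ ^ 2 + p.L / (8 * p.κ) * (‖xb - x‖ ^ 2 + ‖ys - y‖ ^ 2) := by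
    have e1 : inner ℝ (p.gradX i xb ys) (xb' - xb) = inner ℝ (p.gradX i x y) (xb' - xb) +
      inner ℝ (p.gradX i xb ys - p.gradX i x y) (xb' - xb) := by rw [inner_sub_left]; ring
    have e2 := real_inner_le_norm (p.gradX i xb ys - p.gradX i x y) (xb' - xb)
    set u := ‖p.gradX i xb ys - p.gradX i x y‖
    set w := ‖xb' - xb‖
    have e3 : u * w ≤ 2 * (p.L * p.κ) * w ^ 2 + 1 / (8 * (p.L * p.κ)) * u ^ 2 := by
      have : 2 * (p.L * p.κ) * w ^ 2 + 1 / (8 * (p.L * p.κ)) * u ^ 2 - u * w =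
        (4 * (p.L * p.κ) * w - u) ^ 2 / (8 * (p.L * p.κ)) := by field_simp; ring
      have h0 : 0 ≤ (4 * (p.L * p.κ) * w - u) ^ 2 / (8 * (p.L * p.κ)) := by positivity
      linarith
    have e4 : 1 / (8 * (p.L * p.κ)) * u ^ 2 ≤
        1 / (8 * (p.L * p.κ)) * (p.L ^ 2 * (‖xb - x‖ ^ 2 + ‖ys - y‖ ^ 2)) := by gcongr
    have e5 : 1 / (8 * (p.L * p.κ)) * (p.L ^ 2 * (‖xb - x‖ ^ 2 + ‖ys - y‖ ^ 2)) =
      p.L / (8 * p.κ) * (‖xb - x‖ ^ 2 + ‖ys - y‖ ^ 2) := by field_simp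
    linarith
  have h7 : -(p.L * √m / 2 * inner ℝ (lt' - lt) ys) ≤ -(p.L * √m / 2 * inner ℝ (lt' - lt) y)
      + p.L * p.κ * m / 4 * ‖lt' - lt‖ ^ 2 + p.L / (4 * p.κ) * ‖ys - y‖ ^ 2 := by
    have e1 : inner ℝ (lt' - lt) ys = inner ℝ (lt' - lt) y + inner ℝ (lt' - lt) (ys - y) := by
      rw [inner_sub_right]; ring
    have e2 := real_inner_le_norm (-(lt' - lt)) (ys - y)
    rw [inner_neg_left, norm_neg] at e2
    have e3 : p.L * √m / 2 * (-inner ℝ (lt' - lt) (ys - y)) ≤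
      p.L * √m / 2 * (‖lt' - lt‖ * ‖ys - y‖) := by gcongr
    have hm : √(m : ℝ) ^ 2 = m := Real.sq_sqrt (by positivity)
    have e4 : p.L * p.κ * √m ^ 2 / 4 * ‖lt' - lt‖ ^ 2 + p.L / (4 * p.κ) * ‖ys - y‖ ^ 2 -
        p.L * √m / 2 * (‖lt' - lt‖ * ‖ys - y‖) =
        p.L / (4 * p.κ) * (p.κ * √m * ‖lt' - lt‖ - ‖ys - y‖) ^ 2 := by field_simp; ring
    have e5 : 0 ≤ p.L / (4 * p.κ) * (p.κ * √m * ‖lt' - lt‖ - ‖ys - y‖) ^ 2 := by positivity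
    rw [hm] at e4
    rw [e1]
    linarith
  -- The Young weights in `h6` and `h7` leave 3L/(8κ) in front of ‖ys − y‖², so the factor 3κ² of
  -- the stability estimate costs only one power of κ.
  have h8 : (p.L / (8 * p.κ) + p.L / (4 * p.κ)) * ‖ys - y‖ ^ 2 ≤ 9 / 8 * (p.L * p.κ) *
        (δ ^ 2 / p.L ^ 2 + ‖xb' - x‖ ^ 2 + m / 4 * ‖lt' - lt‖ ^ 2) := by
    calc (p.L / (8 * p.κ) + p.L / (4 * p.κ)) * ‖ys - y‖ ^ 2
        ≤ (p.L / (8 * p.κ) + p.L / (4 * p.κ)) * (3 * p.κ ^ 2 *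
          (δ ^ 2 / p.L ^ 2 + ‖xb' - x‖ ^ 2 + m / 4 * ‖lt' - lt‖ ^ 2)) := by gcongr
      _ = _ := by field_simp; ring
  have h9 : p.L / (8 * p.κ) * ‖xb - x‖ ^ 2 ≤ p.L * p.κ / 8 * ‖xb - x‖ ^ 2 := by
    gcongr ?_ * _
    rw [div_le_div_iff₀ (by positivity) (by norm_num)]
    have : p.L ≤ p.L * p.κ := le_mul_of_one_le_right hL.le hκ
    nlinarith
  have h10 : p.L / 2 * ‖xb' - xb‖ ^ 2 ≤ p.L * p.κ / 2 * ‖xb' - xb‖ ^ 2 := by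
    have : p.L ≤ p.L * p.κ := le_mul_of_one_le_right hL.le hκ
    gcongr
  rw [h3]
  simp only [psi] at *
  rw [inner_sub_left lt' lt ys] at h7
  linarith

/-- Change of `P` in one iteration. -/
lemma ObjAssumption.Pval_step_le (hobj : p.ObjAssumption) (hmix : p.MixAssumption)
    {x : Fin m → E n₁} {y lam lam' : Fin m → E n₂} {xb' : E n₁} {δ ηl : ℝ} (hηl : 0 < ηl)
    (hx : ∀ i, x i ∈ dom p.g) (hxb' : xb' ∈ dom p.g)
    (hy : ∀ i, p.IsApproxMax i (x i) (lamTilde p.W lam i) δ (y i))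
    (hlam : ∀ i, lam' i = lam i + (p.L * ηl / (2 * √m)) • (∑ j, p.W i j • y j - y i)) :
    p.Pval xb' lam' ≤ p.Pval (mean x) lam +
      inner ℝ (mean fun i => p.gradX i (x i) (y i)) (xb' - mean x)
      - 1 / ηl * ∑ i, ‖lam' i - lam i‖ ^ 2 + 29 / 8 * (p.L * p.κ) * ‖xb' - mean x‖ ^ 2
      + 5 / 4 * (p.L * p.κ / m) * perpSq x + 17 / 8 * (p.L * p.κ) * ∑ i, ‖lam' i - lam i‖ ^ 2
      + 9 / 8 * (p.κ * δ ^ 2 / p.L) := by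
  have hm := hmix.card_pos
  have hm0 : (0 : ℝ) < m := by exact_mod_cast hm
  have hL := hobj.L_pos
  have hκ0 : 0 < p.κ := by linarith [hobj.one_le_κ]
  have hxb := (hobj.g_closed.mean_mem hm hx).1
  have hsum := Finset.sum_le_sum fun i (_ : i ∈ Finset.univ) =>
    hobj.dmax_sub_le (hx i) hxb hxb' (lt' := lamTilde p.W lam' i) (hy i)
  have hsq : 0 < √(m : ℝ) := Real.sqrt_pos.mpr hm0
  -- By the dual update, (W − I)Y is proportional to ΔΛ. The linear term thus becomes a negative
  -- multiple of ‖ΔΛ‖²: the dual step is a descent step for P.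
  have hlin : ∑ i, inner ℝ (lamTilde p.W lam' i - lamTilde p.W lam i) (y i) =
      2 * √m / (p.L * ηl) * ∑ i, ‖lam' i - lam i‖ ^ 2 := by
    simp only [lamTilde_sub]
    rw [sum_inner_lamTilde, Finset.mul_sum]
    refine Finset.sum_congr rfl fun i _ => ?_
    have e : ∑ j, p.W i j • y j - y i = (2 * √m / (p.L * ηl)) • (lam' i - lam i) := by
      rw [hlam i, add_sub_cancel_left, smul_smul]
      rw [show 2 * √m / (p.L * ηl) * (p.L * ηl / (2 * √m)) = 1 by field_simp, one_smul]
    rw [e, inner_smul_right, real_inner_self_eq_norm_sq]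
  have hQ := hmix.sum_norm_lamTilde_sq_le (fun i => lam' i - lam i)
  simp only [← lamTilde_sub] at hQ
  set Q := ∑ i, ‖lam' i - lam i‖ ^ 2
  have hX1 := sum_norm_sub_sq hm x (mean x)
  rw [sub_self, norm_zero] at hX1
  have hX2 := sum_norm_sub_sq hm x xb'
  simp only [Finset.sum_add_distrib, Finset.sum_sub_distrib, ← Finset.mul_sum, hlin, hX1, hX2,
    ← sum_inner, Finset.sum_const, Finset.card_univ, Fintype.card_fin, nsmul_eq_mul] at hsum
  rw [← card_smul_mean hm (fun i => p.gradX i (x i) (y i)), inner_smul_left, conj_trivial] at hsum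
  set R := ∑ i, ‖lamTilde p.W lam' i - lamTilde p.W lam i‖ ^ 2
  set I := inner ℝ (mean fun i => p.gradX i (x i) (y i)) (xb' - mean x)
  set N := ‖xb' - mean x‖ ^ 2
  have hX := perpSq_nonneg x
  have hr1 : p.L * p.κ * m / 4 * R ≤ p.L * p.κ * m / 4 * (4 * Q) := by gcongr
  have hr2 : 9 / 8 * (p.L * p.κ) * (m / 4 * R) ≤ 9 / 8 * (p.L * p.κ) * (m / 4 * (4 * Q)) := by
    gcongr
  have hs : p.L * √m / 2 * (2 * √m / (p.L * ηl) * Q) = m * (1 / ηl * Q) := by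
    have : √(m : ℝ) * √m = m := Real.mul_self_sqrt hm0.le
    calc p.L * √m / 2 * (2 * √m / (p.L * ηl) * Q) = (√m * √m) * (1 / ηl * Q) := by field_simp
      _ = _ := by rw [this]
  rw [hs] at hsum
  have hδ : 9 / 8 * (p.L * p.κ) * (m * (δ ^ 2 / p.L ^ 2)) = m * (9 / 8 * (p.κ * δ ^ 2 / p.L)) := by
    field_simp
  have htot : ∑ i, p.dmax i xb' (lamTilde p.W lam' i) ≤
      ∑ i, p.dmax i (mean x) (lamTilde p.W lam i) + m * (I - 1 / ηl * Q
        + 29 / 8 * (p.L * p.κ) * N + 5 / 4 * (p.L * p.κ / m) * perpSq x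
        + 17 / 8 * (p.L * p.κ) * Q + 9 / 8 * (p.κ * δ ^ 2 / p.L)) := by
    have e : m * (5 / 4 * (p.L * p.κ / m) * perpSq x) = 5 / 4 * (p.L * p.κ) * perpSq x := by
      field_simp
    linarith
  rw [Pval, Pval]
  calc 1 / (m : ℝ) * ∑ i, p.dmax i xb' (lamTilde p.W lam' i)
      ≤ 1 / (m : ℝ) * (∑ i, p.dmax i (mean x) (lamTilde p.W lam i) + m * (I - 1 / ηl * Q
        + 29 / 8 * (p.L * p.κ) * N + 5 / 4 * (p.L * p.κ / m) * perpSq x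
        + 17 / 8 * (p.L * p.κ) * Q + 9 / 8 * (p.κ * δ ^ 2 / p.L))) := by gcongr
    _ = _ := by rw [mul_add, ← mul_assoc, one_div_mul_cancel hm0.ne']; ring

/-- Change of the partial gradients in one iteration. -/
lemma ObjAssumption.sum_gradX_sub_sq_le (hobj : p.ObjAssumption) (hmix : p.MixAssumption)
    {x x' : Fin m → E n₁} {y y' lam lam' : Fin m → E n₂} {δ δ' : ℝ}
    (hx : ∀ i, x i ∈ dom p.g) (hx' : ∀ i, x' i ∈ dom p.g)
    (hy : ∀ i, p.IsApproxMax i (x i) (lamTilde p.W lam i) δ (y i))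
    (hy' : ∀ i, p.IsApproxMax i (x' i) (lamTilde p.W lam' i) δ' (y' i)) :
    ∑ i, ‖p.gradX i (x' i) (y' i) - p.gradX i (x i) (y i)‖ ^ 2 ≤
      p.L ^ 2 * (1 + 3 * p.κ ^ 2) * ∑ i, ‖x' i - x i‖ ^ 2
      + 3 * p.κ ^ 2 * p.L ^ 2 * (m * ∑ i, ‖lam' i - lam i‖ ^ 2)
      + 3 * p.κ ^ 2 * (m * (δ' + δ) ^ 2) := by
  have hL := hobj.L_pos
  have hQ := hmix.sum_norm_lamTilde_sq_le (fun i => lam' i - lam i)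
  simp only [← lamTilde_sub] at hQ
  have hterm : ∀ i, ‖p.gradX i (x' i) (y' i) - p.gradX i (x i) (y i)‖ ^ 2 ≤
      p.L ^ 2 * (1 + 3 * p.κ ^ 2) * ‖x' i - x i‖ ^ 2 + 3 * p.κ ^ 2 * p.L ^ 2 *
        (m / 4 * ‖lamTilde p.W lam' i - lamTilde p.W lam i‖ ^ 2) +
        3 * p.κ ^ 2 * (δ' + δ) ^ 2 := by
    intro i
    have h1 := hobj.gradX_lipschitz i (hx' i) (hx i) (hy' i).mem_dom (hy i).mem_dom
    have h2 := mul_le_mul_of_nonneg_left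
      ((hy' i).norm_sub_sq_le hobj (hx' i) (hx i) (hy i)) (sq_nonneg p.L)
    have e : p.L ^ 2 * (3 * p.κ ^ 2 * ((δ' + δ) ^ 2 / p.L ^ 2)) = 3 * p.κ ^ 2 * (δ' + δ) ^ 2 := by
      field_simp
    linarith
  refine (Finset.sum_le_sum fun i _ => hterm i).trans ?_
  simp only [Finset.sum_add_distrib, ← Finset.mul_sum, Finset.sum_const, Finset.card_univ,
    Fintype.card_fin, nsmul_eq_mul]
  have h3 : 3 * p.κ ^ 2 * p.L ^ 2 *
      (m / 4 * ∑ i, ‖lamTilde p.W lam' i - lamTilde p.W lam i‖ ^ 2) ≤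
      3 * p.κ ^ 2 * p.L ^ 2 * (m / 4 * (4 * ∑ i, ‖lam' i - lam i‖ ^ 2)) := by gcongr
  linarith

/-! ### The parameters -/

lemma MixAssumption.one_sub_rho_pos (hmix : p.MixAssumption) : 0 < 1 - p.ρ := by
  linarith [hmix.rho_lt_one]

lemma one_sub_rho_le_one : 1 - p.ρ ≤ 1 := by linarith [rho_nonneg (p := p)]

lemma ηx_pos (hobj : p.ObjAssumption) (hmix : p.MixAssumption) : 0 < p.ηx := by
  have := hmix.one_sub_rho_pos
  have := hobj.L_pos
  unfold ηx
  positivity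

lemma ηlam_pos (hobj : p.ObjAssumption) (hmix : p.MixAssumption) : 0 < p.ηlam := by
  have := hmix.one_sub_rho_pos
  have := hobj.L_pos
  have := hobj.one_le_κ
  unfold ηlam
  positivity

lemma δ_pos (hobj : p.ObjAssumption) (hmix : p.MixAssumption) (t : ℕ) : 0 < p.δ t := by
  have := hmix.one_sub_rho_pos
  have := hobj.one_le_κ
  unfold δ
  positivity

lemma ηx_mul_le (hobj : p.ObjAssumption) :
    12 * (p.L * p.κ) * p.ηx ≤ (1 - p.ρ) ^ 2 := by
  have hL := hobj.L_pos
  have hκ := hobj.one_le_κ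
  -- The square of 12/5 is 144/25, just below 6.
  have h : 12 / 5 * p.κ ≤ √(1 + 6 * p.κ ^ 2) := by
    apply Real.le_sqrt_of_sq_le
    nlinarith
  have hs : 0 < √(1 + 6 * p.κ ^ 2) := by positivity
  rw [ηx, mul_div_assoc', div_le_iff₀ (by positivity)]
  have : 12 * (p.L * p.κ) ≤ 5 * p.L * √(1 + 6 * p.κ ^ 2) := by
    nlinarith
  have := mul_le_mul_of_nonneg_right this (sq_nonneg (1 - p.ρ))
  linarith

lemma ηx_sq_mul_le (hobj : p.ObjAssumption) :
    25 * (p.L ^ 2 * (1 + 3 * p.κ ^ 2)) * p.ηx ^ 2 ≤ (1 - p.ρ) ^ 4 := by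
  have hL := hobj.L_pos
  have hs : √(1 + 6 * p.κ ^ 2) ^ 2 = 1 + 6 * p.κ ^ 2 := Real.sq_sqrt (by positivity)
  have e : p.ηx ^ 2 = (1 - p.ρ) ^ 4 / (25 * p.L ^ 2 * (1 + 6 * p.κ ^ 2)) := by
    rw [ηx, div_pow, mul_pow, mul_pow, hs]; ring
  rw [e, mul_div_assoc', div_le_iff₀ (by positivity)]
  have : 25 * (p.L ^ 2 * (1 + 3 * p.κ ^ 2)) ≤ 25 * p.L ^ 2 * (1 + 6 * p.κ ^ 2) := by
    have : 0 ≤ p.L ^ 2 * p.κ ^ 2 := by positivity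
    nlinarith
  have := mul_le_mul_of_nonneg_right this (show 0 ≤ (1 - p.ρ) ^ 4 by positivity)
  linarith

lemma ηlam_mul_le (hobj : p.ObjAssumption) :
    9 * (p.L * p.κ) * p.ηlam ≤ (1 - p.ρ) ^ 2 := by
  have hL := hobj.L_pos
  have hκ := hobj.one_le_κ
  rw [ηlam, mul_div_assoc', div_le_iff₀ (by positivity)]
  have : 9 * (p.L * p.κ) ≤ p.L * (9 * p.κ + 2) := by nlinarith
  have := mul_le_mul_of_nonneg_right this (sq_nonneg (1 - p.ρ))
  linarith

lemma δ_succ_le (hobj : p.ObjAssumption) (t : ℕ) : p.δ (t + 1) ≤ p.δ t := by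
  have hκ := hobj.one_le_κ
  unfold δ
  gcongr
  simp

/-- The inexactness error of one iteration is of order 1/(1+t)² and is dominated by a telescoping
difference, because 2 + t ≤ 2(1 + t). The constant is 2·(17/8)/64 = 34/512 ≤ 1/15. -/
lemma δ_sq_le (hobj : p.ObjAssumption) (hmix : p.MixAssumption) (t : ℕ) :
    17 / 8 * (p.κ * p.δ t ^ 2 / (p.L * (1 - p.ρ))) ≤
      1 / (15 * (p.L * p.κ)) * (1 / (1 + (t : ℝ)) - 1 / (1 + ((t + 1 : ℕ) : ℝ))) := by
  have hL := hobj.L_pos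
  have hκ := hobj.one_le_κ
  have hκ0 : 0 < p.κ := by linarith
  have hσ := hmix.one_sub_rho_pos
  have hσ1 := one_sub_rho_le_one (p := p)
  have ht : (0 : ℝ) < 1 + t := by positivity
  have e1 : p.κ * p.δ t ^ 2 / (p.L * (1 - p.ρ)) =
      (1 - p.ρ) ^ 3 / (64 * (p.L * p.κ) * (1 + t) ^ 2) := by
    rw [δ]; field_simp; ring
  have h1 : (1 - p.ρ) ^ 3 ≤ 1 := pow_le_one₀ hσ.le hσ1
  have e2 : 1 / (1 + (t : ℝ)) - 1 / (1 + ((t + 1 : ℕ) : ℝ)) = 1 / ((1 + t) * (2 + t)) := by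
    push_cast; field_simp; ring
  rw [e1, e2]
  calc 17 / 8 * ((1 - p.ρ) ^ 3 / (64 * (p.L * p.κ) * (1 + t) ^ 2))
      ≤ 17 / 8 * (1 / (64 * (p.L * p.κ) * (1 + t) ^ 2)) := by gcongr
    _ = 17 / (512 * (p.L * p.κ)) * (1 / (1 + t) ^ 2) := by field_simp; norm_num
    _ ≤ 17 / (512 * (p.L * p.κ)) * (2 * (1 / ((1 + t) * (2 + t)))) := by
      gcongr
      rw [mul_one_div, div_le_div_iff₀ (by positivity) (by positivity)]
      nlinarith
    _ = 34 / 512 / (p.L * p.κ) * (1 / ((1 + t) * (2 + t))) := by ring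
    _ ≤ 1 / 15 / (p.L * p.κ) * (1 / ((1 + t) * (2 + t))) := by
      gcongr ?_ / _ * _; norm_num
    _ = _ := by ring

/-! ### The merit function -/

/-- Combination of the one-step estimates. -/
lemma merit_combine {μ σ η ηl L κ δ N X X' Q V V' S Z P P' g g' I : ℝ} (hm : 0 < μ) (hσ : 0 < σ)
    (hσ1 : σ ≤ 1) (hη : 0 < η) (hηl : 0 < ηl) (hL : 0 < L) (hκ : 0 < κ) (hN : 0 ≤ N)
    (hX : 0 ≤ X) (hX' : 0 ≤ X') (hQ : 0 ≤ Q)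
    (h1 : 12 * (L * κ) * η ≤ σ ^ 2) (h2 : 25 * (L ^ 2 * (1 + 3 * κ ^ 2)) * η ^ 2 ≤ σ ^ 4)
    (h3 : 9 * (L * κ) * ηl ≤ σ ^ 2)
    (hP : P' ≤ P + I - 1 / ηl * Q + 29 / 8 * (L * κ) * N + 5 / 4 * (L * κ / μ) * X
      + 17 / 8 * (L * κ) * Q + 9 / 8 * (κ * δ ^ 2 / L))
    (hg : g' ≤ g - I - 1 / η * N - 1 / (2 * μ * η) * (X' - X) - σ / (2 * μ * η) * X
      - σ / (4 * μ * η) * X' + η / (μ * σ) * V)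
    (hV : V' ≤ (1 - σ) * V + S / σ)
    (hS : S ≤ L ^ 2 * (1 + 3 * κ ^ 2) * Z + 3 * κ ^ 2 * L ^ 2 * (μ * Q)
      + 3 * κ ^ 2 * (μ * (4 * δ ^ 2)))
    (hZ : Z ≤ μ * N + 2 * X + 2 * X') :
    P' + g' + 1 / (2 * μ * η) * X' + η / (μ * σ ^ 2) * V' + 1 / (2 * η) * N + 1 / (2 * ηl) * Q ≤
      P + g + 1 / (2 * μ * η) * X + η / (μ * σ ^ 2) * V + 17 / 8 * (κ * δ ^ 2 / (L * σ)) := by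
  -- In the application μ is the number of agents and σ = 1 − ρ; N and Q are the squared
  -- displacements of the average and of Λ, X and V the consensus errors, S the squared change of
  -- the gradients and Z that of all the x_i.
  have hσ2 : σ ^ 2 ≤ σ := by nlinarith
  have a1 : L * κ ≤ 1 / 12 * (σ / η) := by
    rw [mul_div_assoc', le_div_iff₀ hη]; linarith
  have a1' : 1 / 12 * (σ / η) ≤ 1 / 12 * (1 / η) := by gcongr
  have a3 : L * κ / σ ≤ 1 / 9 * (1 / ηl) := by
    rw [mul_one_div, div_le_div_iff₀ hσ hηl]; linarith
  have a3' : L * κ ≤ L * κ / σ := by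
    rw [le_div_iff₀ hσ]
    exact mul_le_of_le_one_right (by positivity) hσ1
  -- The weight of V in the merit is chosen so that the contraction of tracking releases exactly the
  -- term ηV/(μσ) lost in the g-estimate.
  have hVm : η / (μ * σ ^ 2) * V' ≤ η / (μ * σ ^ 2) * V - η / (μ * σ) * V
      + η / (μ * σ ^ 3) * S := by
    calc η / (μ * σ ^ 2) * V' ≤ η / (μ * σ ^ 2) * ((1 - σ) * V + S / σ) := by gcongr
      _ = _ := by field_simp
  have hSm : η / (μ * σ ^ 3) * S ≤ σ / (25 * μ * η) * (μ * N + 2 * X + 2 * X')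
      + 1 / 4 * (L * κ / σ) * Q + κ * δ ^ 2 / (L * σ) := by
    have b1 : η / (μ * σ ^ 3) * (L ^ 2 * (1 + 3 * κ ^ 2)) ≤ σ / (25 * μ * η) := by
      rw [div_mul_eq_mul_div, div_le_div_iff₀ (by positivity) (by positivity)]
      have := mul_le_mul_of_nonneg_left h2 hm.le
      linarith
    have b2 : η / (μ * σ ^ 3) * (3 * κ ^ 2 * L ^ 2 * (μ * Q)) ≤ 1 / 4 * (L * κ / σ) * Q := by
      have e : η / (μ * σ ^ 3) * (3 * κ ^ 2 * L ^ 2 * (μ * Q)) =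
        (12 * (L * κ) * η) * (1 / 4 * (L * κ) / σ ^ 3 * Q) := by field_simp; ring
      rw [e]
      calc (12 * (L * κ) * η) * (1 / 4 * (L * κ) / σ ^ 3 * Q)
          ≤ σ ^ 2 * (1 / 4 * (L * κ) / σ ^ 3 * Q) := by gcongr
        _ = _ := by field_simp
    have b3 : η / (μ * σ ^ 3) * (3 * κ ^ 2 * (μ * (4 * δ ^ 2))) ≤ κ * δ ^ 2 / (L * σ) := by
      have e : η / (μ * σ ^ 3) * (3 * κ ^ 2 * (μ * (4 * δ ^ 2))) =
        (12 * (L * κ) * η) * (κ * δ ^ 2 / (L * σ ^ 3)) := by field_simp; ring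
      rw [e]
      calc (12 * (L * κ) * η) * (κ * δ ^ 2 / (L * σ ^ 3))
          ≤ σ ^ 2 * (κ * δ ^ 2 / (L * σ ^ 3)) := by gcongr
        _ = _ := by field_simp
    calc η / (μ * σ ^ 3) * S ≤ η / (μ * σ ^ 3) * (L ^ 2 * (1 + 3 * κ ^ 2) *
          (μ * N + 2 * X + 2 * X') + 3 * κ ^ 2 * L ^ 2 * (μ * Q)
          + 3 * κ ^ 2 * (μ * (4 * δ ^ 2))) := by
          gcongr
          refine hS.trans ?_
          gcongr
      _ = η / (μ * σ ^ 3) * (L ^ 2 * (1 + 3 * κ ^ 2)) * (μ * N + 2 * X + 2 * X')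
          + η / (μ * σ ^ 3) * (3 * κ ^ 2 * L ^ 2 * (μ * Q))
          + η / (μ * σ ^ 3) * (3 * κ ^ 2 * (μ * (4 * δ ^ 2))) := by ring
      _ ≤ _ := by gcongr
  have cN : σ / (25 * μ * η) * (μ * N) ≤ 1 / 25 * (1 / η) * N := by
    have e : σ / (25 * μ * η) * (μ * N) = σ * (1 / 25 * (1 / η) * N) := by field_simp
    rw [e]
    exact mul_le_of_le_one_left (by positivity) hσ1
  have cN2 : 29 / 8 * (L * κ) * N ≤ 29 / 8 * (1 / 12 * (1 / η)) * N :=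
    mul_le_mul_of_nonneg_right (mul_le_mul_of_nonneg_left (a1.trans a1') (by norm_num)) hN
  have cX : 5 / 4 * (L * κ / μ) * X ≤ 5 / 4 * (1 / 12 * (σ / (μ * η))) * X := by
    have e : 1 / 12 * (σ / (μ * η)) = 1 / 12 * (σ / η) / μ := by field_simp
    rw [e]; gcongr
  have cQ : 17 / 8 * (L * κ) * Q ≤ 17 / 8 * (1 / 9 * (1 / ηl)) * Q :=
    mul_le_mul_of_nonneg_right (mul_le_mul_of_nonneg_left (a3'.trans a3) (by norm_num)) hQ
  have cQ2 : 1 / 4 * (L * κ / σ) * Q ≤ 1 / 4 * (1 / 9 * (1 / ηl)) * Q := by gcongr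
  have cδ : κ * δ ^ 2 / L ≤ κ * δ ^ 2 / (L * σ) := by
    gcongr
    exact mul_le_of_le_one_right hL.le hσ1
  have e1 : 1 / (2 * η) = 1 / 2 * (1 / η) := by field_simp
  have e2 : 1 / (2 * ηl) = 1 / 2 * (1 / ηl) := by field_simp
  have e3 : σ / (2 * μ * η) = 1 / 2 * (σ / (μ * η)) := by field_simp
  have e4 : σ / (4 * μ * η) = 1 / 4 * (σ / (μ * η)) := by field_simp
  have e5 : σ / (25 * μ * η) = 1 / 25 * (σ / (μ * η)) := by field_simp
  rw [e3, e4] at hg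
  rw [e5] at cN hSm
  rw [e1, e2]
  have p1 : 0 ≤ 1 / η * N := by positivity
  have p2 : 0 ≤ 1 / ηl * Q := by positivity
  have p3 : 0 ≤ σ / (μ * η) * X := by positivity
  have p4 : 0 ≤ σ / (μ * η) * X' := by positivity
  -- In units of 1/η and 1/ηl, the terms in N use 29/96 + 1/25 + 1/2 < 1 and those in Q use 17/72 +
  -- 1/36 + 1/2 < 1. In units of σ/(μη), X uses 5/48 + 2/25 < 1/2 and X' uses 2/25 < 1/4. The errors
  -- add to 9/8 + 1 = 17/8.
  linarith

/-- The merit function of a state. -/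
def merit (p : Problem m n₁ n₂) (s : State m n₁ n₂) : ℝ :=
  p.Pval (mean s.x) s.lam + (p.g (mean s.x)).toReal + 1 / (2 * m * p.ηx) * perpSq s.x
    + p.ηx / (m * (1 - p.ρ) ^ 2) * perpSq s.v

/-- The invariants of the method after `t` iterations. -/
structure Invariant (p : Problem m n₁ n₂) (t : ℕ) (s : State m n₁ n₂) : Prop where
  x_mem : ∀ i, s.x i ∈ dom p.g
  y_approx : ∀ i, p.IsApproxMax i (s.x i) (lamTilde p.W s.lam i) (p.δ t) (s.y i)
  v_mean : mean s.v = mean fun i => p.gradX i (s.x i) (s.y i)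

variable {form : APGForm}

lemma lamTilde_zero (W : Matrix (Fin m) (Fin m) ℝ) (i : Fin m) :
    lamTilde W (fun _ => (0 : E n)) i = 0 := by
  simp [lamTilde]

lemma invariant_init (hobj : p.ObjAssumption) (hmix : p.MixAssumption)
    (hform : form = APGForm.extrapolated → p.ExtrapolationRegular) {x0 : E n₁}
    (hx0 : x0 ∈ dom p.g) {yinit : Fin m → E n₂} (hyinit : ∀ i, yinit i ∈ dom p.h) :
    p.Invariant 0 (p.init form p.δ x0 yinit) where
  x_mem _ := hx0
  y_approx i := by
    have h := hobj.isApproxMax_solveY hform i hx0 0 (hyinit i) (δ_pos hobj hmix 0)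
    have e : lamTilde p.W (p.init form p.δ x0 yinit).lam i = 0 := lamTilde_zero _ _
    rw [e]
    exact h
  v_mean := rfl

/-- Mixing preserves averages, so the average of V changes exactly by the change of the averaged
gradients. Accuracy of y needs only a warm start in `dom h`. -/
lemma Invariant.step (hobj : p.ObjAssumption) (hmix : p.MixAssumption)
    (hform : form = APGForm.extrapolated → p.ExtrapolationRegular) {t : ℕ} {s : State m n₁ n₂}
    (hs : p.Invariant t s) : p.Invariant (t + 1) (p.step form p.ηx p.ηlam p.δ t s) where
  x_mem i := (isSubgrad_prox hobj.g_closed (ηx_pos hobj hmix) _).1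
  y_approx i := hobj.isApproxMax_solveY hform i
    (isSubgrad_prox hobj.g_closed (ηx_pos hobj hmix) _).1 _ (hs.y_approx i).mem_dom
    (δ_pos hobj hmix (t + 1))
  v_mean := by
    have e : (p.step form p.ηx p.ηlam p.δ t s).v = fun i =>
      (∑ j, p.W i j • s.v j + p.gradX i ((p.step form p.ηx p.ηlam p.δ t s).x i)
        ((p.step form p.ηx p.ηlam p.δ t s).y i)) - p.gradX i (s.x i) (s.y i) := rfl
    rw [e, mean_sub, mean_add, hmix.mean_mix, hs.v_mean, add_sub_cancel_left]

lemma Invariant.merit_step_le (hobj : p.ObjAssumption) (hmix : p.MixAssumption)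
    (hform : form = APGForm.extrapolated → p.ExtrapolationRegular) {t : ℕ} {s s' : State m n₁ n₂}
    (hs : p.Invariant t s) (hs' : s' = p.step form p.ηx p.ηlam p.δ t s) :
    p.merit s' + 1 / (2 * p.ηx) * ‖mean s'.x - mean s.x‖ ^ 2
        + 1 / (2 * p.ηlam) * ∑ i, ‖s'.lam i - s.lam i‖ ^ 2 ≤
      p.merit s + 1 / (15 * (p.L * p.κ)) * (1 / (1 + (t : ℝ)) - 1 / (1 + ((t + 1 : ℕ) : ℝ))) := by
  have hinv : p.Invariant (t + 1) s' := hs' ▸ hs.step hobj hmix hform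
  have hm := hmix.card_pos
  have hm0 : (0 : ℝ) < m := by exact_mod_cast hm
  have hη := ηx_pos hobj hmix
  have hηl := ηlam_pos hobj hmix
  have hx := (hobj.g_closed.mean_mem hm hs.x_mem).1
  have hx' := (hobj.g_closed.mean_mem hm hinv.x_mem).1
  have hP := hobj.Pval_step_le hmix hηl hs.x_mem hx' hs.y_approx (lam' := s'.lam)
    (fun i => by rw [hs']; rfl)
  have hg := g_mean_step_le hobj.g_closed hmix hη hx (x' := s'.x) (v := s.v)
    (fun i => by rw [hs']; rfl)
  rw [hs.v_mean] at hg
  have hV := perpSq_mix_add_le hmix s.v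
    (fun i => p.gradX i (s'.x i) (s'.y i) - p.gradX i (s.x i) (s.y i))
  have hv : (fun i => ∑ j, p.W i j • s.v j +
      (p.gradX i (s'.x i) (s'.y i) - p.gradX i (s.x i) (s.y i))) = s'.v := by
    funext i
    rw [← add_sub_assoc, hs']
    rfl
  rw [hv] at hV
  have hS := hobj.sum_gradX_sub_sq_le hmix hs.x_mem hinv.x_mem hs.y_approx hinv.y_approx
  have hZ := sum_norm_sub_sq_le hm s'.x s.x
  have hδ : (p.δ (t + 1) + p.δ t) ^ 2 ≤ 4 * p.δ t ^ 2 := by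
    have h1 := δ_pos hobj hmix (t + 1)
    have h2 := δ_succ_le hobj t
    nlinarith
  have key := merit_combine hm0 hmix.one_sub_rho_pos one_sub_rho_le_one hη hηl hobj.L_pos
    (show 0 < p.κ by linarith [hobj.one_le_κ]) (sq_nonneg _) (perpSq_nonneg s.x)
    (perpSq_nonneg s'.x) (Finset.sum_nonneg fun _ _ => sq_nonneg _) (ηx_mul_le hobj)
    (ηx_sq_mul_le hobj) (ηlam_mul_le hobj) hP hg
    (V' := perpSq s'.v) (by rw [sub_sub_cancel]; exact hV)
    (hS.trans (by gcongr)) (hZ.trans (by linarith))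
  have hδ2 := δ_sq_le hobj hmix t
  simp only [merit]
  linarith

/-! ### The primal and dual functions as extended reals -/

lemma sum_h_eq (hobj : p.ObjAssumption) {Y : Fin m → E n₂} (hY : ∀ i, Y i ∈ dom p.h)
    (s : Finset (Fin m)) : ∑ i ∈ s, p.h (Y i) = ((∑ i ∈ s, (p.h (Y i)).toReal : ℝ) : EReal) := by
  classical
  induction s using Finset.induction_on with
  | empty => simp
  | insert a s ha ih =>
    rw [Finset.sum_insert ha, Finset.sum_insert ha, ih, EReal.coe_add,
      hobj.h_closed.coe_toReal (hY a)]

lemma sum_h_ne_bot (hobj : p.ObjAssumption) (Y : Fin m → E n₂) (s : Finset (Fin m)) :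
    ∑ i ∈ s, p.h (Y i) ≠ ⊥ := by
  classical
  induction s using Finset.induction_on with
  | empty => simp
  | insert a s ha ih =>
    rw [Finset.sum_insert ha]
    exact EReal.add_ne_bot_iff.mpr ⟨hobj.h_closed.ne_bot _, ih⟩

lemma sum_h_eq_top (hobj : p.ObjAssumption) {Y : Fin m → E n₂} {i₀ : Fin m}
    (hi₀ : Y i₀ ∉ dom p.h) : ∑ i, p.h (Y i) = ⊤ := by
  have h : p.h (Y i₀) = ⊤ := by simpa [dom] using hi₀
  rw [← Finset.add_sum_erase _ _ (Finset.mem_univ i₀), h]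
  exact EReal.top_add_of_ne_bot (sum_h_ne_bot hobj Y _)

/-- Φ separates over the agents, as L/(2√m) = (1/m)(L√m/2). Its maximum over Y is therefore the
average of the local maxima. -/
lemma Phi_eq (hobj : p.ObjAssumption) (hm : 0 < m) (x : E n₁) (Lam : Fin m → E n₂)
    {Y : Fin m → E n₂} (hY : ∀ i, Y i ∈ dom p.h) :
    p.Phi (fun _ => x) Lam Y = ((1 / (m : ℝ) *
      ∑ i, -(p.psi i x (lamTilde p.W Lam i) (Y i) + (p.h (Y i)).toReal) : ℝ) : EReal) := by
  have hm0 : (0 : ℝ) < m := by exact_mod_cast hm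
  have hs : 0 < √(m : ℝ) := Real.sqrt_pos.mpr hm0
  rw [Phi, sum_h_eq hobj hY, ← EReal.coe_mul, ← EReal.coe_sub]
  congr 1
  simp only [psi, Finset.sum_neg_distrib, Finset.sum_add_distrib, Finset.sum_sub_distrib,
    ← Finset.mul_sum, sum_inner_lamTilde]
  have e : p.L / (2 * √m) = 1 / (m : ℝ) * (p.L * √m / 2) := by
    rw [div_eq_iff (by positivity)]
    field_simp
    rw [Real.sq_sqrt hm0.le]
  rw [e]
  ring

lemma P_eq (hobj : p.ObjAssumption) (hm : 0 < m) {x : E n₁} (hx : x ∈ dom p.g)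
    (Lam : Fin m → E n₂) : p.P x Lam = (p.Pval x Lam : EReal) := by
  have hμ := hobj.mu_pos
  apply le_antisymm
  · refine iSup_le fun Y => ?_
    by_cases hY : ∀ i, Y i ∈ dom p.h
    · rw [Phi_eq hobj hm x Lam hY, EReal.coe_le_coe_iff, Pval]
      gcongr with i
      have h1 := hobj.le_dmax i hx (lamTilde p.W Lam i) (hY i)
      have h2 : 0 ≤ p.μ / 2 * ‖Y i - p.yhat i x (lamTilde p.W Lam i)‖ ^ 2 := by positivity
      linarith
    · push Not at hY
      obtain ⟨i₀, hi₀⟩ := hY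
      have hm0 : (0 : ℝ) < m := by exact_mod_cast hm
      rw [Phi, sum_h_eq_top hobj hi₀, EReal.coe_mul_top_of_pos (by positivity)]
      exact bot_le
  · refine le_trans (le_of_eq ?_)
      (le_iSup _ fun i => p.yhat i x (lamTilde p.W Lam i))
    rw [Phi_eq hobj hm x Lam fun i => (hobj.yhat_spec i hx _).1]
    rfl

/-- Weak duality: on consensus points Y = 1yᵀ the dual term vanishes because the rows of W sum to
one, and the maximum over all Y is at least that over consensus points. -/
lemma primal_le_Pval (hobj : p.ObjAssumption) (hmix : p.MixAssumption) {x : E n₁}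
    (hx : x ∈ dom p.g) (Lam : Fin m → E n₂) : p.primal x ≤ (p.Pval x Lam : EReal) := by
  have hm := hmix.card_pos
  have hm0 : (0 : ℝ) < m := by exact_mod_cast hm
  refine iSup_le fun y => ?_
  by_cases hy : y ∈ dom p.h
  · rw [← P_eq hobj hm hx Lam]
    refine le_trans (le_of_eq ?_) (le_iSup _ fun _ => y)
    rw [Phi, sum_h_eq hobj (fun _ => hy), ← EReal.coe_mul, ← EReal.coe_sub,
      ← hobj.h_closed.coe_toReal hy, ← EReal.coe_sub, EReal.toReal_coe]
    congr 1
    simp only [← Finset.sum_smul, hmix.row_sum, one_smul, sub_self, inner_zero_right,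
      Finset.sum_const_zero, mul_zero, sub_zero, Finset.sum_const, Finset.card_univ,
      Fintype.card_fin, nsmul_eq_mul]
    rw [← mul_assoc (1 / (m : ℝ)), one_div_mul_cancel hm0.ne', one_mul]
  · have : p.h y = ⊤ := by simpa [dom] using hy
    rw [this]
    exact bot_le

/-- The optimal value. -/
def optVal (p : Problem m n₁ n₂) (xs : E n₁) : ℝ := (p.primal xs + p.g xs).toReal

lemma IsSolution.coe_optVal {xs : E n₁} (hxs : p.IsSolution xs) :
    (p.optVal xs : EReal) = p.primal xs + p.g xs :=
  EReal.coe_toReal hxs.2.1 hxs.2.2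

lemma IsSolution.optVal_le (hobj : p.ObjAssumption) (hmix : p.MixAssumption) {xs : E n₁}
    (hxs : p.IsSolution xs) {x : E n₁} (hx : x ∈ dom p.g) (Lam : Fin m → E n₂) :
    p.optVal xs ≤ p.Pval x Lam + (p.g x).toReal := by
  have h := hxs.1 x
  rw [← hxs.coe_optVal] at h
  have h2 : p.primal x + p.g x ≤ ((p.Pval x Lam + (p.g x).toReal : ℝ) : EReal) := by
    rw [EReal.coe_add, hobj.g_closed.coe_toReal hx]
    gcongr
    exact primal_le_Pval hobj hmix hx Lam
  exact_mod_cast h.trans h2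

lemma IsSolution.phi0_eq (hobj : p.ObjAssumption) (hmix : p.MixAssumption) {xs : E n₁}
    (hxs : p.IsSolution xs) {x0 : E n₁} (hx0 : x0 ∈ dom p.g) :
    p.phi0 x0 xs = p.Pval x0 (fun _ => 0) + (p.g x0).toReal - p.optVal xs := by
  rw [phi0, phi, P_eq hobj hmix.card_pos hx0, ← hxs.coe_optVal,
    ← hobj.g_closed.coe_toReal hx0, ← EReal.coe_add, ← EReal.coe_sub, EReal.toReal_coe,
    EReal.toReal_coe]

lemma IsSolution.phi0_nonneg (hobj : p.ObjAssumption) (hmix : p.MixAssumption) {xs : E n₁}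
    (hxs : p.IsSolution xs) {x0 : E n₁} (hx0 : x0 ∈ dom p.g) : 0 ≤ p.phi0 x0 xs := by
  rw [hxs.phi0_eq hobj hmix hx0]
  linarith [hxs.optVal_le hobj hmix hx0 fun _ => 0]

/-! ### Bounds along the run -/

lemma invariant_run (hobj : p.ObjAssumption) (hmix : p.MixAssumption)
    (hform : form = APGForm.extrapolated → p.ExtrapolationRegular) {x0 : E n₁}
    (hx0 : x0 ∈ dom p.g) {yinit : Fin m → E n₂} (hyinit : ∀ i, yinit i ∈ dom p.h) (t : ℕ) :
    p.Invariant t (p.run form p.ηx p.ηlam p.δ x0 yinit t) := by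
  induction t with
  | zero => exact invariant_init hobj hmix hform hx0 hyinit
  | succ t ih => exact ih.step hobj hmix hform

/-- At a consensual start with zero multipliers only the tracking error exceeds the objective gap;
12Lκη_x ≤ (1 − ρ)² makes it at most 1/6. -/
lemma merit_init_le (hobj : p.ObjAssumption) (hmix : p.MixAssumption) {xs : E n₁}
    (hxs : p.IsSolution xs) {x0 : E n₁} (hx0 : x0 ∈ dom p.g) {s : State m n₁ n₂}
    (hx : s.x = fun _ => x0) (hlam : s.lam = fun _ => 0)
    (hV : perpSq s.v ≤ 2 * m * p.L * p.κ * (1 - p.ρ)) :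
    p.merit s ≤ p.phi0 x0 xs + p.optVal xs + 1 / 6 := by
  have hm := hmix.card_pos
  have hm0 : (0 : ℝ) < m := by exact_mod_cast hm
  have hσ := hmix.one_sub_rho_pos
  have hσ1 := one_sub_rho_le_one (p := p)
  have hη := ηx_pos hobj hmix
  have hperp : perpSq (fun _ : Fin m => x0) = 0 := by
    rw [perpSq_eq, mean_const hm]; simp
  rw [hxs.phi0_eq hobj hmix hx0, merit, hx, hlam, mean_const hm, hperp]
  have h1 : p.ηx / (m * (1 - p.ρ) ^ 2) * perpSq s.v ≤
      p.ηx / (m * (1 - p.ρ) ^ 2) * (2 * m * p.L * p.κ * (1 - p.ρ)) := by gcongr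
  have h2 : p.ηx / (m * (1 - p.ρ) ^ 2) * (2 * m * p.L * p.κ * (1 - p.ρ)) ≤ 1 / 6 := by
    rw [div_mul_eq_mul_div, div_le_iff₀ (by positivity)]
    have h3 := ηx_mul_le hobj
    have h4 : 12 * (p.L * p.κ) * p.ηx * (m * (1 - p.ρ)) ≤ (1 - p.ρ) ^ 2 * (m * 1) := by gcongr
    linarith
  linarith

/-- The bound on all merit values and one-step displacements. -/
def meritBound (p : Problem m n₁ n₂) (φ₀ : ℝ) : ℝ := φ₀ + 1 + 1 / (6 * p.L * p.κ)

lemma displacement_bounds (hobj : p.ObjAssumption) (hmix : p.MixAssumption) {xs : E n₁}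
    (hxs : p.IsSolution xs) (hform : form = APGForm.extrapolated → p.ExtrapolationRegular)
    {x0 : E n₁} (hx0 : x0 ∈ dom p.g) {yinit : Fin m → E n₂} (hyinit : ∀ i, yinit i ∈ dom p.h)
    {s : ℕ → State m n₁ n₂} (hs : s = p.run form p.ηx p.ηlam p.δ x0 yinit)
    (hV : perpSq (s 0).v ≤ 2 * m * p.L * p.κ * (1 - p.ρ)) (t : ℕ) :
    ∑ i, ‖(s (t + 1)).x i - (s t).x i‖ ^ 2 ≤ 10 * m * p.ηx * p.meritBound (p.phi0 x0 xs) ∧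
      ∑ i, ‖(s (t + 1)).lam i - (s t).lam i‖ ^ 2 ≤
        2 * p.ηlam * p.meritBound (p.phi0 x0 xs) := by
  have hm := hmix.card_pos
  have hm0 : (0 : ℝ) < m := by exact_mod_cast hm
  have hσ := hmix.one_sub_rho_pos
  have hη := ηx_pos hobj hmix
  have hηl := ηlam_pos hobj hmix
  have hL := hobj.L_pos
  have hκ : 0 < p.κ := by linarith [hobj.one_le_κ]
  have hinv : ∀ t, p.Invariant t (s t) := fun t => by
    rw [hs]; exact invariant_run hobj hmix hform hx0 hyinit t
  have hstep : ∀ t, p.merit (s (t + 1)) + 1 / (2 * p.ηx) * ‖mean (s (t + 1)).x - mean (s t).x‖ ^ 2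
        + 1 / (2 * p.ηlam) * ∑ i, ‖(s (t + 1)).lam i - (s t).lam i‖ ^ 2 ≤
      p.merit (s t) +
        1 / (15 * (p.L * p.κ)) * (1 / (1 + (t : ℝ)) - 1 / (1 + ((t + 1 : ℕ) : ℝ))) :=
    fun t => (hinv t).merit_step_le hobj hmix hform (by rw [hs]; rfl)
  have hQ0 : ∀ t, 0 ≤ 1 / (2 * p.ηlam) * ∑ i, ‖(s (t + 1)).lam i - (s t).lam i‖ ^ 2 := fun t =>
    mul_nonneg (by positivity) (Finset.sum_nonneg fun _ _ => sq_nonneg _)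
  have hN0 : ∀ t, 0 ≤ 1 / (2 * p.ηx) * ‖mean (s (t + 1)).x - mean (s t).x‖ ^ 2 := fun t => by
    positivity
  set M := p.meritBound (p.phi0 x0 xs) with hM
  have hMval : M = p.phi0 x0 xs + 1 + 1 / (6 * p.L * p.κ) := rfl
  -- Adding the tail of the telescoping errors turns the merit into a nonincreasing sequence.
  have hbound : ∀ t, p.merit (s t) + 1 / (15 * (p.L * p.κ)) * (1 / (1 + (t : ℝ))) ≤
      M + p.optVal xs := by
    intro t
    induction t with
    | zero =>
      have h1 := merit_init_le hobj hmix hxs hx0 (s := s 0) (by rw [hs]; rfl) (by rw [hs]; rfl) hV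
      have h2 : 1 / (15 * (p.L * p.κ)) ≤ 1 / (6 * p.L * p.κ) := by
        rw [mul_assoc 6 p.L]; gcongr; norm_num
      simp only [Nat.cast_zero, add_zero, div_one, mul_one]
      linarith
    | succ t ih => linarith [hstep t, hQ0 t, hN0 t]
  have hpos : ∀ t : ℕ, 0 ≤ 1 / (15 * (p.L * p.κ)) * (1 / (1 + (t : ℝ))) := fun t => by positivity
  have hmerit : ∀ t, p.optVal xs + 1 / (2 * m * p.ηx) * perpSq (s t).x ≤ p.merit (s t) := by
    intro t
    have h1 := hxs.optVal_le hobj hmix (hobj.g_closed.mean_mem hm (hinv t).x_mem).1 (s t).lam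
    have h2 : 0 ≤ p.ηx / (m * (1 - p.ρ) ^ 2) * perpSq (s t).v :=
      mul_nonneg (by positivity) (perpSq_nonneg _)
    rw [merit]
    linarith
  have hX : ∀ t, perpSq (s t).x ≤ 2 * m * p.ηx * M := by
    intro t
    have h : 1 / (2 * m * p.ηx) * perpSq (s t).x ≤ M := by
      linarith [hmerit t, hbound t, hpos t]
    rw [one_div_mul_eq_div, div_le_iff₀ (by positivity)] at h
    linarith
  have hXp : 0 ≤ 1 / (2 * m * p.ηx) * perpSq (s (t + 1)).x :=
    mul_nonneg (by positivity) (perpSq_nonneg _)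
  have hN : ‖mean (s (t + 1)).x - mean (s t).x‖ ^ 2 ≤ 2 * p.ηx * M := by
    have h : 1 / (2 * p.ηx) * ‖mean (s (t + 1)).x - mean (s t).x‖ ^ 2 ≤ M := by
      linarith [hstep t, hmerit (t + 1), hbound t, hpos (t + 1), hQ0 t]
    rw [one_div_mul_eq_div, div_le_iff₀ (by positivity)] at h
    linarith
  constructor
  -- The constant 10 is 2 from the average plus 2·2 from each of the two consensus errors.
  · have hZ := sum_norm_sub_sq_le hm (s (t + 1)).x (s t).x
    have h1 := mul_le_mul_of_nonneg_left hN hm0.le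
    linarith [hX t, hX (t + 1)]
  · have h : 1 / (2 * p.ηlam) * ∑ i, ‖(s (t + 1)).lam i - (s t).lam i‖ ^ 2 ≤ M := by
      linarith [hstep t, hmerit (t + 1), hbound t, hpos (t + 1), hN0 t]
    rw [one_div_mul_eq_div, div_le_iff₀ (by positivity)] at h
    linarith

lemma δ_le_zero (hobj : p.ObjAssumption) (t : ℕ) : p.δ t ≤ p.δ 0 := by
  induction t with
  | zero => exact le_rfl
  | succ t ih => exact (δ_succ_le hobj t).trans ih

/-- The left side is what the warm-start estimate produces. The first summand of D absorbs the
displacement part, since 4κ + 1 ≤ 22κ²; its last two absorb the δ₀² part, since 3μ/2 ≤ L + 1 + μ²/2.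
-/
lemma le_D (hobj : p.ObjAssumption) (hmix : p.MixAssumption) {φ₀ : ℝ} (hφ : 0 ≤ φ₀) :
    2 * m * (1 - p.ρ) ^ 2 * p.meritBound φ₀ + 3 / (2 * p.μ) * p.δ 0 ^ 2 ≤ p.D φ₀ := by
  have hm0 : (0 : ℝ) < m := by exact_mod_cast hmix.card_pos
  have hσ := hmix.one_sub_rho_pos
  have hL := hobj.L_pos
  have hκ1 := hobj.one_le_κ
  have hκ : 0 < p.κ := by linarith
  have hμ := hobj.mu_pos
  have hM : 0 ≤ p.meritBound φ₀ := by unfold meritBound; positivity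
  have h1 : 2 * m * (1 - p.ρ) ^ 2 * p.meritBound φ₀ ≤
      (p.L * (11 + √m) + 22 * m * p.κ ^ 2 * (2 * p.L + p.L * √m + 2)) *
        (p.meritBound φ₀ * (1 - p.ρ) ^ 2 / (p.L * (4 * p.κ + 1))) := by
    have e : 2 * m * (1 - p.ρ) ^ 2 * p.meritBound φ₀ = 2 * m * (p.L * (4 * p.κ + 1)) *
        (p.meritBound φ₀ * (1 - p.ρ) ^ 2 / (p.L * (4 * p.κ + 1))) := by field_simp
    rw [e]
    gcongr
    have h2 : 2 * m * (p.L * (4 * p.κ + 1)) ≤ 22 * m * p.κ ^ 2 * (2 * p.L) := by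
      have : 4 * p.κ + 1 ≤ 22 * p.κ ^ 2 := by nlinarith
      calc 2 * m * (p.L * (4 * p.κ + 1)) ≤ 2 * m * (p.L * (22 * p.κ ^ 2)) := by gcongr
        _ = _ := by ring
    have h3 : 0 ≤ p.L * (11 + √m) + 22 * m * p.κ ^ 2 * (p.L * √m + 2) := by positivity
    linarith
  have h4 : 3 / (2 * p.μ) * p.δ 0 ^ 2 ≤
      (p.L + p.L * √m / 2 + 1) * (1 - p.ρ) ^ 4 / (64 * p.μ ^ 2 * p.κ ^ 2)
        + (1 - p.ρ) ^ 4 / (128 * p.κ ^ 2) := by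
    have e1 : 3 / (2 * p.μ) * p.δ 0 ^ 2 =
        3 / 2 * p.μ * ((1 - p.ρ) ^ 4 / (64 * p.μ ^ 2 * p.κ ^ 2)) := by
      simp only [δ, Nat.cast_zero, add_zero]; field_simp; ring
    have e2 : (p.L + p.L * √m / 2 + 1) * (1 - p.ρ) ^ 4 / (64 * p.μ ^ 2 * p.κ ^ 2)
        + (1 - p.ρ) ^ 4 / (128 * p.κ ^ 2) = (p.L + p.L * √m / 2 + 1 + p.μ ^ 2 / 2) *
        ((1 - p.ρ) ^ 4 / (64 * p.μ ^ 2 * p.κ ^ 2)) := by field_simp; ring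
    rw [e1, e2]
    gcongr
    have h5 : 0 ≤ p.L * √m / 2 := by positivity
    nlinarith [hobj.mu_le_L, sq_nonneg (p.μ - 1)]
  have h6 : 0 ≤ m * p.κ * (1 - p.ρ) ^ 2 * (p.L / 2 + p.κ ^ 2 * (2 * p.L + p.L * √m + 2))
      / (p.L * (1 + 6 * p.κ ^ 2)) := by positivity
  have h7 : 0 ≤ m * (p.L / 2 + p.κ ^ 2 * (2 * p.L + p.L * √m + 2)) * (1 - p.ρ) ^ 4
      / (64 * p.L ^ 2 * p.κ ^ 2) := by positivity
  rw [D]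
  rw [meritBound] at h1 ⊢
  linarith

/-- Warm starts have a uniformly bounded gap. -/
lemma gap_warm_start_le (hobj : p.ObjAssumption) (hmix : p.MixAssumption) {xs : E n₁}
    (hxs : p.IsSolution xs) (hform : form = APGForm.extrapolated → p.ExtrapolationRegular)
    {x0 : E n₁} (hx0 : x0 ∈ dom p.g) {yinit : Fin m → E n₂} (hyinit : ∀ i, yinit i ∈ dom p.h)
    {s : ℕ → State m n₁ n₂} (hs : s = p.run form p.ηx p.ηlam p.δ x0 yinit)
    (hV : perpSq (s 0).v ≤ 2 * m * p.L * p.κ * (1 - p.ρ)) (t : ℕ) (i : Fin m) :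
    p.gap i ((s (t + 1)).x i) (lamTilde p.W (s (t + 1)).lam i) ((s t).y i) ≤
      p.D (p.phi0 x0 xs) := by
  have hinv : ∀ t, p.Invariant t (s t) := fun t => by
    rw [hs]; exact invariant_run hobj hmix hform hx0 hyinit t
  have hm0 : (0 : ℝ) < m := by exact_mod_cast hmix.card_pos
  have hL := hobj.L_pos
  have hκ : 0 < p.κ := by linarith [hobj.one_le_κ]
  have hμ := hobj.mu_pos
  have hφ := hxs.phi0_nonneg hobj hmix hx0
  obtain ⟨hZ, hQ⟩ := displacement_bounds hobj hmix hxs hform hx0 hyinit hs hV t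
  have hM : 0 ≤ p.meritBound (p.phi0 x0 xs) := by unfold meritBound; positivity
  set M := p.meritBound (p.phi0 x0 xs)
  have hgap := ((hinv t).y_approx i).gap_le hobj ((hinv t).x_mem i) ((hinv (t + 1)).x_mem i)
    (lt' := lamTilde p.W (s (t + 1)).lam i)
  have ha : ‖(s (t + 1)).x i - (s t).x i‖ ^ 2 ≤ 10 * m * p.ηx * M :=
    (Finset.single_le_sum (f := fun i => ‖(s (t + 1)).x i - (s t).x i‖ ^ 2)
      (fun _ _ => sq_nonneg _) (Finset.mem_univ i)).trans hZ
  have hb : ‖lamTilde p.W (s (t + 1)).lam i - lamTilde p.W (s t).lam i‖ ^ 2 ≤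
      8 * p.ηlam * M := by
    have h1 := hmix.sum_norm_lamTilde_sq_le (fun i => (s (t + 1)).lam i - (s t).lam i)
    simp only [← lamTilde_sub] at h1
    have h2 := Finset.single_le_sum
      (f := fun i => ‖lamTilde p.W (s (t + 1)).lam i - lamTilde p.W (s t).lam i‖ ^ 2)
      (fun _ _ => sq_nonneg _) (Finset.mem_univ i)
    linarith
  refine hgap.trans (le_trans ?_ (le_D hobj hmix hφ))
  set a := ‖(s (t + 1)).x i - (s t).x i‖
  set b := ‖lamTilde p.W (s (t + 1)).lam i - lamTilde p.W (s t).lam i‖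
  have hδ : p.δ t ^ 2 ≤ p.δ 0 ^ 2 :=
    pow_le_pow_left₀ (δ_pos hobj hmix t).le (δ_le_zero hobj t) 2
  have hm : √(m : ℝ) ^ 2 = m := Real.sq_sqrt hm0.le
  have hσ2 : 0 ≤ (1 - p.ρ) ^ 2 := sq_nonneg _
  calc (p.δ t + p.L * a + p.L * √m / 2 * b) ^ 2 / (2 * p.μ)
      ≤ 3 * (p.δ t ^ 2 + (p.L * a) ^ 2 + (p.L * √m / 2 * b) ^ 2) / (2 * p.μ) := by
        gcongr; exact add_add_sq_le _ _ _
    _ = 3 / (2 * p.μ) * p.δ t ^ 2 + 3 / 2 * (p.L * p.κ) * a ^ 2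
        + 3 / 8 * (p.L * p.κ) * √m ^ 2 * b ^ 2 := by
        rw [κ]; field_simp; ring
    _ = 3 / (2 * p.μ) * p.δ t ^ 2 + 3 / 2 * (p.L * p.κ) * a ^ 2
        + 3 / 8 * (p.L * p.κ) * m * b ^ 2 := by rw [hm]
    _ ≤ 3 / (2 * p.μ) * p.δ 0 ^ 2 + 3 / 2 * (p.L * p.κ) * (10 * m * p.ηx * M)
        + 3 / 8 * (p.L * p.κ) * m * (8 * p.ηlam * M) := by gcongr
    -- Regrouped so that each step size meets its own bound; the total 5/4 + 1/3 stays below 2.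
    _ = 3 / (2 * p.μ) * p.δ 0 ^ 2 + 5 / 4 * (m * M) * (12 * (p.L * p.κ) * p.ηx)
        + 1 / 3 * (m * M) * (9 * (p.L * p.κ) * p.ηlam) := by ring
    _ ≤ 3 / (2 * p.μ) * p.δ 0 ^ 2 + 5 / 4 * (m * M) * (1 - p.ρ) ^ 2
        + 1 / 3 * (m * M) * (1 - p.ρ) ^ 2 := by
        gcongr
        · exact ηx_mul_le hobj
        · exact ηlam_mul_le hobj
    _ ≤ _ := by
        have : 0 ≤ m * M * (1 - p.ρ) ^ 2 := by positivity
        linarith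

/-! ### Counting gradient evaluations -/

/-- Truncating the logarithm at 0 makes the estimate "ceiling at most argument plus one" available,
and covers the minimal budget 1 as well. -/
lemma apgBudget_le (i : Fin m) (x : E n₁) (lt y₀ : E n₂) (δ : ℝ) :
    (p.apgBudget i x lt y₀ δ : ℝ) ≤
      √p.κy * max 0 (Real.log (16 * p.Ly * p.gap i x lt y₀ / δ ^ 2)) + 1 := by
  set z := Real.log (16 * p.Ly * p.gap i x lt y₀ / δ ^ 2)
  have h0 : 0 ≤ √p.κy * max 0 z := mul_nonneg (Real.sqrt_nonneg _) (le_max_left _ _)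
  have h1 : (⌈√p.κy * z⌉₊ : ℝ) ≤ √p.κy * max 0 z + 1 := by
    have h2 : √p.κy * z ≤ √p.κy * max 0 z :=
      mul_le_mul_of_nonneg_left (le_max_right _ _) (Real.sqrt_nonneg _)
    have h3 : (⌈√p.κy * z⌉₊ : ℝ) ≤ ⌈√p.κy * max 0 z⌉₊ := by exact_mod_cast Nat.ceil_mono h2
    exact h3.trans (Nat.ceil_lt_add_one h0).le
  rw [apgBudget, Nat.cast_max]
  exact max_le (by push_cast; linarith) h1

/-- The first local solve. -/
lemma apgBudget_init_le (hobj : p.ObjAssumption) (hmix : p.MixAssumption) (i : Fin m) (x : E n₁)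
    (lt y₀ : E n₂) :
    (p.apgBudget i x lt y₀ (p.δ 0) : ℝ) ≤ √p.κy * max 0 (Real.log
      (1024 * p.κ ^ 2 * p.Ly * p.gap i x lt y₀ / (1 - p.ρ) ^ 4)) + 1 := by
  have hσ := hmix.one_sub_rho_pos
  have hκ : 0 < p.κ := by linarith [hobj.one_le_κ]
  have e : 16 * p.Ly * p.gap i x lt y₀ / p.δ 0 ^ 2 =
      1024 * p.κ ^ 2 * p.Ly * p.gap i x lt y₀ / (1 - p.ρ) ^ 4 := by
    simp only [δ, Nat.cast_zero, add_zero]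
    field_simp
    ring
  rw [← e]
  exact apgBudget_le i x lt y₀ _

/-- A later local solve. -/
lemma apgBudget_warm_start_le (hobj : p.ObjAssumption) (hmix : p.MixAssumption) {φ₀ : ℝ}
    (hφ : 0 ≤ φ₀) {T t : ℕ} (ht : t + 1 ≤ T) (i : Fin m) {x : E n₁} {lt y₀ : E n₂}
    (hgap0 : 0 ≤ p.gap i x lt y₀) (hgap : p.gap i x lt y₀ ≤ p.D φ₀) :
    (p.apgBudget i x lt y₀ (p.δ (t + 1)) : ℝ) ≤ √p.κy * Real.log
      (1024 * p.κ ^ 2 * p.Ly * p.D φ₀ * (T + 1) ^ 2 / (1 - p.ρ) ^ 4) + 1 := by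
  have hσ := hmix.one_sub_rho_pos
  have hκ : 0 < p.κ := by linarith [hobj.one_le_κ]
  have hLy := hobj.Ly_pos
  have hL := hobj.L_pos
  have hμ := hobj.mu_pos
  set A := 1024 * p.κ ^ 2 * p.Ly * p.D φ₀ * (T + 1) ^ 2 / (1 - p.ρ) ^ 4 with hA
  have hD0 : 0 ≤ p.D φ₀ := hgap0.trans hgap
  -- This removes the truncation: log A is nonnegative. It holds because D is at least 3δ₀²/(2μ),
  -- where 24 = 1024·3/(2·64).
  have hA1 : 1 ≤ A := by
    rw [hA, one_le_div (by positivity)]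
    have h1 := le_D hobj hmix hφ
    have h2 : 0 ≤ 2 * m * (1 - p.ρ) ^ 2 * p.meritBound φ₀ := by
      unfold meritBound; positivity
    have h3 : 3 / (2 * p.μ) * p.δ 0 ^ 2 ≤ p.D φ₀ := by linarith
    have h4 : (1 : ℝ) ≤ (T + 1) ^ 2 := by
      have : (0 : ℝ) ≤ T := by positivity
      nlinarith
    have h5 : p.Ly / p.μ ≥ 1 := hobj.one_le_κy
    calc (1 - p.ρ) ^ 4 ≤ 24 * (p.Ly / p.μ) * (1 - p.ρ) ^ 4 := by
          apply le_mul_of_one_le_left (by positivity); linarith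
      _ = 1024 * p.κ ^ 2 * p.Ly * (3 / (2 * p.μ) * p.δ 0 ^ 2) := by
          simp only [δ, Nat.cast_zero, add_zero]; field_simp; ring
      _ ≤ 1024 * p.κ ^ 2 * p.Ly * p.D φ₀ := by gcongr
      _ ≤ _ := le_mul_of_one_le_right (by positivity) h4
  refine (apgBudget_le i x lt y₀ _).trans ?_
  gcongr
  refine max_le (Real.log_nonneg hA1) ?_
  rcases hgap0.eq_or_lt with h0 | h0
  · rw [← h0, mul_zero, zero_div, Real.log_zero]
    exact Real.log_nonneg hA1
  have hδ := δ_pos hobj hmix (t + 1)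
  apply Real.log_le_log (by positivity)
  have e : 16 * p.Ly * p.gap i x lt y₀ / p.δ (t + 1) ^ 2 =
      1024 * p.κ ^ 2 * p.Ly * p.gap i x lt y₀ * (1 + ((t + 1 : ℕ) : ℝ)) ^ 2 / (1 - p.ρ) ^ 4 := by
    rw [δ]; field_simp; ring
  -- The solve with tolerance δ_{t+1} sees the factor t + 2, which the horizon factor T + 1 covers
  -- since t + 1 ≤ T.
  have hle : 1 + ((t + 1 : ℕ) : ℝ) ≤ T + 1 := by
    have : ((t + 1 : ℕ) : ℝ) ≤ T := by exact_mod_cast ht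
    linarith
  rw [e, hA]
  gcongr

end Problem

end DGDMax
end

/-! ### Accuracy and total count. -/

theorem mainTheorem5 {m n₁ n₂ : ℕ} (p : DGDMax.Problem m n₁ n₂)
    (hobj : p.ObjAssumption) (hmix : p.MixAssumption)
    (xs : DGDMax.E n₁) (hxs : p.IsSolution xs)
    (form : DGDMax.APGForm)
    (hform : form = DGDMax.APGForm.extrapolated → p.ExtrapolationRegular)
    (x0 : DGDMax.E n₁) (hx0 : x0 ∈ DGDMax.dom p.g)
    (yinit : Fin m → DGDMax.E n₂) (hyinit : ∀ i, yinit i ∈ DGDMax.dom p.h)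
    (s : ℕ → DGDMax.State m n₁ n₂)
    (hs : s = p.run form p.ηx p.ηlam p.δ x0 yinit)
    (hV : DGDMax.perpSq (s 0).v ≤ 2 * m * p.L * p.κ * (1 - p.ρ))
    (ε : ℝ) (hε : 0 < ε) (T : ℕ) (hT : T = p.iterCount ε (p.phi0 x0 xs)) :
    (∀ t i, Metric.infEDist 0
        (DGDMax.superdiff (p.d i ((s t).x i) (DGDMax.lamTilde p.W (s t).lam i)) ((s t).y i))
          ≤ ENNReal.ofReal (p.δ t)) ∧
    ∀ i, ((s T).evals i : ℝ) ≤
      √p.κy * max 0 (Real.log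
          (1024 * p.κ ^ 2 * p.Ly * p.gap i x0 0 (yinit i) / (1 - p.ρ) ^ 4))
        + T * √p.κy * Real.log
          (1024 * p.κ ^ 2 * p.Ly * p.D (p.phi0 x0 xs) * (T + 1) ^ 2 / (1 - p.ρ) ^ 4)
        + T + 1 := by
  have hinv : ∀ t, p.Invariant t (s t) := fun t => by
    rw [hs]; exact DGDMax.Problem.invariant_run hobj hmix hform hx0 hyinit t
  refine ⟨fun t i => ((hinv t).y_approx i).infEDist_le hobj ((hinv t).x_mem i), fun i => ?_⟩
  have hφ := hxs.phi0_nonneg hobj hmix hx0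
  -- The logarithm is kept at the final T while the prefactor counts t, so every later solve adds
  -- the same amount. The extra 1 is the rounding of the initial solve.
  have key : ∀ t ≤ T, ((s t).evals i : ℝ) ≤
      √p.κy * max 0 (Real.log
          (1024 * p.κ ^ 2 * p.Ly * p.gap i x0 0 (yinit i) / (1 - p.ρ) ^ 4))
        + t * √p.κy * Real.log
          (1024 * p.κ ^ 2 * p.Ly * p.D (p.phi0 x0 xs) * (T + 1) ^ 2 / (1 - p.ρ) ^ 4)
        + t + 1 := by
    intro t
    induction t with
    | zero =>
      intro _
      have e : (s 0).evals i = p.apgBudget i x0 0 (yinit i) (p.δ 0) := by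
        rw [hs, ← DGDMax.Problem.solveY_evals form]
        rfl
      rw [e, Nat.cast_zero, zero_mul, zero_mul, add_zero, add_zero]
      exact DGDMax.Problem.apgBudget_init_le hobj hmix i x0 0 (yinit i)
    | succ t ih =>
      intro ht
      have e : (s (t + 1)).evals i = (s t).evals i +
          p.apgBudget i ((s (t + 1)).x i) (DGDMax.lamTilde p.W (s (t + 1)).lam i) ((s t).y i)
            (p.δ (t + 1)) := by
        rw [hs, ← DGDMax.Problem.solveY_evals form]
        rfl
      have h := DGDMax.Problem.apgBudget_warm_start_le hobj hmix hφ ht i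
        (hobj.gap_nonneg i ((hinv (t + 1)).x_mem i) _ ((hinv t).y_approx i).mem_dom)
        (DGDMax.Problem.gap_warm_start_le hobj hmix hxs hform hx0 hyinit hs hV t i)
      have ih' := ih (Nat.le_of_succ_le ht)
      rw [e]
      push_cast
      linarith
  exact key T le_rfl
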